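/- **Notation.** Let $d\ge 1$; $\mathcal S$ and $\mathcal S'$ are the complex-valued Schwartz functions and the tempered distributions on $\mathbb R^d$, $(f,\psi)$ is the (bilinear) pairing, $\tilde\psi(x)=\psi(-x)$, and $(f*\psi)(x)=(f,\psi(x-\cdot))$. Write $f\in\mathcal S'_n$ if $(f,\psi)\ge0$ for all nonnegative real-valued $\psi\in\mathcal S$; $f\in\mathcal S'_{nd}$ if $(f,\psi*\bar{\tilde\psi})\ge 0$ for all $\psi\in\mathcal S$; and let $C_{nd}$ be the set of continuous functions $f:\mathbb R^d\to\mathbb C$ with $\iint f(x-y)\psi(x)\bar\psi(y)\,dx\,dy\ge0$ for all $\psi\in\mathcal S$. The corresponding measure of $f\in\mathcal S'_n$ is the nonnegative Borel measure $\mu$, with $\int(1+|x|^2)^{-k/2}\mu(dx)<\infty$ for some $k\in[0,\infty)$, such that $(f,\psi)=\int\psi\,d\mu$ for all $\psi\in\mathcal S$. Let $\mathcal H$ be the Hilbert space obtained by completing $\mathcal S$ (modulo null vectors) under $\langle\phi,\psi\rangle_{\mathcal H}=(f,\phi*\tilde{\bar\psi})$, let $\{e_k\}$ be a (countable) complete orthonormal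 basis of $\mathcal H$ made of real-valued Schwartz functions, and put $v_k=f*e_k$, $\boldsymbol v=(v_1,v_2,\dots)$. For $\gamma\in\mathbb R$ and $p\in(1,\infty)$ let $$\|g\|_{H^\gamma_p(l_2)}=\big\|\,|(1-\Delta)^{\gamma/2}g|_{l_2}\big\|_{L_p(\mathbb R^d)}$$ for sequences $g=(g^1,g^2,\dots)$ of tempered distributions. For $\gamma>0$ let $R_\gamma$ be the Bessel kernel, $(1-\Delta)^{-\gamma/2}u=R_\gamma*u$, that is $$R_\gamma(x)=\frac{(4\pi)^{-d/2}}{\Gamma(\gamma/2)}\int_0^\infty t^{\frac{\gamma-d}{2}-1}e^{-t-\frac{|x|^2}{4t}}\,dt .$$ Conventions: $\frac1\infty=0$, $\frac{\infty}{\infty}=1$. **Lemma.** (a) Let $f\in\mathcal S'_n\cap\mathcal S'_{nd}$ with corresponding measure $\mu$, and let $k\in[0,\infty)$ be such that $$A:=\int_{\mathbb R^d}\frac{1}{(1+|x|^2)^{k/2}}\,\mu(dx)<\infty .$$ Assume that one of the following holds: (i) $d=1$, $\gamma\in[0,1/2)$, $s\in\big(\frac1{1-2\gamma},\infty\big]$;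 (ii) $d\ge2$, $\gamma\in[0,1)$, $s\in\big(\frac d{1-\gamma},\infty\big]$, and $\displaystyle\int_{|x|<1}|x|^{\frac{s(1-\gamma-d)}{s-1}}\mu(dx)<\infty$. Let $r,p<\infty$ satisfy $\frac1s+\frac1r=1$ and $2\le 2r\le p$. Then $$I:=\int_{\mathbb R^d}\big(R_{1-\gamma}^r*R_{1-\gamma}^r\big)(x)\,(1+|x|^2)^{k(r-1)/2}\,\mu(dx)<\infty,$$ and for all $\xi\in L_{2s}(\mathbb R^d)$ and $u\in L_p(\mathbb R^d)$ the functions $\xi uv_k$ define tempered distributions and $$\|\xi u\boldsymbol v\|_{H_p^{\gamma-1}(l_2)}\le A^{1/2s}I^{1/2r}\|\xi\|_{L_{2s}}\|u\|_{L_p}.$$ (b) Let $f\in\mathcal S'_n\cap C_{nd}$, $\gamma\in[0,1)$, $s\in(1,\infty]$ with $\frac d{1-\gamma}<s$, and let $r,p<\infty$ satisfy $\frac1s+\frac1r=1$ and $2\le2r\le p$. Then $N:=\sup_{x\in\mathbb R^d}|f(x)|$ and $\|R_{1-\gamma}\|_{L_r}$ are finite, and for all $\xi\in L_s(\mathbb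 R^d)$ and $u\in L_p(\mathbb R^d)$ the functions $\xi uv_k$ define tempered distributions and $$\|\xi u\boldsymbol v\|_{H_p^{\gamma-1}(l_2)}\le N^{1/2}\|\xi\|_{L_s}\|R_{1-\gamma}\|_{L_r}\|u\|_{L_p}.$$ -/

import Mathlib

open MeasureTheory
open scoped SchwartzMap ENNReal ComplexOrder

noncomputable section

namespace ColoredNoise

/-- The Euclidean space `ℝ^d`. -/
abbrev Rd (d : ℕ) : Type := EuclideanSpace ℝ (Fin d)

variable {d : ℕ}

/-! ### Schwartz functions and tempered distributions -/

/-- For a Schwartz function `φ` and a point `x`, the Schwartz function `y ↦ φ (x - y)`. -/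
def reflectAt (x : Rd d) (φ : 𝓢(Rd d, ℂ)) : 𝓢(Rd d, ℂ) :=
  SchwartzMap.compSubConstCLM ℂ x
    (SchwartzMap.compCLMOfContinuousLinearEquiv ℂ (ContinuousLinearEquiv.neg ℝ) φ)

@[simp]
theorem reflectAt_apply (x y : Rd d) (φ : 𝓢(Rd d, ℂ)) : reflectAt x φ y = φ (x - y) := by
  simp [reflectAt]

/-- For a Schwartz function `ψ`, the Schwartz function `x ↦ conj (ψ (-x))`. -/
def conjReflect (ψ : 𝓢(Rd d, ℂ)) : 𝓢(Rd d, ℂ) :=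
  SchwartzMap.postcompCLM (𝕜 := ℝ) (Complex.conjCLE : ℂ →L[ℝ] ℂ)
    (SchwartzMap.compCLMOfContinuousLinearEquiv ℝ (ContinuousLinearEquiv.neg ℝ) ψ)

@[simp]
theorem conjReflect_apply (x : Rd d) (ψ : 𝓢(Rd d, ℂ)) :
    conjReflect ψ x = (starRingEnd ℂ) (ψ (-x)) := by
  simp [conjReflect]

/-- The convolution `φ * ψ` of two Schwartz functions, as a Schwartz function. -/
def conv (φ ψ : 𝓢(Rd d, ℂ)) : 𝓢(Rd d, ℂ) :=
  SchwartzMap.convolution (ContinuousLinearMap.mul ℂ ℂ) φ ψ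

theorem conv_apply (φ ψ : 𝓢(Rd d, ℂ)) (x : Rd d) :
    conv φ ψ x = ∫ y, φ y * ψ (x - y) := by
  simp [conv, SchwartzMap.convolution_apply, MeasureTheory.convolution_def]

/-- The tempered distribution `T` is given by integration against the function `g`. -/
def IsRepresentedBy (T : 𝓢'(Rd d, ℂ)) (g : Rd d → ℂ) : Prop :=
  ∀ φ : 𝓢(Rd d, ℂ), Integrable (fun x => φ x * g x) ∧ T φ = ∫ x, φ x * g x

/-- Nonnegative tempered distributions: `(f, ψ) ≥ 0` for every nonnegative (in particular
real-valued) Schwartz function `ψ`.  The order on `ℂ` is the usual partial order, so that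
`0 ≤ z` says that `z` is real and nonnegative. -/
def IsNonnegDist (f : 𝓢'(Rd d, ℂ)) : Prop :=
  ∀ ψ : 𝓢(Rd d, ℂ), (∀ x, 0 ≤ ψ x) → 0 ≤ f ψ

/-- Nonnegative definite tempered distributions: `(f, ψ * conj ψ(-·)) ≥ 0` for every Schwartz
function `ψ`. -/
def IsNonnegDefDist (f : 𝓢'(Rd d, ℂ)) : Prop :=
  ∀ ψ : 𝓢(Rd d, ℂ), 0 ≤ f (conv ψ (conjReflect ψ))

/-- Continuous nonnegative definite functions:
`∫∫ h (x - y) ψ x conj (ψ y) dx dy ≥ 0` for every Schwartz function `ψ`. -/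
def IsNonnegDefFun (h : Rd d → ℂ) : Prop :=
  Continuous h ∧ ∀ ψ : 𝓢(Rd d, ℂ),
    Integrable (fun z : Rd d × Rd d => h (z.1 - z.2) * ψ z.1 * (starRingEnd ℂ) (ψ z.2)) ∧
    0 ≤ ∫ x, ∫ y, h (x - y) * ψ x * (starRingEnd ℂ) (ψ y)

/-- `∫ (1 + |x|²)^(-k/2) μ(dx)`. -/
def temperedMass (μ : Measure (Rd d)) (k : ℝ) : ℝ≥0∞ :=
  ∫⁻ x, ENNReal.ofReal (1 / (1 + ‖x‖ ^ 2) ^ (k / 2)) ∂μ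

/-- `μ` is the corresponding measure of `f`: it is a tempered measure and
`(f, ψ) = ∫ ψ dμ` for every Schwartz function `ψ`. -/
def IsCorrespondingMeasure (f : 𝓢'(Rd d, ℂ)) (μ : Measure (Rd d)) : Prop :=
  (∃ k : ℝ, 0 ≤ k ∧ temperedMass μ k < ⊤) ∧ ∀ ψ : 𝓢(Rd d, ℂ), f ψ = ∫ x, ψ x ∂μ

/-! ### The Hilbert space of the noise and its bases -/

/-- The sesquilinear form `⟨φ, ψ⟩ = (f, φ * conj ψ(-·))` on Schwartz functions. -/
def noiseInner (f : 𝓢'(Rd d, ℂ)) (φ ψ : 𝓢(Rd d, ℂ)) : ℂ :=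
  f (conv φ (conjReflect ψ))

/-- `e` is a complete orthonormal system, made of real-valued Schwartz functions, of the Hilbert
space obtained by completing the Schwartz space under `noiseInner f` (after dividing out the null
vectors, if there are any).  Since the Schwartz functions are dense in the completion, completeness
says that each of them is approximated by finite linear combinations of the `e k`. -/
structure IsNoiseBasis {ι : Type*} (f : 𝓢'(Rd d, ℂ)) (e : ι → 𝓢(Rd d, ℂ)) : Prop where
  real : ∀ k x, (e k x).im = 0
  norm_one : ∀ k, noiseInner f (e k) (e k) = 1
  orthogonal : ∀ j k, j ≠ k → noiseInner f (e j) (e k) = 0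
  complete : ∀ (φ : 𝓢(Rd d, ℂ)) (ε : ℝ), 0 < ε →
    ∃ ψ ∈ Submodule.span ℂ (Set.range e), (noiseInner f (φ - ψ) (φ - ψ)).re < ε

/-- The function `f ∗ φ`, that is `x ↦ (f, φ (x - ·))`. -/
def distConv (f : 𝓢'(Rd d, ℂ)) (φ : 𝓢(Rd d, ℂ)) (x : Rd d) : ℂ :=
  f (reflectAt x φ)

/-! ### Bessel potentials -/

/-- The operator `(1 - Δ)^(γ/2)` on tempered distributions.  Mathlib's Fourier transform is
`∫ exp (-2πi ⟨x, ξ⟩) u x dx`, so that `1 - Δ` has the symbol `1 + (2π|ξ|)²`. -/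
def besselOp (γ : ℝ) : 𝓢'(Rd d, ℂ) →L[ℂ] 𝓢'(Rd d, ℂ) :=
  TemperedDistribution.fourierMultiplierCLM ℂ
    (fun ξ : Rd d => (((1 + (2 * Real.pi * ‖ξ‖) ^ 2) ^ (γ / 2) : ℝ) : ℂ))

/-- The norm `‖ |(1 - Δ)^(γ/2) T|_{l₂} ‖_{L_p}` of a countable family `T` of tempered
distributions.  It is `∞` when some `(1 - Δ)^(γ/2) T k` is not a function; otherwise the functions
`G k` are determined up to null sets, and the infimum is over equal numbers. -/
def besselNorm {ι : Type*} (γ p : ℝ) (T : ι → 𝓢'(Rd d, ℂ)) : ℝ≥0∞ :=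
  ⨅ (G : ι → Rd d → ℂ) (_ : ∀ k, IsRepresentedBy (besselOp γ (T k)) (G k)),
    eLpNorm (fun x => (∑' k, ‖G k x‖ₑ ^ 2) ^ (1 / 2 : ℝ)) (ENNReal.ofReal p) volume

/-- The Bessel kernel `R_γ`, `γ > 0`, normalized so that `(1 - Δ)^(-γ/2) u = R_γ * u`:
`R_γ(x) = (4π)^(-d/2) Γ(γ/2)⁻¹ ∫₀^∞ t^((γ-d)/2-1) exp (-t - |x|²/(4t)) dt`
(substituting `t = |x|² τ` gives the form
`c |x|^(γ-d) ∫₀^∞ τ^((γ-d-2)/2) exp (-|x|² τ - 1/(4τ)) dτ`).  It may be `∞` at the origin. -/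
def besselKernel (γ : ℝ) (x : Rd d) : ℝ≥0∞ :=
  ENNReal.ofReal ((4 * Real.pi) ^ (-(d : ℝ) / 2) / Real.Gamma (γ / 2)) *
    ∫⁻ t in Set.Ioi (0 : ℝ),
      ENNReal.ofReal (t ^ ((γ - d) / 2 - 1) * Real.exp (-t - ‖x‖ ^ 2 / (4 * t)))

/-- `∫ (R_{1-γ}^r * R_{1-γ}^r)(x) (1 + |x|²)^(k(r-1)/2) μ(dx)`. -/
def kernelIntegral (μ : Measure (Rd d)) (k γ r : ℝ) : ℝ≥0∞ :=
  ∫⁻ x, (∫⁻ y, besselKernel (1 - γ) (x - y) ^ r * besselKernel (1 - γ) y ^ r) *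
    ENNReal.ofReal ((1 + ‖x‖ ^ 2) ^ (k * (r - 1) / 2)) ∂μ

/-- `s / (s - 1)`, with the convention `∞ / ∞ = 1`. -/
def conjRatio (s : ℝ≥0∞) : ℝ :=
  if s = ⊤ then 1 else s.toReal / (s.toReal - 1)

/-- The condition on `d`, `γ`, `s` and the corresponding measure `μ`:
`d = 1`, `γ ∈ [0, 1/2)`, `s ∈ (1/(1-2γ), ∞]`; or `d ≥ 2`, `γ ∈ [0, 1)`, `s ∈ (d/(1-γ), ∞]` and
`∫_{|x| < 1} |x|^(s(1-γ-d)/(s-1)) μ(dx) < ∞` (where `0` to a negative power is `∞`). -/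
def Admissible (μ : Measure (Rd d)) (γ : ℝ) (s : ℝ≥0∞) : Prop :=
  (d = 1 ∧ 0 ≤ γ ∧ γ < 1 / 2 ∧ ENNReal.ofReal (1 / (1 - 2 * γ)) < s) ∨
  (2 ≤ d ∧ 0 ≤ γ ∧ γ < 1 ∧ ENNReal.ofReal (d / (1 - γ)) < s ∧
    ∫⁻ x in Metric.ball (0 : Rd d) 1, ‖x‖ₑ ^ (conjRatio s * (1 - γ - d)) ∂μ < ⊤)

end ColoredNoise

end

open ColoredNoise

/-!
The operator `(1 - Δ)^((γ-1)/2)` is the convolution with the Bessel kernel `R = R_{1-γ}`: the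
Fourier transform of `R` is computed from its representation as a superposition of heat kernels
(`fourier_besselKernel`), and the identity passes to functions of tempered growth by duality
(`IsRepresentedBy.besselOp`). Hence the `k`-th Bessel potential at the point `x` is the integral of
`H_x(y) = R(x - y) ξ(y) u(y)` against `v_k = f ∗ e_k`, which is the inner product of `H_x` with
`e_k` in the Hilbert space of the noise. Bessel's inequality, first for Schwartz functions and then by
approximation, bounds the sum of the squares of these numbers by
`∫∫ |H_x(y)| |H_x(y - z)| dy μ(dz)`, the energy of `H_x` (`tsum_enorm_integral_sq_le_energy`). Only
the inequality is needed, so that the completeness of the basis plays no role.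

For a correlation measure, Hölder's inequality on `dy μ(dz)`, with the weight `(1 + |z|²)^(k/2)`
distributed between the two factors, separates `ξ` from `u` (`energy_le_of_holder`), and Minkowski's
and the Cauchy-Schwarz inequalities bound the factor with `u` in `L_{p/2r}`
(`lintegral_weightedAverage_rpow_le`). The finiteness of `I` (`kernelIntegral_lt_top`) follows from
the bound of `R` by `|x|^(-b) exp (-|x|/2)` for `b > d - (1 - γ)`, since the convolution square of
`|x|^(-σ-τ) exp (-|x|/2)` is at most of order `|x|^(-σ) exp (-|x|/4)` when `σ + 2 τ < d`.

A continuous correlation function `h` is nonnegative, since it is so on bump functions, and bounded: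
positivity of the form on `ρ - ρ(· - x)` bounds the mean of `h` around `x` by its mean around the
origin (`exists_norm_le_of_isNonnegDefDist`). Then `f` has the corresponding measure `h(z) dz`, the
energy of `H_x` is at most `N ‖H_x‖²` with the norm of `L_1`, and Hölder's and Young's inequalities
give the estimate.
-/

namespace ColoredNoise

variable {d : ℕ}

/-! ### Elementary inequalities and radial integrals -/

lemma rpow_le_rpow_self_mul_exp {a w : ℝ} (ha : 0 < a) (hw : 0 ≤ w) :
    w ^ a ≤ a ^ a * Real.exp w := by
  have h1 : w / a ≤ Real.exp (w / a) := by linarith [Real.add_one_le_exp (w / a)]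
  have h2 : (w / a) ^ a ≤ Real.exp (w / a) ^ a :=
    Real.rpow_le_rpow (by positivity) h1 ha.le
  rw [← Real.exp_mul, div_mul_cancel₀ _ ha.ne', Real.div_rpow hw ha.le,
    div_le_iff₀ (by positivity)] at h2
  linarith

lemma exists_one_add_rpow_le_exp (N : ℝ) {c : ℝ} (hc : 0 < c) :
    ∃ C : ℝ, 0 < C ∧ ∀ n : ℝ, 0 ≤ n → (1 + n) ^ N ≤ C * Real.exp (c * n) := by
  set M := max N 1
  have hM : 0 < M := lt_of_lt_of_le one_pos (le_max_right _ _)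
  refine ⟨(c ^ M)⁻¹ * (M ^ M * Real.exp c), by positivity, fun n hn => ?_⟩
  calc (1 + n) ^ N ≤ (1 + n) ^ M :=
        Real.rpow_le_rpow_of_exponent_le (by linarith) (le_max_left _ _)
    _ = (c ^ M)⁻¹ * (c * (1 + n)) ^ M := by
        rw [Real.mul_rpow hc.le (by linarith)]
        field_simp
    _ ≤ (c ^ M)⁻¹ * (M ^ M * Real.exp (c * (1 + n))) := by
        gcongr
        exact rpow_le_rpow_self_mul_exp hM (by positivity)
    _ = _ := by rw [mul_add, Real.exp_add, mul_one]; ring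

lemma nontrivial_Rd (hd : 1 ≤ d) : Nontrivial (Rd d) := by
  have : Nonempty (Fin d) := ⟨⟨0, hd⟩⟩
  exact Module.nontrivial_of_finrank_pos (R := ℝ) (by simp; omega)

lemma enorm_rpow_eq_ofReal {x : Rd d} (hx : x ≠ 0) (a : ℝ) :
    ‖x‖ₑ ^ a = ENNReal.ofReal (‖x‖ ^ a) := by
  rw [← ofReal_norm, ENNReal.ofReal_rpow_of_pos (norm_pos_iff.2 hx)]

/-- A radial function with singularity `|x|^(-a)`, `a < d`, and exponential decay is integrable. -/
lemma lintegral_enorm_rpow_mul_exp_lt_top (hd : 1 ≤ d) {a c : ℝ} (ha : a < d) (hc : 0 < c) :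
    ∫⁻ x : Rd d, ‖x‖ₑ ^ (-a) * ENNReal.ofReal (Real.exp (-(c * ‖x‖))) < ⊤ := by
  have := nontrivial_Rd hd
  have h1 : Integrable (fun x : Rd d => (fun n : ℝ => n ^ (-a) * Real.exp (-(c * n))) ‖x‖) := by
    rw [integrable_fun_norm_addHaar volume
      (f := fun n : ℝ => n ^ (-a) * Real.exp (-(c * n)))]
    have h2 := integrableOn_rpow_mul_exp_neg_mul_rpow (p := 1) (s := d - 1 - a) (b := c)
      (by linarith) one_pos hc
    refine h2.congr_fun (fun y hy => ?_) measurableSet_Ioi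
    have hy : (0 : ℝ) < y := hy
    simp only [finrank_euclideanSpace, Fintype.card_fin, smul_eq_mul, Real.rpow_one]
    rw [← mul_assoc, neg_mul]
    congr 1
    rw [← Real.rpow_natCast, ← Real.rpow_add hy, Nat.cast_sub hd, Nat.cast_one, ← sub_eq_add_neg]
  refine lt_of_le_of_lt (lintegral_mono_ae ?_) h1.lintegral_lt_top
  have h0 : ∀ᵐ x : Rd d, x ≠ 0 := by simp [ae_iff]
  filter_upwards [h0] with x hx
  rw [enorm_rpow_eq_ofReal hx, ← ENNReal.ofReal_mul (by positivity)]

/-! ### Bounds for the Bessel kernel -/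

lemma measurable_besselKernel (α : ℝ) : Measurable (besselKernel (d := d) α) := by
  unfold besselKernel
  refine Measurable.const_mul ?_ _
  refine Measurable.lintegral_prod_right' (f := fun z : Rd d × ℝ =>
    ENNReal.ofReal (z.2 ^ ((α - d) / 2 - 1) * Real.exp (-z.2 - ‖z.1‖ ^ 2 / (4 * z.2)))) ?_
  fun_prop

lemma besselKernel_congr_norm {α : ℝ} {x y : Rd d} (h : ‖x‖ = ‖y‖) :
    besselKernel α x = besselKernel α y := by
  simp [besselKernel, h]

lemma besselKernel_neg (α : ℝ) (x : Rd d) : besselKernel α (-x) = besselKernel α x :=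
  besselKernel_congr_norm (norm_neg x)

lemma besselKernel_sub_comm (α : ℝ) (x y : Rd d) :
    besselKernel α (x - y) = besselKernel α (y - x) :=
  besselKernel_congr_norm (norm_sub_rev x y)

/-- For every exponent `b > d - α` the Bessel kernel is dominated by `|x|^(-b) exp (-|x|/2)`.
Allowing `b` to exceed `d - α` avoids the logarithm in the critical case `α = d`. -/
lemma exists_besselKernel_le {α b : ℝ} (hb : 0 < b) (hbα : d - α < b) :
    ∃ C : ℝ≥0∞, C ≠ ⊤ ∧ ∀ x : Rd d, besselKernel α x ≤
      C * (‖x‖ₑ ^ (-b) * ENNReal.ofReal (Real.exp (-(1 / 2 * ‖x‖)))) := by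
  set a := b / 2 with ha_def
  have ha : 0 < a := by positivity
  set J : ℝ≥0∞ := ∫⁻ t in Set.Ioi (0 : ℝ),
    ENNReal.ofReal (t ^ ((α - d) / 2 - 1 + a) * Real.exp (-(1 / 2) * t ^ (1 : ℝ)))
  have hJ : J < ⊤ := (integrableOn_rpow_mul_exp_neg_mul_rpow (by linarith) one_pos
    (by norm_num)).lintegral_lt_top
  set c := ENNReal.ofReal ((4 * Real.pi) ^ (-(d : ℝ) / 2) / Real.Gamma (α / 2))
  refine ⟨c * (ENNReal.ofReal ((8 * a) ^ a) * J) + 1, ?_, fun x => ?_⟩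
  · exact ENNReal.add_ne_top.2 ⟨ENNReal.mul_ne_top ENNReal.ofReal_ne_top
      (ENNReal.mul_ne_top ENNReal.ofReal_ne_top hJ.ne), ENNReal.one_ne_top⟩
  by_cases hx : x = 0
  · subst hx
    simp [ENNReal.zero_rpow_of_neg (neg_lt_zero.2 hb)]
  have hn : 0 < ‖x‖ := norm_pos_iff.2 hx
  set n := ‖x‖ with hn_def
  have key : ∀ t ∈ Set.Ioi (0 : ℝ),
      ENNReal.ofReal (t ^ ((α - d) / 2 - 1) * Real.exp (-t - n ^ 2 / (4 * t))) ≤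
      ENNReal.ofReal ((8 * a) ^ a * (n ^ (-b) * Real.exp (-(1 / 2 * n)))) *
      ENNReal.ofReal (t ^ ((α - d) / 2 - 1 + a) * Real.exp (-(1 / 2) * t ^ (1 : ℝ))) := by
    intro t ht
    have ht : 0 < t := ht
    rw [← ENNReal.ofReal_mul (by positivity)]
    refine ENNReal.ofReal_le_ofReal ?_
    set w := n ^ 2 / (8 * t) with hw
    have hw0 : 0 < w := by positivity
    -- Half of the exponent is kept by the arithmetic-geometric mean inequality; the factor
    -- `exp (-w)` pays for the singularity.
    have h1 : -t - n ^ 2 / (4 * t) ≤ -(1 / 2 * n) + -(1 / 2) * t - w := by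
      have : t / 2 + n ^ 2 / (8 * t) - n / 2 = (2 * t - n) ^ 2 / (8 * t) := by
        field_simp; ring
      have h3 : 0 ≤ (2 * t - n) ^ 2 / (8 * t) := by positivity
      have h4 : n ^ 2 / (4 * t) = w + w := by rw [hw]; field_simp; ring
      linarith
    have h2 : Real.exp (-w) ≤ a ^ a * w ^ (-a) := by
      rw [Real.exp_neg, Real.rpow_neg hw0.le, ← div_eq_mul_inv, inv_eq_one_div,
        div_le_div_iff₀ (Real.exp_pos _) (by positivity), one_mul]
      exact rpow_le_rpow_self_mul_exp ha hw0.le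
    have h3 : w ^ (-a) = 8 ^ a * t ^ a * n ^ (-b) := by
      rw [hw, Real.div_rpow (by positivity) (by positivity), Real.mul_rpow (by norm_num) ht.le,
        ← Real.rpow_natCast, ← Real.rpow_mul hn.le, Real.rpow_neg (by norm_num : (0:ℝ) ≤ 8),
        Real.rpow_neg ht.le]
      have : ((2 : ℕ) : ℝ) * -a = -b := by rw [ha_def]; push_cast; ring
      rw [this]
      field_simp
    calc t ^ ((α - d) / 2 - 1) * Real.exp (-t - n ^ 2 / (4 * t))
        ≤ t ^ ((α - d) / 2 - 1) * Real.exp (-(1 / 2 * n) + -(1 / 2) * t - w) := by gcongr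
      _ = t ^ ((α - d) / 2 - 1) *
          (Real.exp (-(1 / 2 * n)) * Real.exp (-(1 / 2) * t) * Real.exp (-w)) := by
          rw [← Real.exp_add, ← Real.exp_add, sub_eq_add_neg _ w]
      _ ≤ t ^ ((α - d) / 2 - 1) *
          (Real.exp (-(1 / 2 * n)) * Real.exp (-(1 / 2) * t) * (a ^ a * w ^ (-a))) := by gcongr
      _ = _ := by
          rw [h3, Real.mul_rpow (by norm_num) ha.le, Real.rpow_add ht, Real.rpow_one]
          ring
  calc besselKernel α x ≤ c * ∫⁻ t in Set.Ioi (0 : ℝ),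
        ENNReal.ofReal ((8 * a) ^ a * (n ^ (-b) * Real.exp (-(1 / 2 * n)))) *
        ENNReal.ofReal (t ^ ((α - d) / 2 - 1 + a) * Real.exp (-(1 / 2) * t ^ (1 : ℝ))) := by
        unfold besselKernel
        exact mul_le_mul' le_rfl (setLIntegral_mono' measurableSet_Ioi key)
    _ = c * (ENNReal.ofReal ((8 * a) ^ a) * J) *
          (‖x‖ₑ ^ (-b) * ENNReal.ofReal (Real.exp (-(1 / 2 * n)))) := by
        rw [lintegral_const_mul' _ _ ENNReal.ofReal_ne_top, enorm_rpow_eq_ofReal hx,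
          ENNReal.ofReal_mul (by positivity), ENNReal.ofReal_mul (by positivity)]
        ring
    _ ≤ _ := by gcongr; exact le_self_add

/-- The Bessel kernel has finite moments of all orders. -/
lemma lintegral_besselKernel_mul_rpow_lt_top (hd : 1 ≤ d) {α : ℝ} (hα : 0 < α) (N : ℝ) :
    ∫⁻ x : Rd d, besselKernel α x * ENNReal.ofReal ((1 + ‖x‖) ^ N) < ⊤ := by
  have hd' : (1 : ℝ) ≤ d := by exact_mod_cast hd
  obtain ⟨b, hb1, hb2⟩ : ∃ b : ℝ, max 0 (d - α) < b ∧ b < d :=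
    exists_between (by rw [max_lt_iff]; constructor <;> linarith)
  rw [max_lt_iff] at hb1
  obtain ⟨C, hC, hle⟩ := exists_besselKernel_le (d := d) hb1.1 hb1.2
  obtain ⟨D, hD, hDle⟩ := exists_one_add_rpow_le_exp N (c := 1 / 4) (by norm_num)
  calc ∫⁻ x : Rd d, besselKernel α x * ENNReal.ofReal ((1 + ‖x‖) ^ N)
      ≤ ∫⁻ x : Rd d, (C * ENNReal.ofReal D) *
        (‖x‖ₑ ^ (-b) * ENNReal.ofReal (Real.exp (-(1 / 4 * ‖x‖)))) := by
        refine lintegral_mono fun x => ?_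
        refine (mul_le_mul' (hle x) (ENNReal.ofReal_le_ofReal (hDle _ (norm_nonneg x)))).trans ?_
        have : Real.exp (-(1 / 4 * ‖x‖)) =
            Real.exp (-(1 / 2 * ‖x‖)) * Real.exp (1 / 4 * ‖x‖) := by
          rw [← Real.exp_add]; congr 1; ring
        rw [this, ENNReal.ofReal_mul hD.le, ENNReal.ofReal_mul (Real.exp_pos _).le]
        apply le_of_eq
        ring
    _ < ⊤ := by
        rw [lintegral_const_mul' _ _ (ENNReal.mul_ne_top hC ENNReal.ofReal_ne_top)]
        exact ENNReal.mul_lt_top (ENNReal.mul_lt_top hC.lt_top ENNReal.ofReal_lt_top)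
          (lintegral_enorm_rpow_mul_exp_lt_top hd hb2 (by norm_num))

lemma lintegral_besselKernel_lt_top (hd : 1 ≤ d) {α : ℝ} (hα : 0 < α) :
    ∫⁻ x : Rd d, besselKernel α x < ⊤ := by
  simpa using lintegral_besselKernel_mul_rpow_lt_top hd hα 0

/-- The constant `1 / 2` of the exponential decay is kept, by giving away the factor `r ≥ 1`. -/
lemma exists_besselKernel_rpow_le {α b r : ℝ} (hb : 0 < b) (hbα : d - α < b) (hr : 1 ≤ r) :
    ∃ C : ℝ≥0∞, C ≠ ⊤ ∧ ∀ x : Rd d, besselKernel α x ^ r ≤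
      C * (‖x‖ₑ ^ (-(r * b)) * ENNReal.ofReal (Real.exp (-(1 / 2 * ‖x‖)))) := by
  obtain ⟨C, hC, hle⟩ := exists_besselKernel_le (d := d) hb hbα
  have hr0 : 0 ≤ r := by linarith
  refine ⟨C ^ r, ENNReal.rpow_ne_top_of_nonneg hr0 hC, fun x => ?_⟩
  refine (ENNReal.rpow_le_rpow (hle x) hr0).trans ?_
  rw [ENNReal.mul_rpow_of_nonneg _ _ hr0, ENNReal.mul_rpow_of_nonneg _ _ hr0, ← ENNReal.rpow_mul,
    ENNReal.ofReal_rpow_of_nonneg (Real.exp_pos _).le hr0, ← Real.exp_mul]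
  have : -b * r = -(r * b) := by ring
  rw [this]
  gcongr
  nlinarith [norm_nonneg x]

/-- The Bessel kernel belongs to `L_r` when `r (d - α) < d`. -/
lemma lintegral_besselKernel_rpow_lt_top (hd : 1 ≤ d) {α r : ℝ} (hr : 1 ≤ r)
    (hrα : r * (d - α) < d) :
    ∫⁻ x : Rd d, besselKernel α x ^ r < ⊤ := by
  have hd' : (1 : ℝ) ≤ d := by exact_mod_cast hd
  have hr0 : 0 < r := by linarith
  obtain ⟨b, hb1, hb2⟩ : ∃ b : ℝ, max 0 (d - α) < b ∧ b < d / r := by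
    exact exists_between (max_lt (div_pos (by linarith) hr0)
      ((lt_div_iff₀ hr0).2 (by linarith)))
  rw [max_lt_iff] at hb1
  rw [lt_div_iff₀ hr0] at hb2
  obtain ⟨C, hC, hle⟩ := exists_besselKernel_rpow_le (d := d) hb1.1 hb1.2 hr
  refine (lintegral_mono hle).trans_lt ?_
  rw [lintegral_const_mul' _ _ hC]
  exact ENNReal.mul_lt_top hC.lt_top
    (lintegral_enorm_rpow_mul_exp_lt_top hd (by linarith) (by norm_num))

lemma rpow_neg_mul_rpow_neg_le (a b : ℝ≥0∞) {p q : ℝ} (hp : 0 ≤ p) (hq : 0 ≤ q)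
    (ha : a ≠ 0) (ha' : a ≠ ⊤) (hb : b ≠ 0) (hb' : b ≠ ⊤) :
    a ^ (-p) * b ^ (-q) ≤ a ^ (-(p + q)) + b ^ (-(p + q)) := by
  rcases le_total a b with h | h
  · refine le_trans ?_ le_self_add
    rw [neg_add, ENNReal.rpow_add _ _ ha ha']
    refine mul_le_mul' le_rfl ?_
    rw [ENNReal.rpow_neg, ENNReal.rpow_neg]
    gcongr
  · refine le_trans ?_ le_add_self
    rw [neg_add, ENNReal.rpow_add _ _ hb hb']
    refine mul_le_mul' ?_ le_rfl
    rw [ENNReal.rpow_neg, ENNReal.rpow_neg]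
    gcongr

/-- The convolution square of `|x|^(-σ-τ) exp (-c|x|)` is at most of order `|x|^(-σ)` when
`σ + 2 τ < d`: one of the two factors is evaluated at distance at least `|x|/2`. -/
lemma exists_conv_square_le (hd : 1 ≤ d) {σ τ c : ℝ} (hσ : 0 ≤ σ) (hτ : 0 ≤ τ)
    (hστ : σ + 2 * τ < d) (hc : 0 < c) :
    ∃ C : ℝ≥0∞, C ≠ ⊤ ∧ ∀ x : Rd d,
      ∫⁻ y, (‖x - y‖ₑ ^ (-(σ + τ)) * ENNReal.ofReal (Real.exp (-(c * ‖x - y‖)))) *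
        (‖y‖ₑ ^ (-(σ + τ)) * ENNReal.ofReal (Real.exp (-(c * ‖y‖)))) ≤
      C * (‖x‖ₑ ^ (-σ) * ENNReal.ofReal (Real.exp (-(c / 2 * ‖x‖)))) := by
  have := nontrivial_Rd hd
  set g : Rd d → ℝ≥0∞ := fun y =>
    ‖y‖ₑ ^ (-(σ + 2 * τ)) * ENNReal.ofReal (Real.exp (-(c / 2 * ‖y‖)))
  have hg : Measurable g := by fun_prop
  set J := ∫⁻ y, g y
  have hJ : J < ⊤ := lintegral_enorm_rpow_mul_exp_lt_top hd hστ (by positivity)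
  refine ⟨2 ^ σ * (J + J), ENNReal.mul_ne_top (ENNReal.rpow_ne_top_of_nonneg hσ (by simp))
    (ENNReal.add_ne_top.2 ⟨hJ.ne, hJ.ne⟩), fun x => ?_⟩
  have hfar : ∀ z w : Rd d, z ≠ 0 → w ≠ 0 → ‖x‖ ≤ 2 * ‖z‖ →
      ‖z‖ₑ ^ (-(σ + τ)) * ‖w‖ₑ ^ (-(σ + τ)) ≤
      2 ^ σ * ‖x‖ₑ ^ (-σ) * (‖z‖ₑ ^ (-(σ + 2 * τ)) + ‖w‖ₑ ^ (-(σ + 2 * τ))) := by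
    intro z w hz hw hxz
    have hz0 : ‖z‖ₑ ≠ 0 := by simpa using hz
    have hw0 : ‖w‖ₑ ≠ 0 := by simpa using hw
    have h1 : ‖z‖ₑ ^ (-σ) ≤ 2 ^ σ * ‖x‖ₑ ^ (-σ) := by
      have h2 : ‖x‖ₑ ≤ 2 * ‖z‖ₑ := by
        rw [← ofReal_norm, ← ofReal_norm]
        refine (ENNReal.ofReal_le_ofReal hxz).trans ?_
        rw [ENNReal.ofReal_mul (by norm_num), ENNReal.ofReal_ofNat]
      have h3 : ‖x‖ₑ ^ σ ≤ 2 ^ σ * ‖z‖ₑ ^ σ := by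
        rw [← ENNReal.mul_rpow_of_nonneg _ _ hσ]
        exact ENNReal.rpow_le_rpow h2 hσ
      have h2σ : (2 : ℝ≥0∞) ^ σ ≠ 0 := by simp
      have h2σ' : (2 : ℝ≥0∞) ^ σ ≠ ⊤ := ENNReal.rpow_ne_top_of_nonneg hσ (by simp)
      rw [ENNReal.rpow_neg, ENNReal.rpow_neg]
      calc (‖z‖ₑ ^ σ)⁻¹ = 2 ^ σ * (2 ^ σ * ‖z‖ₑ ^ σ)⁻¹ := by
            rw [ENNReal.mul_inv (Or.inl h2σ) (Or.inl h2σ'), ← mul_assoc,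
              ENNReal.mul_inv_cancel h2σ h2σ', one_mul]
        _ ≤ _ := by gcongr
    calc ‖z‖ₑ ^ (-(σ + τ)) * ‖w‖ₑ ^ (-(σ + τ))
        = ‖z‖ₑ ^ (-σ) * (‖z‖ₑ ^ (-τ) * ‖w‖ₑ ^ (-(σ + τ))) := by
          rw [neg_add, ENNReal.rpow_add _ _ hz0 enorm_ne_top]; ring
      _ ≤ (2 ^ σ * ‖x‖ₑ ^ (-σ)) * (‖z‖ₑ ^ (-(τ + (σ + τ))) + ‖w‖ₑ ^ (-(τ + (σ + τ)))) := by
          gcongr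
          exact rpow_neg_mul_rpow_neg_le _ _ hτ (by linarith) hz0 enorm_ne_top hw0 enorm_ne_top
      _ = _ := by
          have : τ + (σ + τ) = σ + 2 * τ := by ring
          rw [this]
  have h0 : ∀ᵐ y : Rd d, y ≠ 0 := by simp [ae_iff]
  have hx0 : ∀ᵐ y : Rd d, y ≠ x := by simp [ae_iff]
  calc ∫⁻ y, (‖x - y‖ₑ ^ (-(σ + τ)) * ENNReal.ofReal (Real.exp (-(c * ‖x - y‖)))) *
        (‖y‖ₑ ^ (-(σ + τ)) * ENNReal.ofReal (Real.exp (-(c * ‖y‖))))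
      ≤ ∫⁻ y, (2 ^ σ * ‖x‖ₑ ^ (-σ) * ENNReal.ofReal (Real.exp (-(c / 2 * ‖x‖)))) *
        (g (x - y) + g y) := by
        refine lintegral_mono_ae ?_
        filter_upwards [h0, hx0] with y hy0 hyx
        have hxy : x - y ≠ 0 := sub_ne_zero.2 (Ne.symm hyx)
        have htri : ‖x‖ ≤ ‖x - y‖ + ‖y‖ := by simpa using norm_add_le (x - y) y
        have hpow : ‖x - y‖ₑ ^ (-(σ + τ)) * ‖y‖ₑ ^ (-(σ + τ)) ≤ 2 ^ σ * ‖x‖ₑ ^ (-σ) *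
            (‖x - y‖ₑ ^ (-(σ + 2 * τ)) + ‖y‖ₑ ^ (-(σ + 2 * τ))) := by
          rcases le_total ‖x - y‖ ‖y‖ with h | h
          · rw [mul_comm (‖x - y‖ₑ ^ _), add_comm (‖x - y‖ₑ ^ _)]
            exact hfar y (x - y) hy0 hxy (by linarith)
          · exact hfar (x - y) y hxy hy0 (by linarith)
        have hexp : ENNReal.ofReal (Real.exp (-(c * ‖x - y‖))) *
            ENNReal.ofReal (Real.exp (-(c * ‖y‖))) ≤
            ENNReal.ofReal (Real.exp (-(c / 2 * ‖x‖))) *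
              (ENNReal.ofReal (Real.exp (-(c / 2 * ‖x - y‖))) *
               ENNReal.ofReal (Real.exp (-(c / 2 * ‖y‖)))) := by
          rw [← ENNReal.ofReal_mul (by positivity), ← ENNReal.ofReal_mul (by positivity),
            ← ENNReal.ofReal_mul (by positivity), ← Real.exp_add, ← Real.exp_add, ← Real.exp_add]
          refine ENNReal.ofReal_le_ofReal (Real.exp_le_exp.2 ?_)
          nlinarith
        have hle1 : ∀ z : Rd d, ENNReal.ofReal (Real.exp (-(c / 2 * ‖z‖))) ≤ 1 := by
          intro z
          rw [← ENNReal.ofReal_one]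
          refine ENNReal.ofReal_le_ofReal (Real.exp_le_one_iff.2 ?_)
          have := norm_nonneg z
          nlinarith
        set A := ‖x - y‖ₑ ^ (-(σ + 2 * τ))
        set B := ‖y‖ₑ ^ (-(σ + 2 * τ))
        set E1 := ENNReal.ofReal (Real.exp (-(c / 2 * ‖x - y‖)))
        set E2 := ENNReal.ofReal (Real.exp (-(c / 2 * ‖y‖)))
        calc _ = (‖x - y‖ₑ ^ (-(σ + τ)) * ‖y‖ₑ ^ (-(σ + τ))) *
            (ENNReal.ofReal (Real.exp (-(c * ‖x - y‖))) *
              ENNReal.ofReal (Real.exp (-(c * ‖y‖)))) := by ring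
          _ ≤ (2 ^ σ * ‖x‖ₑ ^ (-σ) * (A + B)) *
            (ENNReal.ofReal (Real.exp (-(c / 2 * ‖x‖))) * (E1 * E2)) := mul_le_mul' hpow hexp
          _ = (2 ^ σ * ‖x‖ₑ ^ (-σ) * ENNReal.ofReal (Real.exp (-(c / 2 * ‖x‖)))) *
              (A * E1 * E2 + B * E2 * E1) := by ring
          _ ≤ (2 ^ σ * ‖x‖ₑ ^ (-σ) * ENNReal.ofReal (Real.exp (-(c / 2 * ‖x‖)))) *
              (A * E1 * 1 + B * E2 * 1) := by
              gcongr
              · exact hle1 _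
              · exact hle1 _
          _ = _ := by rw [mul_one, mul_one]
    _ = (2 ^ σ * ‖x‖ₑ ^ (-σ) * ENNReal.ofReal (Real.exp (-(c / 2 * ‖x‖)))) * (J + J) := by
        rw [lintegral_const_mul _ (by fun_prop), lintegral_add_left (by fun_prop),
          lintegral_sub_left_eq_self g x]
    _ = _ := by ring

/-- Finiteness of `kernelIntegral`, for exponents with `r b = σ + τ`. Near the origin the
integrability of `|x|^(-σ)` is used, far from it the finiteness of the tempered mass. -/
lemma kernelIntegral_lt_top_of_lintegral_ball (hd : 1 ≤ d) {μ : Measure (Rd d)} {k γ r b σ τ : ℝ}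
    (hμ : temperedMass μ k < ⊤) (hr : 1 ≤ r) (hb : 0 < b) (hbγ : d - (1 - γ) < b)
    (hσ : 0 ≤ σ) (hτ : 0 ≤ τ) (hrb : r * b = σ + τ) (hστ : σ + 2 * τ < d)
    (hball : ∫⁻ x in Metric.ball (0 : Rd d) 1, ‖x‖ₑ ^ (-σ) ∂μ < ⊤) :
    kernelIntegral μ k γ r < ⊤ := by
  obtain ⟨C, hC, hle⟩ := exists_besselKernel_rpow_le (d := d) hb hbγ hr
  obtain ⟨D, hD, hDle⟩ := exists_conv_square_le hd hσ hτ hστ (c := 1 / 2) (by norm_num)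
  have hconv : ∀ x : Rd d, (∫⁻ y, besselKernel (1 - γ) (x - y) ^ r * besselKernel (1 - γ) y ^ r) ≤
      C * C * D * (‖x‖ₑ ^ (-σ) * ENNReal.ofReal (Real.exp (-(1 / 4 * ‖x‖)))) := by
    intro x
    calc _ ≤ ∫⁻ y, (C * C) *
        ((‖x - y‖ₑ ^ (-(σ + τ)) * ENNReal.ofReal (Real.exp (-(1 / 2 * ‖x - y‖)))) *
        (‖y‖ₑ ^ (-(σ + τ)) * ENNReal.ofReal (Real.exp (-(1 / 2 * ‖y‖))))) := by
          refine lintegral_mono fun y => ?_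
          refine (mul_le_mul' (hle (x - y)) (hle y)).trans (le_of_eq ?_)
          rw [hrb]; ring
      _ ≤ (C * C) * (D * (‖x‖ₑ ^ (-σ) * ENNReal.ofReal (Real.exp (-(1 / 4 * ‖x‖))))) := by
          rw [lintegral_const_mul' _ _ (ENNReal.mul_ne_top hC hC)]
          gcongr
          refine (hDle x).trans (le_of_eq ?_)
          norm_num
      _ = _ := by ring
  set m := max (k * (r - 1) / 2 + k / 2) 0
  set q := max (k * (r - 1) / 2) 0
  obtain ⟨F, hF, hFle⟩ := exists_one_add_rpow_le_exp (2 * m) (c := 1 / 4) (by norm_num)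
  have hsq : ∀ x : Rd d, 1 + ‖x‖ ^ 2 ≤ (1 + ‖x‖) ^ 2 := fun x => by nlinarith [norm_nonneg x]
  have hnear : ∫⁻ x in Metric.ball (0 : Rd d) 1,
      (∫⁻ y, besselKernel (1 - γ) (x - y) ^ r * besselKernel (1 - γ) y ^ r) *
      ENNReal.ofReal ((1 + ‖x‖ ^ 2) ^ (k * (r - 1) / 2)) ∂μ < ⊤ := by
    refine lt_of_le_of_lt (setLIntegral_mono' (g := fun x =>
      (C * C * D * ENNReal.ofReal (2 ^ q)) * ‖x‖ₑ ^ (-σ)) measurableSet_ball ?_) ?_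
    · intro x hx
      have hx1 : ‖x‖ < 1 := by simpa using hx
      have h1 : ENNReal.ofReal (Real.exp (-(1 / 4 * ‖x‖))) ≤ 1 := by
        rw [← ENNReal.ofReal_one]
        refine ENNReal.ofReal_le_ofReal (Real.exp_le_one_iff.2 ?_)
        have := norm_nonneg x
        linarith
      have h2 : (1 + ‖x‖ ^ 2) ^ (k * (r - 1) / 2) ≤ 2 ^ q := by
        calc (1 + ‖x‖ ^ 2) ^ (k * (r - 1) / 2) ≤ (1 + ‖x‖ ^ 2) ^ q :=
              Real.rpow_le_rpow_of_exponent_le (by nlinarith [norm_nonneg x]) (le_max_left _ _)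
          _ ≤ 2 ^ q := Real.rpow_le_rpow (by positivity) (by nlinarith [norm_nonneg x])
              (le_max_right _ _)
      calc _ ≤ C * C * D * (‖x‖ₑ ^ (-σ) * 1) * ENNReal.ofReal (2 ^ q) :=
            mul_le_mul' ((hconv x).trans (by gcongr)) (ENNReal.ofReal_le_ofReal h2)
        _ = _ := by ring
    · have hK : C * C * D * ENNReal.ofReal (2 ^ q) ≠ ⊤ :=
        ENNReal.mul_ne_top (ENNReal.mul_ne_top (ENNReal.mul_ne_top hC hC) hD)
          ENNReal.ofReal_ne_top
      rw [lintegral_const_mul' _ _ hK]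
      exact ENNReal.mul_lt_top hK.lt_top hball
  have hfar : ∫⁻ x in (Metric.ball (0 : Rd d) 1)ᶜ,
      (∫⁻ y, besselKernel (1 - γ) (x - y) ^ r * besselKernel (1 - γ) y ^ r) *
      ENNReal.ofReal ((1 + ‖x‖ ^ 2) ^ (k * (r - 1) / 2)) ∂μ < ⊤ := by
    refine lt_of_le_of_lt (setLIntegral_mono' (g := fun x => (C * C * D * ENNReal.ofReal F) *
      ENNReal.ofReal (1 / (1 + ‖x‖ ^ 2) ^ (k / 2))) measurableSet_ball.compl ?_) ?_
    · intro x hx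
      have hx1 : 1 ≤ ‖x‖ := by simpa using hx
      have h1 : ‖x‖ₑ ^ (-σ) ≤ 1 := by
        have h2 : (1 : ℝ≥0∞) ≤ ‖x‖ₑ := by
          rw [← ofReal_norm, ← ENNReal.ofReal_one]
          exact ENNReal.ofReal_le_ofReal hx1
        rw [ENNReal.rpow_neg, ENNReal.inv_le_one]
        simpa using ENNReal.rpow_le_rpow h2 hσ
      have hp : 0 < 1 + ‖x‖ ^ 2 := by positivity
      have h3 : Real.exp (-(1 / 4 * ‖x‖)) * (1 + ‖x‖ ^ 2) ^ (k * (r - 1) / 2) ≤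
          F * (1 / (1 + ‖x‖ ^ 2) ^ (k / 2)) := by
        rw [mul_one_div, le_div_iff₀ (by positivity), mul_assoc, ← Real.rpow_add hp, Real.exp_neg,
          inv_mul_le_iff₀ (Real.exp_pos _)]
        calc (1 + ‖x‖ ^ 2) ^ (k * (r - 1) / 2 + k / 2) ≤ (1 + ‖x‖ ^ 2) ^ m :=
              Real.rpow_le_rpow_of_exponent_le (by nlinarith [norm_nonneg x]) (le_max_left _ _)
          _ ≤ ((1 + ‖x‖) ^ 2) ^ m := Real.rpow_le_rpow hp.le (hsq x) (le_max_right _ _)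
          _ = (1 + ‖x‖) ^ (2 * m) := by
              rw [← Real.rpow_natCast, ← Real.rpow_mul (by positivity)]; norm_num
          _ ≤ _ := by linarith [hFle ‖x‖ (norm_nonneg x)]
      calc _ ≤ C * C * D * (1 * ENNReal.ofReal (Real.exp (-(1 / 4 * ‖x‖)))) *
            ENNReal.ofReal ((1 + ‖x‖ ^ 2) ^ (k * (r - 1) / 2)) :=
            mul_le_mul' ((hconv x).trans (by gcongr)) le_rfl
        _ = C * C * D * ENNReal.ofReal
              (Real.exp (-(1 / 4 * ‖x‖)) * (1 + ‖x‖ ^ 2) ^ (k * (r - 1) / 2)) := by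
            rw [ENNReal.ofReal_mul (Real.exp_pos _).le]; ring
        _ ≤ C * C * D * ENNReal.ofReal (F * (1 / (1 + ‖x‖ ^ 2) ^ (k / 2))) := by gcongr
        _ = _ := by rw [ENNReal.ofReal_mul hF.le]; ring
    · have hK : C * C * D * ENNReal.ofReal F ≠ ⊤ :=
        ENNReal.mul_ne_top (ENNReal.mul_ne_top (ENNReal.mul_ne_top hC hC) hD)
          ENNReal.ofReal_ne_top
      rw [lintegral_const_mul' _ _ hK]
      exact ENNReal.mul_lt_top hK.lt_top (lt_of_le_of_lt (setLIntegral_le_lintegral _ _) hμ)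
  unfold kernelIntegral
  rw [← lintegral_add_compl _ (measurableSet_ball (x := (0 : Rd d)) (ε := 1))]
  exact ENNReal.add_lt_top.2 ⟨hnear, hfar⟩

open scoped FourierTransform RealInnerProductSpace

/-! ### The Bessel kernel as a Fourier transform -/

/-- The Fourier transform of `exp (-t)` times the heat kernel, without its normalizing constant. The
Bessel kernel is a superposition of these functions. -/
lemma fourier_heatKernel {t : ℝ} (ht : 0 < t) (ξ : Rd d) :
    𝓕 (fun x : Rd d => ((Real.exp (-t - ‖x‖ ^ 2 / (4 * t)) : ℝ) : ℂ)) ξ =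
      (((4 * Real.pi * t) ^ ((d : ℝ) / 2) *
        Real.exp (-((1 + (2 * Real.pi * ‖ξ‖) ^ 2) * t)) : ℝ) : ℂ) := by
  have hb : 0 < ((1 / (4 * t) : ℝ) : ℂ).re := by
    rw [Complex.ofReal_re]; positivity
  have h := fourier_gaussian_innerProductSpace (V := Rd d) hb ξ
  have h1 : (fun x : Rd d => ((Real.exp (-t - ‖x‖ ^ 2 / (4 * t)) : ℝ) : ℂ)) =
      (Real.exp (-t) : ℂ) • fun x : Rd d => Complex.exp (-((1 / (4 * t) : ℝ) : ℂ) * ‖x‖ ^ 2) := by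
    funext x
    rw [Pi.smul_apply, smul_eq_mul, sub_eq_add_neg, Real.exp_add, Complex.ofReal_mul]
    congr 1
    push_cast
    congr 1
    ring
  have h2 : ((Real.pi : ℂ) / ((1 / (4 * t) : ℝ) : ℂ)) ^ ((Module.finrank ℝ (Rd d) : ℂ) / 2) =
      (((4 * Real.pi * t) ^ ((d : ℝ) / 2) : ℝ) : ℂ) := by
    rw [Complex.ofReal_cpow (by positivity), finrank_euclideanSpace, Fintype.card_fin]
    have ht' : (t : ℂ) ≠ 0 := by exact_mod_cast ht.ne'
    congr 1
    · push_cast; field_simp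
    · push_cast; rfl
  rw [h1]
  have h3 : 𝓕 ((Real.exp (-t) : ℂ) • fun x : Rd d =>
      Complex.exp (-((1 / (4 * t) : ℝ) : ℂ) * ‖x‖ ^ 2)) ξ =
      (Real.exp (-t) : ℂ) * 𝓕 (fun x : Rd d =>
        Complex.exp (-((1 / (4 * t) : ℝ) : ℂ) * ‖x‖ ^ 2)) ξ := by
    have := VectorFourier.fourierIntegral_const_smul Real.fourierChar (volume : Measure (Rd d))
      (innerₗ (Rd d)) (fun x : Rd d =>
        Complex.exp (-((1 / (4 * t) : ℝ) : ℂ) * ‖x‖ ^ 2)) (Real.exp (-t) : ℂ)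
    exact congrFun this ξ
  rw [h3, h, h2]
  have h4 : Real.exp (-((1 + (2 * Real.pi * ‖ξ‖) ^ 2) * t)) =
      Real.exp (-t) * Real.exp (-(4 * Real.pi ^ 2 * t * ‖ξ‖ ^ 2)) := by
    rw [← Real.exp_add]; congr 1; ring
  rw [h4]
  push_cast
  have ht' : (t : ℂ) ≠ 0 := by exact_mod_cast ht.ne'
  have h5 : -(Real.pi : ℂ) ^ 2 * (‖ξ‖ : ℂ) ^ 2 / (1 / (4 * (t : ℂ))) =
      -(4 * (Real.pi : ℂ) ^ 2 * t * (‖ξ‖ : ℂ) ^ 2) := by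
    field_simp
  rw [h5]
  ring

lemma integrable_besselKernel (hd : 1 ≤ d) {α : ℝ} (hα : 0 < α) :
    Integrable (fun x : Rd d => (((besselKernel α x).toReal : ℝ) : ℂ)) :=
  (integrable_toReal_of_lintegral_ne_top (measurable_besselKernel α).aemeasurable
    (lintegral_besselKernel_lt_top hd hα).ne).ofReal

/-- The Fourier transform of the Bessel kernel is the symbol of `(1 - Δ)^(-α/2)`. -/
lemma fourier_besselKernel (hd : 1 ≤ d) {α : ℝ} (hα : 0 < α) (ξ : Rd d) :
    𝓕 (fun x : Rd d => (((besselKernel α x).toReal : ℝ) : ℂ)) ξ =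
      (((1 + (2 * Real.pi * ‖ξ‖) ^ 2) ^ (-α / 2) : ℝ) : ℂ) := by
  set c : ℝ := (4 * Real.pi) ^ (-(d : ℝ) / 2) / Real.Gamma (α / 2) with hc_def
  have hΓ : 0 < Real.Gamma (α / 2) := Real.Gamma_pos_of_pos (by positivity)
  have hc : 0 < c := by positivity
  set k : Rd d → ℝ → ℝ := fun x t =>
    t ^ ((α - d) / 2 - 1) * Real.exp (-t - ‖x‖ ^ 2 / (4 * t)) with hk_def
  have hkm : Measurable (fun z : Rd d × ℝ => k z.1 z.2) := by
    simp only [hk_def]; fun_prop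
  have hk0 : ∀ x, ∀ t ∈ Set.Ioi (0 : ℝ), 0 ≤ k x t := fun x t ht => by
    have ht : 0 < t := ht
    simp only [hk_def]; positivity
  have hR : ∀ x : Rd d, (besselKernel α x).toReal = c * ∫ t in Set.Ioi (0 : ℝ), k x t := by
    intro x
    rw [integral_eq_lintegral_of_nonneg_ae
      (ae_restrict_of_forall_mem measurableSet_Ioi (hk0 x))
      (hkm.comp measurable_prodMk_left).aestronglyMeasurable]
    rw [besselKernel, ENNReal.toReal_mul, ENNReal.toReal_ofReal hc.le]
  have hint : Integrable (fun z : Rd d × ℝ => k z.1 z.2)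
      (volume.prod (volume.restrict (Set.Ioi (0 : ℝ)))) := by
    refine ⟨hkm.aestronglyMeasurable, ?_⟩
    rw [hasFiniteIntegral_iff_enorm, lintegral_prod _ hkm.enorm.aemeasurable]
    have h1 : ∀ x : Rd d, ∫⁻ t in Set.Ioi (0 : ℝ), ‖k x t‖ₑ =
        ∫⁻ t in Set.Ioi (0 : ℝ), ENNReal.ofReal (k x t) := fun x =>
      setLIntegral_congr_fun measurableSet_Ioi fun t ht =>
        Real.enorm_of_nonneg (hk0 x t ht)
    simp only [h1]
    have h2 := lintegral_besselKernel_lt_top hd hα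
    unfold besselKernel at h2
    rw [lintegral_const_mul' _ _ ENNReal.ofReal_ne_top] at h2
    refine (ENNReal.lt_top_of_mul_ne_top_right h2.ne ?_)
    simpa using hc
  have hint2 : Integrable (fun z : Rd d × ℝ => Real.fourierChar (-⟪z.1, ξ⟫) • ((k z.1 z.2 : ℝ) : ℂ))
      (volume.prod (volume.restrict (Set.Ioi (0 : ℝ)))) := by
    have h1 : Continuous fun z : Rd d × ℝ => ((Real.fourierChar (-⟪z.1, ξ⟫) : Circle) : ℂ) := by
      have := Real.continuous_fourierChar
      fun_prop
    refine (hint.ofReal (𝕜 := ℂ)).mono (h1.aestronglyMeasurable.mul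
      hkm.complex_ofReal.aestronglyMeasurable) (Filter.Eventually.of_forall fun z => ?_)
    rw [Circle.norm_smul]
    rfl
  have hinner : ∀ t ∈ Set.Ioi (0 : ℝ),
      ∫ x : Rd d, Real.fourierChar (-⟪x, ξ⟫) • ((k x t : ℝ) : ℂ) =
      (((4 * Real.pi) ^ ((d : ℝ) / 2) *
        (t ^ (α / 2 - 1) * Real.exp (-((1 + (2 * Real.pi * ‖ξ‖) ^ 2) * t))) : ℝ) : ℂ) := by
    intro t ht
    have ht : 0 < t := ht
    have h1 := fourier_heatKernel ht ξ
    rw [Real.fourier_eq] at h1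
    calc _ = ((t ^ ((α - d) / 2 - 1) : ℝ) : ℂ) * ∫ x : Rd d, Real.fourierChar (-⟪x, ξ⟫) •
          ((Real.exp (-t - ‖x‖ ^ 2 / (4 * t)) : ℝ) : ℂ) := by
          rw [← integral_const_mul]
          congr 1
          funext x
          simp only [hk_def, Circle.smul_def, smul_eq_mul, Complex.ofReal_mul]
          ring
      _ = _ := by
          rw [h1, ← Complex.ofReal_mul, Real.mul_rpow (by positivity) ht.le]
          congr 1
          have : α / 2 - 1 = (α - d) / 2 - 1 + (d : ℝ) / 2 := by ring
          rw [this, Real.rpow_add ht]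
          ring
  have hA : 0 < 1 + (2 * Real.pi * ‖ξ‖) ^ 2 := by positivity
  calc 𝓕 (fun x : Rd d => (((besselKernel α x).toReal : ℝ) : ℂ)) ξ
      = (c : ℂ) * ∫ x : Rd d, ∫ t in Set.Ioi (0 : ℝ),
          Real.fourierChar (-⟪x, ξ⟫) • ((k x t : ℝ) : ℂ) := by
        rw [Real.fourier_eq, ← integral_const_mul]
        congr 1
        funext x
        have h1 : ∫ t in Set.Ioi (0 : ℝ), Real.fourierChar (-⟪x, ξ⟫) • ((k x t : ℝ) : ℂ) =
            ((Real.fourierChar (-⟪x, ξ⟫) : Circle) : ℂ) *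
              ((∫ t in Set.Ioi (0 : ℝ), k x t : ℝ) : ℂ) := by
          rw [← integral_complex_ofReal, ← integral_const_mul]
          rfl
        rw [h1, hR x, Circle.smul_def, smul_eq_mul, Complex.ofReal_mul]
        ring
    _ = (c : ℂ) * ∫ t in Set.Ioi (0 : ℝ), ∫ x : Rd d,
          Real.fourierChar (-⟪x, ξ⟫) • ((k x t : ℝ) : ℂ) := by
        rw [integral_integral_swap hint2]
    _ = (c : ℂ) * ∫ t in Set.Ioi (0 : ℝ), (((4 * Real.pi) ^ ((d : ℝ) / 2) *
        (t ^ (α / 2 - 1) * Real.exp (-((1 + (2 * Real.pi * ‖ξ‖) ^ 2) * t))) : ℝ) : ℂ) := by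
        rw [setIntegral_congr_fun measurableSet_Ioi hinner]
    _ = _ := by
        rw [integral_complex_ofReal, integral_const_mul,
          Real.integral_rpow_mul_exp_neg_mul_Ioi (by positivity) hA, ← Complex.ofReal_mul]
        congr 1
        rw [hc_def, neg_div, neg_div, Real.rpow_neg (by positivity), Real.rpow_neg hA.le,
          Real.div_rpow zero_le_one hA.le, Real.one_rpow]
        have : 0 < (4 * Real.pi) ^ ((d : ℝ) / 2) := by positivity
        field_simp

lemma hasTemperateGrowth_besselSymbol (α : ℝ) :
    (fun ξ : Rd d => (((1 + (2 * Real.pi * ‖ξ‖) ^ 2) ^ α : ℝ) : ℂ)).HasTemperateGrowth := by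
  have h1 := (Function.HasTemperateGrowth.comp
    (Function.hasTemperateGrowth_one_add_norm_sq_rpow (Rd d) α)
    (((2 * Real.pi) • ContinuousLinearMap.id ℝ (Rd d)).hasTemperateGrowth))
  have h2 := Function.HasTemperateGrowth.comp Function.Complex.hasTemperateGrowth_ofReal h1
  have h3 : ∀ ξ : Rd d, ‖((2 * Real.pi) • ContinuousLinearMap.id ℝ (Rd d)) ξ‖ =
      2 * Real.pi * ‖ξ‖ := fun ξ => by
    simp [norm_smul, abs_of_pos Real.pi_pos]
  simpa only [Function.comp_def, h3] using h2

/-- On Schwartz functions the Bessel potential is the convolution with the Bessel kernel. -/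
lemma besselMultiplier_apply (hd : 1 ≤ d) {α : ℝ} (hα : 0 < α) (u : 𝓢(Rd d, ℂ)) (x : Rd d) :
    (𝓕 (SchwartzMap.smulLeftCLM ℂ
      (fun ξ : Rd d => (((1 + (2 * Real.pi * ‖ξ‖) ^ 2) ^ (-α / 2) : ℝ) : ℂ))
      (𝓕⁻ u)) : 𝓢(Rd d, ℂ)) x =
    ∫ y, (((besselKernel α (x - y)).toReal : ℝ) : ℂ) * u y := by
  set w : 𝓢(Rd d, ℂ) := 𝓕⁻ u with hw
  have hu : ∀ z, ∫ v, Real.fourierChar (-⟪v, z⟫) • w v = u z := by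
    intro z
    have h1 : 𝓕 w = u := FourierTransform.fourier_fourierInv_eq u
    rw [← h1, SchwartzMap.fourier_coe, Real.fourier_eq]
  set g : Rd d → ℂ := fun v => Real.fourierChar (-⟪v, x⟫) • w v with hg_def
  have hg : Integrable g := (Real.fourierIntegral_convergent_iff x).2 w.integrable
  have hswap := VectorFourier.integral_fourierIntegral_smul_eq_flip (L := innerₗ (Rd d))
    Real.continuous_fourierChar continuous_inner (integrable_besselKernel hd hα) hg
  rw [SchwartzMap.fourier_coe, Real.fourier_eq]
  calc _ = ∫ ξ, 𝓕 (fun x : Rd d => (((besselKernel α x).toReal : ℝ) : ℂ)) ξ • g ξ := by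
        congr 1
        funext v
        rw [fourier_besselKernel hd hα,
          SchwartzMap.smulLeftCLM_apply_apply (hasTemperateGrowth_besselSymbol _)]
        simp only [hg_def, Circle.smul_def, smul_eq_mul]
        ring
    _ = ∫ y, (((besselKernel α y).toReal : ℝ) : ℂ) * u (x + y) := by
        refine hswap.trans ?_
        congr 1
        funext y
        rw [smul_eq_mul, ← hu (x + y)]
        congr 1
        change ∫ v, Real.fourierChar (-((innerₗ (Rd d)).flip v y)) • g v = _
        congr 1
        funext v
        simp only [hg_def, LinearMap.flip_apply, innerₗ_apply_apply, inner_add_right]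
        rw [smul_smul, ← AddChar.map_add_eq_mul, real_inner_comm]
        congr 2
        ring
    _ = _ := by
        rw [← integral_add_left_eq_self
          (fun y => (((besselKernel α (x - y)).toReal : ℝ) : ℂ) * u y) x]
        congr 1
        funext y
        rw [sub_add_cancel_left, besselKernel_neg]

/-! ### Functions defining tempered distributions -/

/-- Measurable functions that are integrable against some weight `(1 + |x|)^(-N)`. They define
tempered distributions by integration. -/
def IsTemperedFun (g : Rd d → ℂ) : Prop :=
  AEStronglyMeasurable g volume ∧
    ∃ N : ℝ, 0 ≤ N ∧ ∫⁻ x, ‖g x‖ₑ * ENNReal.ofReal ((1 + ‖x‖) ^ (-N)) < ⊤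

/-- Peetre's inequality. -/
lemma one_add_norm_rpow_neg_le {N : ℝ} (hN : 0 ≤ N) (x y : Rd d) :
    (1 + ‖x‖) ^ (-N) ≤ (1 + ‖y‖) ^ (-N) * (1 + ‖x - y‖) ^ N := by
  have hx := norm_nonneg x
  have hy := norm_nonneg y
  have hxy := norm_nonneg (x - y)
  have h1 : 1 + ‖y‖ ≤ (1 + ‖x‖) * (1 + ‖x - y‖) := by
    have : ‖y‖ ≤ ‖x‖ + ‖x - y‖ := by
      have := norm_sub_norm_le y x
      rw [norm_sub_rev] at this
      linarith
    nlinarith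
  have h2 : (1 + ‖y‖) ^ N ≤ (1 + ‖x‖) ^ N * (1 + ‖x - y‖) ^ N := by
    rw [← Real.mul_rpow (by positivity) (by positivity)]
    exact Real.rpow_le_rpow (by positivity) h1 hN
  rw [Real.rpow_neg (by positivity), Real.rpow_neg (by positivity), inv_mul_eq_div,
    le_div_iff₀ (by positivity), inv_mul_le_iff₀ (by positivity)]
  exact h2

lemma exists_schwartz_decay (φ : 𝓢(Rd d, ℂ)) (N : ℝ) :
    ∃ C : ℝ, 0 ≤ C ∧ ∀ x, ‖φ x‖ ≤ C * (1 + ‖x‖) ^ (-N) := by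
  set n := ⌈N⌉₊
  set C : ℝ := 2 ^ n * (Finset.Iic (n, 0)).sup (fun m => SchwartzMap.seminorm ℝ m.1 m.2) φ
  have hC : ∀ x, (1 + ‖x‖) ^ n * ‖φ x‖ ≤ C := by
    intro x
    have := SchwartzMap.one_add_le_sup_seminorm_apply (𝕜 := ℝ) (m := (n, 0)) (k := n) (n := 0)
      le_rfl le_rfl φ x
    simpa using this
  refine ⟨C, le_trans (by positivity) (hC 0), fun x => ?_⟩
  have hx : 0 < 1 + ‖x‖ := by positivity
  rw [Real.rpow_neg hx.le, ← div_eq_mul_inv, le_div_iff₀ (by positivity)]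
  refine le_trans ?_ (hC x)
  rw [mul_comm]
  gcongr
  rw [← Real.rpow_natCast]
  exact Real.rpow_le_rpow_of_exponent_le (by linarith [norm_nonneg x]) (Nat.le_ceil N)

/-- A tempered function defines a tempered distribution. -/
lemma IsTemperedFun.exists_distribution {g : Rd d → ℂ} (hg : IsTemperedFun g) :
    ∃ T : 𝓢'(Rd d, ℂ), IsRepresentedBy T g := by
  obtain ⟨hgm, N, hN, hint⟩ := hg
  set w : Rd d → ℝ := fun x => (1 + ‖x‖ ^ 2) ^ (N / 2) with hw_def
  have hw0 : ∀ x, 0 < w x := fun x => by simp only [hw_def]; positivity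
  have hwm : Measurable w := by simp only [hw_def]; fun_prop
  have hwg : (fun x => ((w x : ℝ) : ℂ)).HasTemperateGrowth :=
    Function.HasTemperateGrowth.comp Function.Complex.hasTemperateGrowth_ofReal
      (Function.hasTemperateGrowth_one_add_norm_sq_rpow (Rd d) (N / 2))
  set g' : Rd d → ℂ := fun x => ((w x)⁻¹ : ℝ) * g x with hg'_def
  have hwle : ∀ x, (w x)⁻¹ ≤ 2 ^ (N / 2) * (1 + ‖x‖) ^ (-N) := by
    intro x
    have hx := norm_nonneg x
    have h1 : (1 + ‖x‖) ^ N ≤ 2 ^ (N / 2) * w x := by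
      calc (1 + ‖x‖) ^ N = ((1 + ‖x‖) ^ 2) ^ (N / 2) := by
            rw [← Real.rpow_natCast, ← Real.rpow_mul (by positivity)]; congr 1; push_cast; ring
        _ ≤ (2 * (1 + ‖x‖ ^ 2)) ^ (N / 2) := by
            refine Real.rpow_le_rpow (by positivity) ?_ (by positivity)
            nlinarith [sq_nonneg (1 - ‖x‖)]
        _ = _ := Real.mul_rpow (by norm_num) (by positivity)
    rw [Real.rpow_neg (by positivity), ← div_eq_mul_inv, le_div_iff₀ (by positivity),
      inv_mul_le_iff₀ (hw0 x)]
    linarith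
  have hg'int : Integrable g' := by
    refine ⟨(hwm.inv.complex_ofReal.aestronglyMeasurable).mul hgm, ?_⟩
    rw [hasFiniteIntegral_iff_enorm]
    calc ∫⁻ x, ‖g' x‖ₑ ≤ ∫⁻ x, ENNReal.ofReal (2 ^ (N / 2)) *
          (‖g x‖ₑ * ENNReal.ofReal ((1 + ‖x‖) ^ (-N))) := by
          refine lintegral_mono fun x => ?_
          simp only [hg'_def, enorm_mul]
          have h1 : ‖(((w x)⁻¹ : ℝ) : ℂ)‖ₑ ≤
              ENNReal.ofReal (2 ^ (N / 2)) * ENNReal.ofReal ((1 + ‖x‖) ^ (-N)) := by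
            rw [← ENNReal.ofReal_mul (by positivity), ← ofReal_norm, Complex.norm_real,
              Real.norm_of_nonneg (inv_nonneg.2 (hw0 x).le)]
            exact ENNReal.ofReal_le_ofReal (hwle x)
          calc _ ≤ (ENNReal.ofReal (2 ^ (N / 2)) * ENNReal.ofReal ((1 + ‖x‖) ^ (-N))) * ‖g x‖ₑ := by
                gcongr
            _ = _ := by ring
      _ < ⊤ := by
          rw [lintegral_const_mul' _ _ ENNReal.ofReal_ne_top]
          exact ENNReal.mul_lt_top ENNReal.ofReal_lt_top hint
  have hfact : Fact ((1 : ℝ≥0∞) ≤ 1) := ⟨le_rfl⟩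
  have hmem : MemLp g' 1 volume := memLp_one_iff_integrable.2 hg'int
  have hprod : ∀ (φ : 𝓢(Rd d, ℂ)) x,
      SchwartzMap.smulLeftCLM ℂ (fun x => ((w x : ℝ) : ℂ)) φ x * g' x = φ x * g x := by
    intro φ x
    rw [SchwartzMap.smulLeftCLM_apply_apply hwg]
    simp only [hg'_def, smul_eq_mul, Complex.ofReal_inv]
    have : ((w x : ℝ) : ℂ) ≠ 0 := by exact_mod_cast (hw0 x).ne'
    field_simp
  refine ⟨TemperedDistribution.smulLeftCLM ℂ (fun x => ((w x : ℝ) : ℂ))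
    (Lp.toTemperedDistribution (hmem.toLp g')), fun φ => ⟨?_, ?_⟩⟩
  · simp only [← hprod]
    set ψ := SchwartzMap.smulLeftCLM ℂ (fun x => ((w x : ℝ) : ℂ)) φ
    exact hg'int.bdd_mul ψ.continuous.aestronglyMeasurable
      (Filter.Eventually.of_forall fun x => SchwartzMap.norm_le_seminorm ℝ ψ x)
  · rw [TemperedDistribution.smulLeftCLM_apply_apply, Lp.toTemperedDistribution_apply]
    refine integral_congr_ae ?_
    filter_upwards [hmem.coeFn_toLp] with x hx
    rw [hx, smul_eq_mul, hprod]

/-- Products of `L_q` functions with functions of polynomial growth are tempered. -/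
lemma IsTemperedFun.of_memLp_mul {q : ℝ≥0∞} (hq : 1 ≤ q) {g v : Rd d → ℂ} (hg : MemLp g q volume)
    (hv : AEStronglyMeasurable v volume) {C m : ℝ} (hm : 0 ≤ m)
    (hle : ∀ x, ‖v x‖ ≤ C * (1 + ‖x‖) ^ m) : IsTemperedFun (fun x => g x * v x) := by
  have := ENNReal.HolderConjugate.inv_one_sub_inv' hq
  obtain ⟨n, hn⟩ := Measure.HasTemperateGrowth.exists_eLpNorm_lt_top ((1 - q⁻¹)⁻¹)
    (inferInstance : (volume : Measure (Rd d)).HasTemperateGrowth)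
  have hC : 0 ≤ C := by
    have := (norm_nonneg _).trans (hle 0)
    simpa using this
  refine ⟨hg.1.mul hv, m + n, by positivity, ?_⟩
  set W : Rd d → ℝ := fun x => (1 + ‖x‖) ^ (-n : ℝ) with hW
  have hWm : Measurable W := by simp only [hW]; fun_prop
  have hWL : MemLp W ((1 - q⁻¹)⁻¹) volume := ⟨hWm.aestronglyMeasurable, hn⟩
  have hint : MemLp (W • g) 1 volume := MemLp.smul (p := (1 - q⁻¹)⁻¹) (q := q) hg hWL
  have hfin := (memLp_one_iff_integrable.1 hint).2
  rw [hasFiniteIntegral_iff_enorm] at hfin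
  calc ∫⁻ x, ‖g x * v x‖ₑ * ENNReal.ofReal ((1 + ‖x‖) ^ (-(m + n)))
      ≤ ∫⁻ x, ENNReal.ofReal C * ‖(W • g) x‖ₑ := by
        refine lintegral_mono fun x => ?_
        rw [Pi.smul_apply', enorm_mul, enorm_smul]
        have h1 : ‖v x‖ₑ * ENNReal.ofReal ((1 + ‖x‖) ^ (-(m + n))) ≤ ENNReal.ofReal C * ‖W x‖ₑ := by
          rw [← ofReal_norm, ← ofReal_norm, ← ENNReal.ofReal_mul (norm_nonneg _),
            ← ENNReal.ofReal_mul hC]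
          refine ENNReal.ofReal_le_ofReal ?_
          have hx : 0 < 1 + ‖x‖ := by positivity
          calc ‖v x‖ * (1 + ‖x‖) ^ (-(m + n)) ≤ C * (1 + ‖x‖) ^ m * (1 + ‖x‖) ^ (-(m + n)) := by
                gcongr; exact hle x
            _ = C * ‖W x‖ := by
                rw [mul_assoc, ← Real.rpow_add hx, Real.norm_of_nonneg (by positivity)]
                congr 2
                ring
        calc _ = ‖g x‖ₑ * (‖v x‖ₑ * ENNReal.ofReal ((1 + ‖x‖) ^ (-(m + n)))) := by ring
          _ ≤ ‖g x‖ₑ * (ENNReal.ofReal C * ‖W x‖ₑ) := by gcongr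
          _ = _ := by ring
    _ < ⊤ := by
        rw [lintegral_const_mul' _ _ ENNReal.ofReal_ne_top]
        exact ENNReal.mul_lt_top ENNReal.ofReal_lt_top hfin

/-! ### Bessel potentials of functions -/

/-- The convolution of a function with the Bessel kernel. -/
noncomputable def besselConv (α : ℝ) (g : Rd d → ℂ) (x : Rd d) : ℂ :=
  ∫ y, (((besselKernel α (x - y)).toReal : ℝ) : ℂ) * g y

lemma enorm_besselKernel_toReal_le (α : ℝ) (x : Rd d) :
    ‖(((besselKernel α x).toReal : ℝ) : ℂ)‖ₑ ≤ besselKernel α x := by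
  rw [← ofReal_norm, Complex.norm_real, Real.norm_of_nonneg ENNReal.toReal_nonneg]
  exact ENNReal.ofReal_toReal_le

lemma measurable_besselKernel_sub (α : ℝ) :
    Measurable (fun z : Rd d × Rd d => besselKernel α (z.1 - z.2)) :=
  (measurable_besselKernel α).comp (measurable_fst.sub measurable_snd)

/-- Convolution with the Bessel kernel, which has finite moments, preserves temperedness. The
absolute convergence stated here justifies every use of Fubini's theorem for `besselConv`. -/
lemma IsTemperedFun.exists_lintegral_besselKernel_lt_top (hd : 1 ≤ d) {α : ℝ} (hα : 0 < α)
    {g : Rd d → ℂ} (hg : IsTemperedFun g) :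
    ∃ N : ℝ, 0 ≤ N ∧ ∫⁻ x, ENNReal.ofReal ((1 + ‖x‖) ^ (-N)) *
      ∫⁻ y, besselKernel α (x - y) * ‖g y‖ₑ < ⊤ := by
  obtain ⟨hgm, N, hN, hint⟩ := hg
  refine ⟨N, hN, ?_⟩
  set M := ∫⁻ x : Rd d, besselKernel α x * ENNReal.ofReal ((1 + ‖x‖) ^ N)
  have hM : M < ⊤ := lintegral_besselKernel_mul_rpow_lt_top hd hα N
  have hKm := measurable_besselKernel_sub (d := d) α
  have hR := measurable_besselKernel (d := d) α
  have hprodm : AEMeasurable (fun z : Rd d × Rd d =>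
      ENNReal.ofReal ((1 + ‖z.1‖) ^ (-N)) * (besselKernel α (z.1 - z.2) * ‖g z.2‖ₑ))
      (volume.prod volume) := by
    refine AEMeasurable.mul (Measurable.aemeasurable (by fun_prop)) (hKm.aemeasurable.mul ?_)
    exact hgm.comp_snd.enorm
  calc ∫⁻ x, ENNReal.ofReal ((1 + ‖x‖) ^ (-N)) * ∫⁻ y, besselKernel α (x - y) * ‖g y‖ₑ
      = ∫⁻ x, ∫⁻ y, ENNReal.ofReal ((1 + ‖x‖) ^ (-N)) * (besselKernel α (x - y) * ‖g y‖ₑ) := by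
        congr 1; funext x
        rw [lintegral_const_mul' _ _ ENNReal.ofReal_ne_top]
    _ = ∫⁻ y, ∫⁻ x, ENNReal.ofReal ((1 + ‖x‖) ^ (-N)) * (besselKernel α (x - y) * ‖g y‖ₑ) :=
        lintegral_lintegral_swap hprodm
    _ ≤ ∫⁻ y, (‖g y‖ₑ * ENNReal.ofReal ((1 + ‖y‖) ^ (-N))) * M := by
        refine lintegral_mono fun y => ?_
        calc _ ≤ ∫⁻ x, (‖g y‖ₑ * ENNReal.ofReal ((1 + ‖y‖) ^ (-N))) *
              (besselKernel α (x - y) * ENNReal.ofReal ((1 + ‖x - y‖) ^ N)) := by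
              refine lintegral_mono fun x => ?_
              have h1 : ENNReal.ofReal ((1 + ‖x‖) ^ (-N)) ≤
                  ENNReal.ofReal ((1 + ‖y‖) ^ (-N)) * ENNReal.ofReal ((1 + ‖x - y‖) ^ N) := by
                rw [← ENNReal.ofReal_mul (by positivity)]
                exact ENNReal.ofReal_le_ofReal (one_add_norm_rpow_neg_le hN x y)
              calc _ ≤ (ENNReal.ofReal ((1 + ‖y‖) ^ (-N)) *
                    ENNReal.ofReal ((1 + ‖x - y‖) ^ N)) * (besselKernel α (x - y) * ‖g y‖ₑ) := by
                    gcongr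
                _ = _ := by ring
          _ = (‖g y‖ₑ * ENNReal.ofReal ((1 + ‖y‖) ^ (-N))) * ∫⁻ x,
              (besselKernel α (x - y) * ENNReal.ofReal ((1 + ‖x - y‖) ^ N)) :=
              lintegral_const_mul' _ _ (ENNReal.mul_ne_top enorm_ne_top ENNReal.ofReal_ne_top)
          _ = _ := by
              rw [lintegral_sub_right_eq_self
                (fun x => besselKernel α x * ENNReal.ofReal ((1 + ‖x‖) ^ N)) y]
    _ < ⊤ := by
        rw [lintegral_mul_const' _ _ hM.ne]
        exact ENNReal.mul_lt_top hint hM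

lemma IsTemperedFun.ae_integrable_besselKernel_mul (hd : 1 ≤ d) {α : ℝ} (hα : 0 < α)
    {g : Rd d → ℂ} (hg : IsTemperedFun g) :
    ∀ᵐ x, Integrable (fun y => (((besselKernel α (x - y)).toReal : ℝ) : ℂ) * g y) := by
  obtain ⟨N, hN, hfin⟩ := hg.exists_lintegral_besselKernel_lt_top hd hα
  have hKm := measurable_besselKernel_sub (d := d) α
  have hm : AEMeasurable (fun x : Rd d => ∫⁻ y, besselKernel α (x - y) * ‖g y‖ₑ) volume :=
    AEMeasurable.lintegral_prod_right' (hKm.aemeasurable.mul hg.1.comp_snd.enorm)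
  have hae := ae_lt_top' ((Measurable.aemeasurable (by fun_prop)).mul hm) hfin.ne
  filter_upwards [hae] with x hx
  have hx0 : ENNReal.ofReal ((1 + ‖x‖) ^ (-N)) ≠ 0 := by
    rw [ne_eq, ENNReal.ofReal_eq_zero, not_le]; positivity
  have hlt := ENNReal.lt_top_of_mul_ne_top_right hx.ne hx0
  refine ⟨?_, ?_⟩
  · refine AEStronglyMeasurable.mul ?_ hg.1
    exact ((hKm.comp measurable_prodMk_left).ennreal_toReal.complex_ofReal).aestronglyMeasurable
  · rw [hasFiniteIntegral_iff_enorm]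
    refine lt_of_le_of_lt (lintegral_mono fun y => ?_) hlt
    rw [enorm_mul]
    gcongr
    exact enorm_besselKernel_toReal_le _ _

/-- For a distribution given by a tempered function, the Bessel potential is given by the
convolution with the Bessel kernel. -/
lemma IsRepresentedBy.besselOp (hd : 1 ≤ d) {α : ℝ} (hα : 0 < α) {T : 𝓢'(Rd d, ℂ)}
    {g : Rd d → ℂ} (hT : IsRepresentedBy T g) (hg : IsTemperedFun g) :
    IsRepresentedBy (besselOp (-α) T) (besselConv α g) := by
  intro φ
  obtain ⟨N, hN, hfin⟩ := hg.exists_lintegral_besselKernel_lt_top hd hα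
  obtain ⟨C, hC, hdecay⟩ := exists_schwartz_decay φ N
  have hKm := measurable_besselKernel_sub (d := d) α
  have hint : Integrable (fun z : Rd d × Rd d =>
      φ z.1 * ((((besselKernel α (z.1 - z.2)).toReal : ℝ) : ℂ) * g z.2))
      (volume.prod volume) := by
    have hm1 : AEStronglyMeasurable (fun z : Rd d × Rd d =>
        φ z.1 * ((((besselKernel α (z.1 - z.2)).toReal : ℝ) : ℂ) * g z.2))
        (volume.prod volume) :=
      (φ.continuous.comp continuous_fst).aestronglyMeasurable.mul
        ((hKm.ennreal_toReal.complex_ofReal).aestronglyMeasurable.mul hg.1.comp_snd)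
    refine ⟨hm1, ?_⟩
    rw [hasFiniteIntegral_iff_enorm, lintegral_prod _ hm1.enorm]
    calc _ ≤ ∫⁻ x, ENNReal.ofReal C * (ENNReal.ofReal ((1 + ‖x‖) ^ (-N)) *
          ∫⁻ y, besselKernel α (x - y) * ‖g y‖ₑ) := by
          refine lintegral_mono fun x => ?_
          rw [← mul_assoc, ← ENNReal.ofReal_mul hC, ← lintegral_const_mul' _ _ ENNReal.ofReal_ne_top]
          refine lintegral_mono fun y => ?_
          rw [enorm_mul, enorm_mul]
          gcongr
          · rw [← ofReal_norm]
            exact ENNReal.ofReal_le_ofReal (hdecay x)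
          · exact enorm_besselKernel_toReal_le _ _
      _ < ⊤ := by
          rw [lintegral_const_mul' _ _ ENNReal.ofReal_ne_top]
          exact ENNReal.mul_lt_top ENNReal.ofReal_lt_top hfin
  have hinner : ∀ x, ∫ y, φ x * ((((besselKernel α (x - y)).toReal : ℝ) : ℂ) * g y) =
      φ x * besselConv α g x := fun x => by
    rw [integral_const_mul]; rfl
  constructor
  · have := hint.integral_prod_left
    simpa only [hinner] using this
  · have h1 : ColoredNoise.besselOp (-α) T φ = T (𝓕 (SchwartzMap.smulLeftCLM ℂ
      (fun ξ : Rd d => (((1 + (2 * Real.pi * ‖ξ‖) ^ 2) ^ (-α / 2) : ℝ) : ℂ)) (𝓕⁻ φ))) := rfl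
    rw [h1, (hT _).2]
    calc _ = ∫ y, ∫ x, φ x * ((((besselKernel α (x - y)).toReal : ℝ) : ℂ) * g y) := by
          congr 1
          funext y
          rw [besselMultiplier_apply hd hα, ← integral_mul_const]
          congr 1
          funext x
          rw [besselKernel_sub_comm]
          ring
      _ = ∫ x, ∫ y, φ x * ((((besselKernel α (x - y)).toReal : ℝ) : ℂ) * g y) :=
          integral_integral_swap hint.swap
      _ = _ := by simp only [hinner]

/-! ### Bessel's inequality for positive semidefinite sesquilinear forms -/

section Sesquilinear

variable {V : Type*} [AddCommGroup V] [Module ℂ V] {B : V →ₗ[ℂ] V →ₗ⋆[ℂ] ℂ}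

/-- Over `ℂ` a form with nonnegative diagonal is Hermitian, by polarization. -/
lemma conj_symm_of_nonneg (hB : ∀ v, 0 ≤ B v v) (v w : V) :
    B w v = (starRingEnd ℂ) (B v w) := by
  have him : ∀ z, (B z z).im = 0 := fun z => (Complex.nonneg_iff.1 (hB z)).2.symm
  -- The imaginary parts on `v + w` and `v + i w` give the two components of the identity.
  have h1 := him (v + w)
  have h2 := him (v + Complex.I • w)
  simp only [map_add, LinearMap.add_apply, map_smul, LinearMap.smul_apply, map_smulₛₗ,
    Complex.add_im, Complex.add_re, him, smul_eq_mul, Complex.conj_I, Complex.mul_im, Complex.mul_re,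
    Complex.I_re, Complex.I_im, Complex.neg_re, Complex.neg_im] at h1 h2
  apply Complex.ext
  · simp only [Complex.conj_re]
    linarith
  · simp only [Complex.conj_im]
    linarith

/-- Bessel's inequality. The form may be degenerate. -/
lemma sum_norm_sq_le_of_orthonormal (hB : ∀ v, 0 ≤ B v v) {ι : Type*} {e : ι → V}
    (h1 : ∀ k, B (e k) (e k) = 1) (h0 : ∀ j k, j ≠ k → B (e j) (e k) = 0) (F : Finset ι) (h : V) :
    ∑ k ∈ F, ‖B h (e k)‖ ^ 2 ≤ (B h h).re := by
  classical
  set p : V := ∑ k ∈ F, B h (e k) • e k with hp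
  set S : ℂ := ∑ k ∈ F, B h (e k) * (starRingEnd ℂ) (B h (e k)) with hS
  have hpe : ∀ k ∈ F, B p (e k) = B h (e k) := by
    intro k hk
    rw [hp, map_sum, LinearMap.sum_apply, Finset.sum_eq_single k]
    · simp [h1]
    · intro j _ hjk
      simp [h0 j k hjk]
    · exact fun h => absurd hk h
  have hright : ∀ v : V, B v p = ∑ k ∈ F, (starRingEnd ℂ) (B h (e k)) * B v (e k) := by
    intro v
    rw [hp, map_sum]
    simp [map_smulₛₗ]
  have hpp : B p p = S := by
    rw [hright, hS]
    exact Finset.sum_congr rfl fun k hk => by rw [hpe k hk, mul_comm]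
  have hhp : B h p = S := by
    rw [hright, hS]
    exact Finset.sum_congr rfl fun k _ => mul_comm _ _
  have hph : B p h = S := by
    rw [conj_symm_of_nonneg hB h p, hhp, hS, map_sum]
    exact Finset.sum_congr rfl fun k _ => by rw [map_mul, Complex.conj_conj, mul_comm]
  have hpos := (Complex.nonneg_iff.1 (hB (h - p))).1
  simp only [map_sub, LinearMap.sub_apply, hpp, hhp, hph, Complex.sub_re] at hpos
  have hSre : S.re = ∑ k ∈ F, ‖B h (e k)‖ ^ 2 := by
    rw [hS, Complex.re_sum]
    refine Finset.sum_congr rfl fun k _ => ?_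
    rw [Complex.mul_conj, Complex.ofReal_re, Complex.normSq_eq_norm_sq]
  linarith

end Sesquilinear

/-! ### The sesquilinear form of the noise -/

lemma conjReflect_add (φ ψ : 𝓢(Rd d, ℂ)) :
    conjReflect (φ + ψ) = conjReflect φ + conjReflect ψ := by
  ext x; simp

lemma conjReflect_smul (c : ℂ) (φ : 𝓢(Rd d, ℂ)) :
    conjReflect (c • φ) = (starRingEnd ℂ) c • conjReflect φ := by
  ext x; simp

/-- `noiseInner f`, as a sesquilinear map. -/
noncomputable def noiseForm (f : 𝓢'(Rd d, ℂ)) : 𝓢(Rd d, ℂ) →ₗ[ℂ] 𝓢(Rd d, ℂ) →ₗ⋆[ℂ] ℂ :=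
  LinearMap.mk₂'ₛₗ (RingHom.id ℂ) (starRingEnd ℂ) (noiseInner f)
    (fun φ₁ φ₂ ψ => by simp [noiseInner, conv])
    (fun c φ ψ => by simp [noiseInner, conv])
    (fun φ ψ₁ ψ₂ => by simp [noiseInner, conv, conjReflect_add])
    (fun c φ ψ => by simp [noiseInner, conv, conjReflect_smul])

lemma noiseForm_apply (f : 𝓢'(Rd d, ℂ)) (φ ψ : 𝓢(Rd d, ℂ)) :
    noiseForm f φ ψ = noiseInner f φ ψ := rfl

lemma sum_norm_noiseInner_sq_le {f : 𝓢'(Rd d, ℂ)} (hf : IsNonnegDefDist f) {ι : Type*}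
    {e : ι → 𝓢(Rd d, ℂ)} (he : IsNoiseBasis f e) (F : Finset ι) (φ : 𝓢(Rd d, ℂ)) :
    ∑ k ∈ F, ‖noiseInner f φ (e k)‖ ^ 2 ≤ (noiseInner f φ φ).re :=
  sum_norm_sq_le_of_orthonormal (B := noiseForm f) hf he.norm_one he.orthogonal F φ

/-! ### Tempered measures -/

lemma measure_closedBall_lt_top {μ : Measure (Rd d)} {k : ℝ} (hk : 0 ≤ k)
    (hμ : temperedMass μ k < ⊤) (ρ : ℝ) : μ (Metric.closedBall 0 ρ) < ⊤ := by
  set c : ℝ := 1 / (1 + ρ ^ 2) ^ (k / 2) with hc_def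
  have hc : 0 < c := by positivity
  have h1 : ENNReal.ofReal c * μ (Metric.closedBall 0 ρ) ≤ temperedMass μ k := by
    rw [← setLIntegral_const]
    refine (setLIntegral_mono' measurableSet_closedBall fun x hx => ?_).trans
      (setLIntegral_le_lintegral _ _)
    have hx : ‖x‖ ≤ ρ := by simpa using hx
    refine ENNReal.ofReal_le_ofReal ?_
    rw [hc_def]
    gcongr
  refine ENNReal.lt_top_of_mul_ne_top_right (h1.trans_lt hμ).ne ?_
  simpa using hc

lemma isLocallyFiniteMeasure_of_temperedMass {μ : Measure (Rd d)} {k : ℝ} (hk : 0 ≤ k)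
    (hμ : temperedMass μ k < ⊤) : IsLocallyFiniteMeasure μ :=
  ⟨fun x => ⟨Metric.closedBall 0 (‖x‖ + 1),
    Filter.mem_of_superset (Metric.ball_mem_nhds x one_pos) fun y hy => by
      have h1 : dist y x < 1 := hy
      have h2 : ‖y‖ ≤ ‖x‖ + ‖y - x‖ := by simpa using norm_add_le x (y - x)
      rw [dist_eq_norm] at h1
      simp only [Metric.mem_closedBall, dist_zero_right]
      linarith, measure_closedBall_lt_top hk hμ _⟩⟩

/-- Absolute convergence, with polynomial growth in `y`, of the integral defining `f ∗ φ`. -/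
lemma exists_lintegral_translate_le {μ : Measure (Rd d)} {k : ℝ} (hk : 0 ≤ k)
    (hμ : temperedMass μ k < ⊤) (φ : 𝓢(Rd d, ℂ)) :
    ∃ C : ℝ, 0 ≤ C ∧ ∀ y, ∫⁻ z, ‖φ (y - z)‖ₑ ∂μ ≤ ENNReal.ofReal (C * (1 + ‖y‖) ^ k) := by
  obtain ⟨C, hC, hle⟩ := exists_schwartz_decay φ k
  refine ⟨C * (temperedMass μ k).toReal, by positivity, fun y => ?_⟩
  calc ∫⁻ z, ‖φ (y - z)‖ₑ ∂μ
      ≤ ∫⁻ z, ENNReal.ofReal (C * (1 + ‖y‖) ^ k) *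
        ENNReal.ofReal (1 / (1 + ‖z‖ ^ 2) ^ (k / 2)) ∂μ := by
        refine lintegral_mono fun z => ?_
        rw [← ENNReal.ofReal_mul (by positivity), ← ofReal_norm]
        refine ENNReal.ofReal_le_ofReal ((hle _).trans ?_)
        have h1 := one_add_norm_rpow_neg_le hk (y - z) (-z)
        rw [sub_neg_eq_add, sub_add_cancel, norm_neg] at h1
        have h2 : (1 + ‖z‖) ^ (-k) ≤ 1 / (1 + ‖z‖ ^ 2) ^ (k / 2) := by
          have hz := norm_nonneg z
          rw [Real.rpow_neg (by positivity), one_div]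
          refine inv_anti₀ (by positivity) ?_
          calc (1 + ‖z‖ ^ 2) ^ (k / 2) ≤ ((1 + ‖z‖) ^ 2) ^ (k / 2) :=
                Real.rpow_le_rpow (by positivity) (by nlinarith) (by positivity)
            _ = (1 + ‖z‖) ^ k := by
                rw [← Real.rpow_natCast, ← Real.rpow_mul (by positivity)]
                congr 1; push_cast; ring
        calc C * (1 + ‖y - z‖) ^ (-k) ≤ C * ((1 + ‖z‖) ^ (-k) * (1 + ‖y‖) ^ k) := by gcongr
          _ ≤ C * (1 / (1 + ‖z‖ ^ 2) ^ (k / 2) * (1 + ‖y‖) ^ k) := by gcongr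
          _ = _ := by ring
    _ = ENNReal.ofReal (C * (1 + ‖y‖) ^ k) * temperedMass μ k :=
        lintegral_const_mul' _ _ ENNReal.ofReal_ne_top
    _ = _ := by
        rw [← ENNReal.ofReal_toReal hμ.ne, ← ENNReal.ofReal_mul (by positivity),
          ENNReal.toReal_ofReal ENNReal.toReal_nonneg]
        congr 1
        ring

section Measure

variable {f : 𝓢'(Rd d, ℂ)} {μ : Measure (Rd d)} {k : ℝ}

lemma distConv_eq (hf : ∀ ψ : 𝓢(Rd d, ℂ), f ψ = ∫ x, ψ x ∂μ) (φ : 𝓢(Rd d, ℂ)) (y : Rd d) :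
    distConv f φ y = ∫ z, φ (y - z) ∂μ := by
  simp [distConv, hf]

lemma stronglyMeasurable_distConv (hf : ∀ ψ : 𝓢(Rd d, ℂ), f ψ = ∫ x, ψ x ∂μ) (hk : 0 ≤ k)
    (hμ : temperedMass μ k < ⊤) (φ : 𝓢(Rd d, ℂ)) : StronglyMeasurable (distConv f φ) := by
  have := isLocallyFiniteMeasure_of_temperedMass hk hμ
  have h1 : distConv f φ = fun y => ∫ z, φ (y - z) ∂μ := funext (distConv_eq hf φ)
  rw [h1]
  have h2 : Continuous fun z : Rd d × Rd d => φ (z.1 - z.2) :=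
    φ.continuous.comp (continuous_fst.sub continuous_snd)
  exact h2.stronglyMeasurable.integral_prod_right'

lemma exists_norm_distConv_le (hf : ∀ ψ : 𝓢(Rd d, ℂ), f ψ = ∫ x, ψ x ∂μ) (hk : 0 ≤ k)
    (hμ : temperedMass μ k < ⊤) (φ : 𝓢(Rd d, ℂ)) :
    ∃ C : ℝ, ∀ y, ‖distConv f φ y‖ ≤ C * (1 + ‖y‖) ^ k := by
  obtain ⟨C, hC, hle⟩ := exists_lintegral_translate_le hk hμ φ
  refine ⟨C, fun y => ?_⟩
  rw [distConv_eq hf]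
  have h1 := (enorm_integral_le_lintegral_enorm (μ := μ) (fun z => φ (y - z))).trans (hle y)
  rw [← ofReal_norm] at h1
  exact (ENNReal.ofReal_le_ofReal_iff (by positivity)).1 h1

lemma noiseInner_eq (hf : ∀ ψ : 𝓢(Rd d, ℂ), f ψ = ∫ x, ψ x ∂μ) (φ ψ : 𝓢(Rd d, ℂ)) :
    noiseInner f φ ψ = ∫ z, (∫ y, φ y * (starRingEnd ℂ) (ψ (y - z))) ∂μ := by
  rw [noiseInner, hf]
  congr 1
  funext z
  rw [conv_apply]
  congr 1
  funext y
  rw [conjReflect_apply, neg_sub]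

/-- The mutual energy of a Schwartz function with a real basis function is the integral against
the convolution of the noise distribution with the latter. -/
lemma noiseInner_eq_integral_mul_distConv (hf : ∀ ψ : 𝓢(Rd d, ℂ), f ψ = ∫ x, ψ x ∂μ) (hk : 0 ≤ k)
    (hμ : temperedMass μ k < ⊤) (φ : 𝓢(Rd d, ℂ)) {e : 𝓢(Rd d, ℂ)} (he : ∀ x, (e x).im = 0) :
    noiseInner f φ e = ∫ y, φ y * distConv f e y := by
  have := isLocallyFiniteMeasure_of_temperedMass hk hμ
  obtain ⟨C, hC, hle⟩ := exists_lintegral_translate_le hk hμ e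
  have hφ : IsTemperedFun φ := by
    have := IsTemperedFun.of_memLp_mul (v := fun _ => 1) (C := 1) (m := 0) (le_refl (1 : ℝ≥0∞))
      (φ.memLp 1) aestronglyMeasurable_const le_rfl (by simp)
    simpa using this
  have hcont : Continuous fun z : Rd d × Rd d => φ z.1 * e (z.1 - z.2) :=
    (φ.continuous.comp continuous_fst).mul
      (e.continuous.comp (continuous_fst.sub continuous_snd))
  have hint : Integrable (fun z : Rd d × Rd d => φ z.1 * e (z.1 - z.2)) (volume.prod μ) := by
    refine ⟨hcont.aestronglyMeasurable, ?_⟩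
    rw [hasFiniteIntegral_iff_enorm, lintegral_prod _ hcont.aestronglyMeasurable.enorm]
    obtain ⟨K, hK⟩ := (Measure.HasTemperateGrowth.exists_eLpNorm_lt_top 1
      (inferInstance : (volume : Measure (Rd d)).HasTemperateGrowth))
    obtain ⟨D, hD, hφle⟩ := exists_schwartz_decay φ (K + k)
    rw [eLpNorm_one_eq_lintegral_enorm] at hK
    calc _ ≤ ∫⁻ y, ENNReal.ofReal (D * C) * ‖(1 + ‖y‖) ^ (-K : ℝ)‖ₑ := by
          refine lintegral_mono fun y => ?_
          simp only [enorm_mul]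
          rw [lintegral_const_mul' _ _ enorm_ne_top]
          refine (mul_le_mul' le_rfl (hle y)).trans ?_
          rw [← ofReal_norm, ← ofReal_norm, ← ENNReal.ofReal_mul (by positivity),
            ← ENNReal.ofReal_mul (by positivity)]
          refine ENNReal.ofReal_le_ofReal ?_
          have hy : 0 < 1 + ‖y‖ := by positivity
          calc ‖φ y‖ * (C * (1 + ‖y‖) ^ k) ≤
                (D * (1 + ‖y‖) ^ (-(K + k))) * (C * (1 + ‖y‖) ^ k) := by
                gcongr; exact hφle y
            _ = (D * C) * ((1 + ‖y‖) ^ (-(K + k)) * (1 + ‖y‖) ^ k) := by ring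
            _ = _ := by
                rw [← Real.rpow_add hy, Real.norm_of_nonneg (by positivity)]
                congr 2
                ring
      _ < ⊤ := by
          rw [lintegral_const_mul' _ _ ENNReal.ofReal_ne_top]
          exact ENNReal.mul_lt_top ENNReal.ofReal_lt_top hK
  rw [noiseInner_eq hf]
  calc _ = ∫ z, (∫ y, φ y * e (y - z)) ∂μ := by
        congr 1; funext z; congr 1; funext y
        rw [Complex.conj_eq_iff_im.2 (he _)]
    _ = ∫ y, ∫ z, φ y * e (y - z) ∂μ := (integral_integral_swap hint).symm
    _ = _ := by
        congr 1; funext y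
        rw [integral_const_mul, distConv_eq hf]

end Measure

/-! ### The energy of a function -/

/-- `∫∫ |H(y)| |H(y - z)| dy μ(dz)`, an upper bound for the squared norm of `H` in the Hilbert
space of the noise whose correlation measure is `μ`. -/
noncomputable def energy (μ : Measure (Rd d)) (H : Rd d → ℂ) : ℝ≥0∞ :=
  ∫⁻ z, (∫⁻ y, ‖H y‖ₑ * ‖H (y - z)‖ₑ) ∂μ

lemma energy_mono {μ : Measure (Rd d)} {G H : Rd d → ℂ} (h : ∀ y, ‖G y‖ₑ ≤ ‖H y‖ₑ) :
    energy μ G ≤ energy μ H :=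
  lintegral_mono fun z => lintegral_mono fun y => mul_le_mul' (h y) (h (y - z))

lemma lintegral_enorm_mul_translate_le {G H : Rd d → ℂ} (hG : Measurable G) (hH : Measurable H)
    (z : Rd d) :
    ∫⁻ y, ‖G y‖ₑ * ‖H (y - z)‖ₑ ≤ eLpNorm G 2 volume * eLpNorm H 2 volume := by
  have h := ENNReal.lintegral_mul_le_Lp_mul_Lq (volume : Measure (Rd d))
    Real.HolderConjugate.two_two
    (f := fun y => ‖G y‖ₑ) (g := fun y => ‖H (y - z)‖ₑ) (by fun_prop) (by fun_prop)
  rw [lintegral_sub_right_eq_self (fun y => ‖H y‖ₑ ^ (2 : ℝ)) z] at h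
  rw [eLpNorm_eq_lintegral_rpow_enorm_toReal (by simp) (by simp),
    eLpNorm_eq_lintegral_rpow_enorm_toReal (by simp) (by simp)]
  simpa using h

lemma ofReal_noiseInner_re_le_energy {f : 𝓢'(Rd d, ℂ)} {μ : Measure (Rd d)}
    (hf : ∀ ψ : 𝓢(Rd d, ℂ), f ψ = ∫ x, ψ x ∂μ) (φ : 𝓢(Rd d, ℂ)) :
    ENNReal.ofReal (noiseInner f φ φ).re ≤ energy μ φ := by
  calc ENNReal.ofReal (noiseInner f φ φ).re ≤ ‖noiseInner f φ φ‖ₑ := by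
        rw [← ofReal_norm]
        exact ENNReal.ofReal_le_ofReal (Complex.re_le_norm _)
    _ ≤ ∫⁻ z, ‖(∫ y, φ y * (starRingEnd ℂ) (φ (y - z)))‖ₑ ∂μ := by
        rw [noiseInner_eq hf]
        exact enorm_integral_le_lintegral_enorm _
    _ ≤ _ := by
        refine lintegral_mono fun z => (enorm_integral_le_lintegral_enorm _).trans (le_of_eq ?_)
        congr 1; funext y
        rw [enorm_mul, ← ofReal_norm ((starRingEnd ℂ) _), Complex.norm_conj, ofReal_norm]

lemma sum_enorm_integral_sq_le_energy_of_schwartz {f : 𝓢'(Rd d, ℂ)} {μ : Measure (Rd d)} {k : ℝ}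
    (hfd : IsNonnegDefDist f) (hf : ∀ ψ : 𝓢(Rd d, ℂ), f ψ = ∫ x, ψ x ∂μ) (hk : 0 ≤ k)
    (hμ : temperedMass μ k < ⊤) {ι : Type*} {e : ι → 𝓢(Rd d, ℂ)} (he : IsNoiseBasis f e)
    (F : Finset ι) (φ : 𝓢(Rd d, ℂ)) :
    ∑ i ∈ F, ‖∫ y, φ y * distConv f (e i) y‖ₑ ^ 2 ≤ energy μ φ := by
  refine le_trans (le_of_eq ?_)
    ((ENNReal.ofReal_le_ofReal (sum_norm_noiseInner_sq_le hfd he F φ)).trans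
      (ofReal_noiseInner_re_le_energy hf φ))
  rw [ENNReal.ofReal_sum_of_nonneg fun _ _ => by positivity]
  refine Finset.sum_congr rfl fun i _ => ?_
  rw [noiseInner_eq_integral_mul_distConv hf hk hμ φ (he.real i),
    ENNReal.ofReal_pow (norm_nonneg _), ofReal_norm]

/-! ### Approximation by Schwartz functions -/

open Filter Topology Metric in
/-- A square integrable function supported in a ball is approximated in `L_2` by Schwartz functions
supported in a slightly larger ball. -/
lemma exists_schwartz_eLpNorm_sub_le {H : Rd d → ℂ} (hH : MemLp H 2 volume) {ρ : ℝ} (hρ : 0 < ρ)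
    (hsupp : ∀ y, ρ < ‖y‖ → H y = 0) {ε : ℝ} (hε : 0 < ε) :
    ∃ φ : 𝓢(Rd d, ℂ), (∀ y, ρ + 1 < ‖y‖ → φ y = 0) ∧
      eLpNorm (fun y => H y - φ y) 2 volume ≤ ENNReal.ofReal ε := by
  obtain ⟨g, hgc, hgs, hg⟩ := hH.exist_eLpNorm_sub_le (by simp) (by norm_num) hε
  let χ : ContDiffBump (0 : Rd d) := ⟨ρ, ρ + 1, hρ, by linarith⟩
  have hcs : HasCompactSupport (fun y => ((χ y : ℝ) : ℂ) * g y) := hgc.mul_left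
  have hsm : ContDiff ℝ (⊤ : ℕ∞) (fun y => ((χ y : ℝ) : ℂ) * g y) :=
    (Complex.ofRealCLM.contDiff.comp χ.contDiff).mul hgs
  refine ⟨hcs.toSchwartzMap hsm, fun y hy => ?_, ?_⟩
  · change ((χ y : ℝ) : ℂ) * g y = 0
    rw [χ.zero_of_le_dist (by simpa using hy.le)]
    simp
  · refine le_trans (eLpNorm_mono fun y => ?_) hg
    change ‖H y - ((χ y : ℝ) : ℂ) * g y‖ ≤ ‖H y - g y‖
    rcases le_or_gt ‖y‖ ρ with hy | hy
    · rw [χ.one_of_mem_closedBall (by simpa using hy)]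
      simp
    · rw [hsupp y hy, zero_sub, zero_sub, norm_neg, norm_neg, norm_mul, Complex.norm_real,
        Real.norm_of_nonneg χ.nonneg]
      exact mul_le_of_le_one_left (norm_nonneg _) χ.le_one

/-- Perturbation bound for the energy. Functions supported in a ball interact only through the
restriction of `μ` to a ball, which has finite measure. -/
lemma energy_sub_le {μ : Measure (Rd d)} [SFinite μ] {H D : Rd d → ℂ} (hH : Measurable H)
    (hD : Measurable D) {ρ : ℝ} (hHs : ∀ y, ρ < ‖y‖ → H y = 0) (hDs : ∀ y, ρ < ‖y‖ → D y = 0) :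
    energy μ (fun y => H y - D y) ≤ energy μ H + μ (Metric.closedBall 0 (2 * ρ)) *
      (2 * eLpNorm H 2 volume * eLpNorm D 2 volume + eLpNorm D 2 volume ^ 2) := by
  set K := 2 * eLpNorm H 2 volume * eLpNorm D 2 volume + eLpNorm D 2 volume ^ 2 with hK
  set B : Set (Rd d) := Metric.closedBall 0 (2 * ρ)
  have hfar : ∀ (G : Rd d → ℂ), (∀ y, ρ < ‖y‖ → G y = 0) → ∀ z ∉ B, ∀ y,
      ‖G y‖ₑ * ‖G (y - z)‖ₑ = 0 := by
    intro G hG z hz y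
    have hz : 2 * ρ < ‖z‖ := by simpa [B] using hz
    rcases le_or_gt ‖y‖ ρ with hy | hy
    · have h1 : ‖z‖ ≤ ‖y‖ + ‖y - z‖ := by
        have := norm_sub_le y (y - z)
        rwa [sub_sub_cancel] at this
      rw [hG (y - z) (by linarith)]
      simp
    · rw [hG y hy]
      simp
  have hpt : ∀ z, ∫⁻ y, ‖H y - D y‖ₑ * ‖H (y - z) - D (y - z)‖ₑ ≤
      (∫⁻ y, ‖H y‖ₑ * ‖H (y - z)‖ₑ) + B.indicator (fun _ => K) z := by
    intro z
    by_cases hz : z ∈ B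
    · rw [Set.indicator_of_mem hz]
      calc ∫⁻ y, ‖H y - D y‖ₑ * ‖H (y - z) - D (y - z)‖ₑ
          ≤ ∫⁻ y, (‖H y‖ₑ * ‖H (y - z)‖ₑ + (‖H y‖ₑ * ‖D (y - z)‖ₑ +
              (‖D y‖ₑ * ‖H (y - z)‖ₑ + ‖D y‖ₑ * ‖D (y - z)‖ₑ))) := by
            refine lintegral_mono fun y => ?_
            refine (mul_le_mul' enorm_sub_le enorm_sub_le).trans (le_of_eq ?_)
            ring
        _ = (∫⁻ y, ‖H y‖ₑ * ‖H (y - z)‖ₑ) + ((∫⁻ y, ‖H y‖ₑ * ‖D (y - z)‖ₑ) +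
              ((∫⁻ y, ‖D y‖ₑ * ‖H (y - z)‖ₑ) + ∫⁻ y, ‖D y‖ₑ * ‖D (y - z)‖ₑ)) := by
            rw [lintegral_add_left (by fun_prop), lintegral_add_left (by fun_prop),
              lintegral_add_left (by fun_prop)]
        _ ≤ (∫⁻ y, ‖H y‖ₑ * ‖H (y - z)‖ₑ) + (eLpNorm H 2 volume * eLpNorm D 2 volume +
              (eLpNorm D 2 volume * eLpNorm H 2 volume +
                eLpNorm D 2 volume * eLpNorm D 2 volume)) := by
            gcongr
            · exact lintegral_enorm_mul_translate_le hH hD z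
            · exact lintegral_enorm_mul_translate_le hD hH z
            · exact lintegral_enorm_mul_translate_le hD hD z
        _ = _ := by rw [hK]; ring
    · have h0 := hfar (fun y => H y - D y) (fun y hy => by simp [hHs y hy, hDs y hy]) z hz
      simp [h0]
  calc energy μ (fun y => H y - D y)
      ≤ ∫⁻ z, ((∫⁻ y, ‖H y‖ₑ * ‖H (y - z)‖ₑ) + B.indicator (fun _ => K) z) ∂μ :=
        lintegral_mono hpt
    _ = energy μ H + K * μ B := by
        rw [lintegral_add_right _ (measurable_const.indicator Metric.isClosed_closedBall.measurableSet),
          lintegral_indicator_const Metric.isClosed_closedBall.measurableSet]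
        rfl
    _ = _ := by rw [mul_comm K]

/-! ### Bessel's inequality for functions -/

section BesselInequality

variable {f : 𝓢'(Rd d, ℂ)} {μ : Measure (Rd d)} {k : ℝ} {ι : Type*} {e : ι → 𝓢(Rd d, ℂ)}

open Filter Topology in
/-- Bessel's inequality extends from Schwartz functions to bounded functions of compact support by
`L_2` approximation with uniformly bounded supports. -/
lemma sum_enorm_integral_sq_le_energy_of_bounded
    (hfd : IsNonnegDefDist f) (hf : ∀ ψ : 𝓢(Rd d, ℂ), f ψ = ∫ x, ψ x ∂μ) (hk : 0 ≤ k)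
    (hμ : temperedMass μ k < ⊤) (he : IsNoiseBasis f e) (F : Finset ι) {H : Rd d → ℂ}
    (hH : Measurable H) {ρ M : ℝ} (hρ : 0 < ρ) (hsupp : ∀ y, ρ < ‖y‖ → H y = 0)
    (hM : ∀ y, ‖H y‖ ≤ M) :
    ∑ i ∈ F, ‖∫ y, H y * distConv f (e i) y‖ₑ ^ 2 ≤ energy μ H := by
  have hlf := isLocallyFiniteMeasure_of_temperedMass hk hμ
  set B : Set (Rd d) := Metric.closedBall 0 (ρ + 1)
  have hBm : MeasurableSet B := Metric.isClosed_closedBall.measurableSet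
  have hBfin : IsFiniteMeasure (volume.restrict B) :=
    ⟨by rw [Measure.restrict_apply_univ]; exact MeasureTheory.measure_closedBall_lt_top⟩
  have hB0 : ∀ G : Rd d → ℂ, (∀ y, ρ + 1 < ‖y‖ → G y = 0) → ∀ y ∉ B, G y = 0 := by
    intro G hG y hy
    exact hG y (by simpa [B] using hy)
  have hH2 : MemLp H 2 volume := by
    have h1 : B.indicator H = H := by
      rw [Set.indicator_eq_self]
      intro y hy
      by_contra hyB
      exact hy (hB0 H (fun y hy => hsupp y (by linarith)) y hyB)
    rw [← h1, memLp_indicator_iff_restrict hBm]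
    exact MemLp.of_bound hH.aestronglyMeasurable M (Eventually.of_forall hM)
  choose φ hφs hφ using fun n : ℕ => exists_schwartz_eLpNorm_sub_le hH2 hρ hsupp
    (ε := 1 / ((n : ℝ) + 1)) (by positivity)
  set D : ℕ → Rd d → ℂ := fun n y => H y - φ n y with hD_def
  have hDm : ∀ n, Measurable (D n) := fun n => hH.sub (φ n).continuous.measurable
  have hDs : ∀ n y, ρ + 1 < ‖y‖ → D n y = 0 := fun n y hy => by
    simp [hD_def, hφs n y hy, hsupp y (by linarith)]
  have hφD : ∀ n, (fun y => H y - D n y) = φ n := fun n => by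
    funext y; simp [hD_def]
  have hDlim : Tendsto (fun n => eLpNorm (D n) 2 volume) atTop (𝓝 0) := by
    refine tendsto_of_tendsto_of_tendsto_of_le_of_le tendsto_const_nhds ?_ (fun _ => zero_le) hφ
    rw [← ENNReal.ofReal_zero]
    exact ENNReal.tendsto_ofReal tendsto_one_div_add_atTop_nhds_zero_nat
  have hle : ∀ n, ∑ i ∈ F, ‖∫ y, φ n y * distConv f (e i) y‖ₑ ^ 2 ≤
      energy μ H + μ (Metric.closedBall 0 (2 * (ρ + 1))) *
      (2 * eLpNorm H 2 volume * eLpNorm (D n) 2 volume + eLpNorm (D n) 2 volume ^ 2) := by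
    intro n
    refine (sum_enorm_integral_sq_le_energy_of_schwartz hfd hf hk hμ he F (φ n)).trans ?_
    rw [← hφD n]
    exact energy_sub_le hH (hDm n) (fun y hy => hsupp y (by linarith)) (hDs n)
  have hrhs : Tendsto (fun n => energy μ H + μ (Metric.closedBall 0 (2 * (ρ + 1))) *
      (2 * eLpNorm H 2 volume * eLpNorm (D n) 2 volume + eLpNorm (D n) 2 volume ^ 2)) atTop
      (𝓝 (energy μ H)) := by
    have h1 : Tendsto (fun n => 2 * eLpNorm H 2 volume * eLpNorm (D n) 2 volume +
        eLpNorm (D n) 2 volume ^ 2) atTop (𝓝 (2 * eLpNorm H 2 volume * 0 + 0 ^ 2)) :=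
      (ENNReal.Tendsto.const_mul hDlim (Or.inr (ENNReal.mul_ne_top (by simp) hH2.2.ne))).add
        (ENNReal.Tendsto.pow hDlim)
    have h2 := ENNReal.Tendsto.const_mul h1
      (Or.inr (measure_closedBall_lt_top hk hμ (2 * (ρ + 1))).ne)
    have h3 := h2.const_add (energy μ H)
    simpa using h3
  have hlhs : Tendsto (fun n => ∑ i ∈ F, ‖∫ y, φ n y * distConv f (e i) y‖ₑ ^ 2) atTop
      (𝓝 (∑ i ∈ F, ‖∫ y, H y * distConv f (e i) y‖ₑ ^ 2)) := by
    refine tendsto_finsetSum _ fun i _ => ENNReal.Tendsto.pow (Tendsto.enorm ?_)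
    set v := distConv f (e i) with hv
    have hvm : Measurable v := (stronglyMeasurable_distConv hf hk hμ (e i)).measurable
    obtain ⟨C, hC⟩ := exists_norm_distConv_le hf hk hμ (e i)
    have hC0 : 0 ≤ C := by simpa using (norm_nonneg _).trans (hC 0)
    have hv2 : MemLp (B.indicator v) 2 volume := by
      rw [memLp_indicator_iff_restrict hBm]
      refine MemLp.of_bound hvm.aestronglyMeasurable (C * (1 + (ρ + 1)) ^ k) ?_
      refine ae_restrict_of_forall_mem hBm fun y hy => (hC y).trans ?_
      have : ‖y‖ ≤ ρ + 1 := by simpa [B] using hy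
      gcongr
    have hmul : ∀ G : Rd d → ℂ, (∀ y ∉ B, G y = 0) →
        (fun y => G y * v y) = fun y => G y * B.indicator v y := by
      intro G hG
      funext y
      by_cases hy : y ∈ B
      · rw [Set.indicator_of_mem hy]
      · simp [hG y hy]
    have hint : ∀ G : Rd d → ℂ, (∀ y ∉ B, G y = 0) → MemLp G 2 volume →
        Integrable (fun y => G y * v y) := by
      intro G hG hG2
      rw [hmul G hG]
      exact hG2.integrable_mul hv2
    have hHB := hB0 H (fun y hy => hsupp y (by linarith))
    rw [tendsto_iff_edist_tendsto_0]
    refine tendsto_of_tendsto_of_tendsto_of_le_of_le tendsto_const_nhds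
      (g := fun _ => 0) (h := fun n => eLpNorm (D n) 2 volume * eLpNorm (B.indicator v) 2 volume)
      ?_ (fun _ => zero_le) (fun n => ?_)
    · have := ENNReal.Tendsto.mul_const hDlim (Or.inr hv2.2.ne)
      simpa using this
    · have hD2 : MemLp (D n) 2 volume := hH2.sub ((φ n).memLp 2)
      rw [edist_comm, edist_eq_enorm_sub, ← integral_sub (hint H hHB hH2)
        (hint (φ n) (hB0 _ (hφs n)) ((φ n).memLp 2))]
      refine (enorm_integral_le_lintegral_enorm _).trans ?_
      have h1 := lintegral_enorm_mul_translate_le (hDm n) (hvm.indicator hBm) 0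
      refine le_trans (le_of_eq ?_) h1
      congr 1
      funext y
      have := congrFun (hmul (D n) (hB0 _ (hDs n))) y
      rw [← sub_mul, this, enorm_mul, sub_zero]
  exact le_of_tendsto_of_tendsto' hlhs hrhs hle

open Filter Topology in
/-- Bessel's inequality for functions: the coefficients of `H` with respect to the basis are the
integrals of `H` against `f ∗ e_i`, and the sum of their squares is at most the energy of `H`. -/
theorem tsum_enorm_integral_sq_le_energy
    (hfd : IsNonnegDefDist f) (hf : ∀ ψ : 𝓢(Rd d, ℂ), f ψ = ∫ x, ψ x ∂μ) (hk : 0 ≤ k)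
    (hμ : temperedMass μ k < ⊤) (he : IsNoiseBasis f e) {H : Rd d → ℂ} (hH : Measurable H)
    (hint : ∀ i, Integrable (fun y => H y * distConv f (e i) y)) :
    ∑' i, ‖∫ y, H y * distConv f (e i) y‖ₑ ^ 2 ≤ energy μ H := by
  rw [ENNReal.tsum_eq_iSup_sum]
  refine iSup_le fun F => ?_
  set S : ℕ → Set (Rd d) := fun n => {y | ‖H y‖ ≤ n ∧ ‖y‖ ≤ n + 1}
  have hS : ∀ n, MeasurableSet (S n) := fun n =>
    (measurableSet_le hH.norm measurable_const).inter
      (measurableSet_le measurable_norm measurable_const)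
  have hle : ∀ n : ℕ, ∑ i ∈ F, ‖∫ y, (S n).indicator H y * distConv f (e i) y‖ₑ ^ 2 ≤
      energy μ H := by
    intro n
    refine (sum_enorm_integral_sq_le_energy_of_bounded hfd hf hk hμ he F (hH.indicator (hS n))
      (ρ := n + 1) (M := n) (by positivity) ?_ ?_).trans (energy_mono ?_)
    · intro y hy
      exact Set.indicator_of_notMem (fun h => absurd h.2 (not_le.2 hy)) _
    · intro y
      by_cases hy : y ∈ S n
      · rw [Set.indicator_of_mem hy]; exact hy.1
      · rw [Set.indicator_of_notMem hy]; simp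
    · intro y
      by_cases hy : y ∈ S n
      · rw [Set.indicator_of_mem hy]
      · rw [Set.indicator_of_notMem hy]; simp
  have hlim : Tendsto (fun n => ∑ i ∈ F, ‖∫ y, (S n).indicator H y * distConv f (e i) y‖ₑ ^ 2)
      atTop (𝓝 (∑ i ∈ F, ‖∫ y, H y * distConv f (e i) y‖ₑ ^ 2)) := by
    refine tendsto_finsetSum F fun i _ => ENNReal.Tendsto.pow (Tendsto.enorm ?_)
    have hvm := (stronglyMeasurable_distConv hf hk hμ (e i)).measurable
    refine tendsto_integral_of_dominated_convergence (fun y => ‖H y * distConv f (e i) y‖)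
      (fun n => ((hH.indicator (hS n)).mul hvm).aestronglyMeasurable) (hint i).norm
      (fun n => Eventually.of_forall fun y => ?_) (Eventually.of_forall fun y => ?_)
    · by_cases hy : y ∈ S n
      · rw [Set.indicator_of_mem hy]
      · rw [Set.indicator_of_notMem hy, zero_mul, norm_zero]
        positivity
    · refine tendsto_const_nhds.congr' ?_
      obtain ⟨n, hn⟩ := exists_nat_ge (max ‖H y‖ ‖y‖)
      filter_upwards [eventually_ge_atTop n] with m hm
      have hnm : (n : ℝ) ≤ m := by exact_mod_cast hm
      rw [max_le_iff] at hn
      rw [Set.indicator_of_mem (show y ∈ S m from ⟨by linarith, by linarith⟩)]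
  exact le_of_tendsto' hlim hle

end BesselInequality

/-! ### Mixed norm inequalities -/

/-- Jensen's inequality for a measure that need not have mass one. -/
lemma lintegral_rpow_le_measure_univ_rpow_mul {Y : Type*} [MeasurableSpace Y] (ν : Measure Y)
    {g : Y → ℝ≥0∞} (hg : AEMeasurable g ν) {q : ℝ} (hq : 1 ≤ q) :
    (∫⁻ y, g y ∂ν) ^ q ≤ ν Set.univ ^ (q - 1) * ∫⁻ y, g y ^ q ∂ν := by
  have hq0 : 0 < q := by linarith
  have h1q : 1 / q ≤ 1 := by rw [div_le_one hq0]; exact hq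
  have h := ENNReal.lintegral_mul_norm_pow_le (μ := ν) (f := fun y => g y ^ q) (g := fun _ => 1)
    (hg.pow_const q) aemeasurable_const (p := 1 / q) (q := 1 - 1 / q) (by positivity)
    (by linarith) (by ring)
  simp only [← ENNReal.rpow_mul, mul_one_div_cancel hq0.ne', ENNReal.rpow_one, ENNReal.one_rpow,
    mul_one, lintegral_one] at h
  calc (∫⁻ y, g y ∂ν) ^ q
      ≤ ((∫⁻ y, g y ^ q ∂ν) ^ (1 / q) * ν Set.univ ^ (1 - 1 / q)) ^ q :=
        ENNReal.rpow_le_rpow h hq0.le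
    _ = _ := by
        rw [ENNReal.mul_rpow_of_nonneg _ _ hq0.le, ← ENNReal.rpow_mul, ← ENNReal.rpow_mul,
          one_div_mul_cancel hq0.ne', ENNReal.rpow_one, sub_mul, one_div_mul_cancel hq0.ne',
          one_mul, mul_comm]

/-- A form of Minkowski's integral inequality: the `L_q` norm in `x` of an average in `y` is
controlled by a bound, uniform in `y`, of the `L_q` norms. -/
lemma lintegral_lintegral_rpow_le {X Y : Type*} [MeasurableSpace X] [MeasurableSpace Y]
    {m : Measure X} {ν : Measure Y} [SFinite m] [SFinite ν] {G : X → Y → ℝ≥0∞}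
    (hG : Measurable (Function.uncurry G)) {q : ℝ} (hq : 1 ≤ q) {B : ℝ≥0∞}
    (hB : ∀ y, ∫⁻ x, G x y ^ q ∂m ≤ B) :
    ∫⁻ x, (∫⁻ y, G x y ∂ν) ^ q ∂m ≤ ν Set.univ ^ q * B := by
  have hGq : Measurable (Function.uncurry fun x y => G x y ^ q) := hG.pow_const q
  calc ∫⁻ x, (∫⁻ y, G x y ∂ν) ^ q ∂m
      ≤ ∫⁻ x, ν Set.univ ^ (q - 1) * (∫⁻ y, G x y ^ q ∂ν) ∂m :=
        lintegral_mono fun x => lintegral_rpow_le_measure_univ_rpow_mul ν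
          (hG.comp measurable_prodMk_left).aemeasurable hq
    _ = ν Set.univ ^ (q - 1) * ∫⁻ x, (∫⁻ y, G x y ^ q ∂ν) ∂m :=
        lintegral_const_mul _ hGq.lintegral_prod_right'
    _ = ν Set.univ ^ (q - 1) * ∫⁻ y, (∫⁻ x, G x y ^ q ∂m) ∂ν := by
        rw [lintegral_lintegral_swap hGq.aemeasurable]
    _ ≤ ν Set.univ ^ (q - 1) * ∫⁻ _, B ∂ν := by
        gcongr with y
        exact hB y
    _ = ν Set.univ ^ q * B := by
        rw [lintegral_const, mul_comm B, ← mul_assoc]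
        congr 1
        nth_rewrite 2 [← ENNReal.rpow_one (ν Set.univ)]
        rw [← ENNReal.rpow_add_of_nonneg _ _ (by linarith) zero_le_one]
        congr 1
        ring

lemma lintegral_mul_translate_le {h : Rd d → ℝ≥0∞} (hh : Measurable h) (z : Rd d) :
    ∫⁻ y, h y * h (y - z) ≤ ∫⁻ y, h y ^ (2 : ℝ) := by
  have h1 := ENNReal.lintegral_mul_le_Lp_mul_Lq (volume : Measure (Rd d))
    Real.HolderConjugate.two_two (f := h) (g := fun y => h (y - z)) (by fun_prop) (by fun_prop)
  rw [lintegral_sub_right_eq_self (fun y => h y ^ (2 : ℝ)) z,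
    ← ENNReal.rpow_add_of_nonneg _ _ (by norm_num) (by norm_num)] at h1
  norm_num at h1
  simpa using h1

/-! ### Energies with respect to a correlation measure -/

/-- `∫∫ R^r(y) R^r(y + z) |u(x - y)|^r |u(x - y - z)|^r (1 + |z|²)^(k(r-1)/2) dy μ(dz)`, where
`R = R_{1-γ}`. -/
noncomputable def weightedAverage (μ : Measure (Rd d)) (k γ r : ℝ) (u : Rd d → ℂ) (x : Rd d) :
    ℝ≥0∞ :=
  ∫⁻ z, (∫⁻ y, ENNReal.ofReal ((1 + ‖z‖ ^ 2) ^ (k * (r - 1) / 2)) *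
    (besselKernel (1 - γ) (y + z) ^ r * besselKernel (1 - γ) y ^ r) *
      (‖u (x - y)‖ₑ ^ r * ‖u (x - y - z)‖ₑ ^ r)) ∂μ

section

variable {μ : Measure (Rd d)} {k γ r : ℝ} {u : Rd d → ℂ}

lemma measurable_weightedDensity (k γ r : ℝ) : Measurable (fun w : Rd d × Rd d =>
    ENNReal.ofReal ((1 + ‖w.1‖ ^ 2) ^ (k * (r - 1) / 2)) *
    (besselKernel (1 - γ) (w.2 + w.1) ^ r * besselKernel (1 - γ) w.2 ^ r)) := by
  have hR := measurable_besselKernel (d := d) (1 - γ)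
  fun_prop

/-- The average of the products `|u(x - y)|^r |u(x - y - z)|^r` is bounded in `L_{p/2r}`, by
Minkowski's inequality and the Cauchy-Schwarz inequality. -/
lemma lintegral_weightedAverage_rpow_le [SFinite μ] (hu : Measurable u) (hr : 0 < r) {p : ℝ}
    (hp : 2 * r ≤ p) :
    ∫⁻ x, weightedAverage μ k γ r u x ^ (p / (2 * r)) ≤
      kernelIntegral μ k γ r ^ (p / (2 * r)) * ∫⁻ x, ‖u x‖ₑ ^ p := by
  set dens : Rd d × Rd d → ℝ≥0∞ := fun w =>
    ENNReal.ofReal ((1 + ‖w.1‖ ^ 2) ^ (k * (r - 1) / 2)) *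
    (besselKernel (1 - γ) (w.2 + w.1) ^ r * besselKernel (1 - γ) w.2 ^ r) with hdens
  have hdm : Measurable dens := measurable_weightedDensity k γ r
  set ν := (μ.prod volume).withDensity dens
  have hν : ν Set.univ = kernelIntegral μ k γ r := by
    rw [withDensity_apply _ MeasurableSet.univ, Measure.restrict_univ,
      lintegral_prod _ hdm.aemeasurable]
    unfold kernelIntegral
    congr 1
    funext z
    simp only [hdens]
    rw [lintegral_const_mul' _ _ ENNReal.ofReal_ne_top, mul_comm]
    congr 1
    rw [← lintegral_neg_eq_self (μ := volume)]
    congr 1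
    funext y
    rw [besselKernel_neg, neg_add_eq_sub]
  set G : Rd d → Rd d × Rd d → ℝ≥0∞ := fun x w =>
    ‖u (x - w.2)‖ₑ ^ r * ‖u (x - w.2 - w.1)‖ₑ ^ r with hG
  have hGm : Measurable (Function.uncurry G) := by
    simp only [hG, Function.uncurry_def]
    fun_prop
  have hF : ∀ x, weightedAverage μ k γ r u x = ∫⁻ w, G x w ∂ν := by
    intro x
    have hGx : Measurable (G x) := by simp only [hG]; fun_prop
    have hm : AEMeasurable (dens * G x) (μ.prod volume) := (hdm.mul hGx).aemeasurable
    have h1 : ∫⁻ w, G x w ∂ν = ∫⁻ w, (dens * G x) w ∂(μ.prod volume) :=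
      lintegral_withDensity_eq_lintegral_mul _ hdm hGx
    rw [h1, lintegral_prod _ hm]
    simp only [Pi.mul_apply, hdens, hG, weightedAverage]
  simp only [hF]
  have hq : 1 ≤ p / (2 * r) := by
    rw [le_div_iff₀ (by positivity)]; linarith
  rw [← hν]
  refine lintegral_lintegral_rpow_le hGm hq fun w => ?_
  have hh : Measurable fun x => ‖u x‖ₑ ^ (p / 2) := by fun_prop
  calc ∫⁻ x, G x w ^ (p / (2 * r))
      = ∫⁻ x, ‖u (x - w.2)‖ₑ ^ (p / 2) * ‖u (x - w.2 - w.1)‖ₑ ^ (p / 2) := by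
        congr 1
        funext x
        simp only [hG]
        rw [ENNReal.mul_rpow_of_nonneg _ _ (by linarith), ← ENNReal.rpow_mul, ← ENNReal.rpow_mul]
        have : r * (p / (2 * r)) = p / 2 := by field_simp
        rw [this]
    _ = ∫⁻ x, ‖u x‖ₑ ^ (p / 2) * ‖u (x - w.1)‖ₑ ^ (p / 2) :=
        lintegral_sub_right_eq_self
          (fun x => ‖u x‖ₑ ^ (p / 2) * ‖u (x - w.1)‖ₑ ^ (p / 2)) w.2
    _ ≤ ∫⁻ x, (‖u x‖ₑ ^ (p / 2)) ^ (2 : ℝ) := lintegral_mul_translate_le hh w.1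
    _ = _ := by
        congr 1
        funext x
        rw [← ENNReal.rpow_mul]
        congr 1
        ring

/-- The energy of `y ↦ R(x - y) ξ(y) u(y)`, after the substitution `y ↦ x - y`. -/
lemma energy_besselKernel_mul_le {ξ : Rd d → ℂ} (x : Rd d) :
    energy μ (fun y => (((besselKernel (1 - γ) (x - y)).toReal : ℝ) : ℂ) * (ξ y * u y)) ≤
    ∫⁻ z, (∫⁻ y, (‖ξ (x - y)‖ₑ * ‖ξ (x - y - z)‖ₑ) *
      ((besselKernel (1 - γ) (y + z) * besselKernel (1 - γ) y) *
        (‖u (x - y)‖ₑ * ‖u (x - y - z)‖ₑ))) ∂μ := by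
  refine lintegral_mono fun z => ?_
  rw [← lintegral_sub_left_eq_self _ x]
  refine lintegral_mono fun y => ?_
  simp only [enorm_mul]
  have h1 : x - (x - y) = y := by abel
  have h2 : x - (x - y - z) = y + z := by abel
  rw [h1, h2]
  calc _ ≤ besselKernel (1 - γ) y * (‖ξ (x - y)‖ₑ * ‖u (x - y)‖ₑ) *
        (besselKernel (1 - γ) (y + z) * (‖ξ (x - y - z)‖ₑ * ‖u (x - y - z)‖ₑ)) := by
        gcongr <;> exact enorm_besselKernel_toReal_le _ _
    _ = _ := by ring

/-- Bound of the energy for bounded `ξ`, where `r = 1`. -/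
lemma energy_le_of_bounded {ξ : Rd d → ℂ} {M : ℝ≥0∞} (hM' : M ≠ ⊤) (hM : ∀ y, ‖ξ y‖ₑ ≤ M)
    (x : Rd d) :
    energy μ (fun y => (((besselKernel (1 - γ) (x - y)).toReal : ℝ) : ℂ) * (ξ y * u y)) ≤
      M ^ 2 * weightedAverage μ k γ 1 u x := by
  refine (energy_besselKernel_mul_le x).trans ?_
  unfold weightedAverage
  have hM2 : M ^ 2 ≠ ⊤ := ENNReal.pow_ne_top hM'
  rw [← lintegral_const_mul' _ _ hM2]
  refine lintegral_mono fun z => ?_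
  rw [← lintegral_const_mul' _ _ hM2]
  refine lintegral_mono fun y => ?_
  simp only [sub_self, mul_zero, zero_div, Real.rpow_zero, ENNReal.ofReal_one, one_mul,
    ENNReal.rpow_one, sq]
  gcongr
  · exact hM _
  · exact hM _

/-- Bound of the energy by Hölder's inequality on `dy μ(dz)`. The weight `(1 + |z|²)^(k/2)` is
split between the two factors so that the one containing `ξ` sees the tempered mass of `μ`. -/
lemma energy_le_of_holder [SFinite μ] {ξ : Rd d → ℂ} (hξ : Measurable ξ) (hu : Measurable u) {s : ℝ}
    (hsr : s.HolderConjugate r) (x : Rd d) :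
    energy μ (fun y => (((besselKernel (1 - γ) (x - y)).toReal : ℝ) : ℂ) * (ξ y * u y)) ≤
      (temperedMass μ k * ∫⁻ y, ‖ξ y‖ₑ ^ (2 * s)) ^ (1 / s) *
        weightedAverage μ k γ r u x ^ (1 / r) := by
  have hR := measurable_besselKernel (d := d) (1 - γ)
  have hs0 : 0 < s := hsr.pos
  have hr0 : 0 < r := hsr.symm.pos
  set w : Rd d → ℝ≥0∞ := fun z => ENNReal.ofReal ((1 + ‖z‖ ^ 2) ^ (k / 2)) with hw
  have hwm : Measurable w := by simp only [hw]; fun_prop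
  have hpos : ∀ z : Rd d, 0 < (1 + ‖z‖ ^ 2) ^ (k / 2) := fun z => by positivity
  have hw0 : ∀ z, w z ≠ 0 := fun z => by simp [hw, hpos]
  have hwt : ∀ z, w z ≠ ⊤ := fun z => ENNReal.ofReal_ne_top
  set a : Rd d × Rd d → ℝ≥0∞ := fun v =>
    w v.1 ^ (-(1 / s)) * (‖ξ (x - v.2)‖ₑ * ‖ξ (x - v.2 - v.1)‖ₑ) with ha
  set b : Rd d × Rd d → ℝ≥0∞ := fun v => w v.1 ^ (1 / s) *
      ((besselKernel (1 - γ) (v.2 + v.1) * besselKernel (1 - γ) v.2) *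
        (‖u (x - v.2)‖ₑ * ‖u (x - v.2 - v.1)‖ₑ)) with hb
  have ham : Measurable a := by simp only [ha]; fun_prop
  have hbm : Measurable b := by simp only [hb]; fun_prop
  have hab : ∀ v, (a * b) v = (‖ξ (x - v.2)‖ₑ * ‖ξ (x - v.2 - v.1)‖ₑ) *
      ((besselKernel (1 - γ) (v.2 + v.1) * besselKernel (1 - γ) v.2) *
        (‖u (x - v.2)‖ₑ * ‖u (x - v.2 - v.1)‖ₑ)) := by
    intro v
    have h1 : w v.1 ^ (-(1 / s)) * w v.1 ^ (1 / s) = 1 := by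
      rw [← ENNReal.rpow_add _ _ (hw0 _) (hwt _), neg_add_cancel, ENNReal.rpow_zero]
    simp only [Pi.mul_apply, ha, hb]
    calc _ = (w v.1 ^ (-(1 / s)) * w v.1 ^ (1 / s)) *
          ((‖ξ (x - v.2)‖ₑ * ‖ξ (x - v.2 - v.1)‖ₑ) *
          ((besselKernel (1 - γ) (v.2 + v.1) * besselKernel (1 - γ) v.2) *
            (‖u (x - v.2)‖ₑ * ‖u (x - v.2 - v.1)‖ₑ))) := by ring
      _ = _ := by rw [h1, one_mul]
  have hA : ∫⁻ v, a v ^ s ∂(μ.prod volume) ≤ temperedMass μ k * ∫⁻ y, ‖ξ y‖ₑ ^ (2 * s) := by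
    rw [lintegral_prod _ (ham.pow_const s).aemeasurable]
    have hξs : Measurable fun y => ‖ξ y‖ₑ ^ s := by fun_prop
    calc ∫⁻ z, (∫⁻ y, a (z, y) ^ s) ∂μ
        ≤ ∫⁻ z, ENNReal.ofReal (1 / (1 + ‖z‖ ^ 2) ^ (k / 2)) *
            (∫⁻ y, ‖ξ y‖ₑ ^ (2 * s)) ∂μ := by
          refine lintegral_mono fun z => ?_
          have h1 : ∀ y, a (z, y) ^ s = ENNReal.ofReal (1 / (1 + ‖z‖ ^ 2) ^ (k / 2)) *
              (‖ξ (x - y)‖ₑ ^ s * ‖ξ (x - y - z)‖ₑ ^ s) := by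
            intro y
            simp only [ha]
            rw [ENNReal.mul_rpow_of_nonneg _ _ hs0.le, ENNReal.mul_rpow_of_nonneg _ _ hs0.le,
              ← ENNReal.rpow_mul, neg_mul, one_div_mul_cancel hs0.ne', ENNReal.rpow_neg_one, one_div,
              ENNReal.ofReal_inv_of_pos (hpos z)]
          simp only [h1]
          rw [lintegral_const_mul' _ _ ENNReal.ofReal_ne_top,
            lintegral_sub_left_eq_self (fun y => ‖ξ y‖ₑ ^ s * ‖ξ (y - z)‖ₑ ^ s) x]
          refine mul_le_mul' le_rfl ?_
          refine (lintegral_mul_translate_le hξs z).trans (le_of_eq ?_)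
          congr 1
          funext y
          rw [← ENNReal.rpow_mul, mul_comm]
      _ = _ := lintegral_mul_const _ (by fun_prop)
  have hB : ∫⁻ v, b v ^ r ∂(μ.prod volume) = weightedAverage μ k γ r u x := by
    rw [lintegral_prod _ (hbm.pow_const r).aemeasurable]
    unfold weightedAverage
    congr 1; funext z; congr 1; funext y
    simp only [hb]
    rw [ENNReal.mul_rpow_of_nonneg _ _ hr0.le, ENNReal.mul_rpow_of_nonneg _ _ hr0.le,
      ENNReal.mul_rpow_of_nonneg _ _ hr0.le, ENNReal.mul_rpow_of_nonneg _ _ hr0.le,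
      ← ENNReal.rpow_mul, ← mul_assoc]
    congr 2
    simp only [hw]
    rw [ENNReal.ofReal_rpow_of_pos (hpos z), ← Real.rpow_mul (by positivity)]
    congr 2
    have h1 := hsr.inv_add_inv_eq_one
    have h2 : 1 / s * r = r - 1 := by
      rw [one_div, eq_sub_of_add_eq h1, sub_mul, inv_mul_cancel₀ hr0.ne', one_mul]
    rw [h2]
    ring
  calc energy μ _ ≤ ∫⁻ v, (a * b) v ∂(μ.prod volume) := by
        refine (energy_besselKernel_mul_le x).trans (le_of_eq ?_)
        rw [lintegral_prod _ (ham.mul hbm).aemeasurable]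
        simp only [hab]
    _ ≤ (∫⁻ v, a v ^ s ∂(μ.prod volume)) ^ (1 / s) *
        (∫⁻ v, b v ^ r ∂(μ.prod volume)) ^ (1 / r) :=
        ENNReal.lintegral_mul_le_Lp_mul_Lq _ hsr ham.aemeasurable hbm.aemeasurable
    _ ≤ _ := by
        rw [hB]
        gcongr

end

/-! ### Bounded correlation functions -/

/-- `∫ R^r(y) |u(x - y)|^r dy`, where `R = R_{1-γ}`. -/
noncomputable def kernelAverage (γ r : ℝ) (u : Rd d → ℂ) (x : Rd d) : ℝ≥0∞ :=
  ∫⁻ y, besselKernel (1 - γ) y ^ r * ‖u (x - y)‖ₑ ^ r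

/-- Young's inequality for the convolution of `R^r` with `|u|^r`. -/
lemma lintegral_kernelAverage_rpow_le {γ r p : ℝ} {u : Rd d → ℂ} (hu : Measurable u) (hr : 0 < r)
    (hp : r ≤ p) :
    ∫⁻ x, kernelAverage γ r u x ^ (p / r) ≤
      (∫⁻ y : Rd d, besselKernel (1 - γ) y ^ r) ^ (p / r) * ∫⁻ x, ‖u x‖ₑ ^ p := by
  have hR : Measurable fun y : Rd d => besselKernel (1 - γ) y ^ r :=
    (measurable_besselKernel (1 - γ)).pow_const r
  set ν := (volume : Measure (Rd d)).withDensity fun y => besselKernel (1 - γ) y ^ r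
  have hν : ν Set.univ = ∫⁻ y : Rd d, besselKernel (1 - γ) y ^ r := by
    rw [withDensity_apply _ MeasurableSet.univ, Measure.restrict_univ]
  have hGm : Measurable (Function.uncurry fun x y : Rd d => ‖u (x - y)‖ₑ ^ r) := by
    simp only [Function.uncurry_def]; fun_prop
  have hF : ∀ x, kernelAverage γ r u x = ∫⁻ y, ‖u (x - y)‖ₑ ^ r ∂ν := by
    intro x
    rw [lintegral_withDensity_eq_lintegral_mul _ hR (by fun_prop)]
    rfl
  simp only [hF]
  rw [← hν]
  refine lintegral_lintegral_rpow_le hGm ((one_le_div hr).2 hp) fun y => le_of_eq ?_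
  rw [lintegral_sub_right_eq_self (fun x => (‖u x‖ₑ ^ r) ^ (p / r)) y]
  congr 1; funext x
  rw [← ENNReal.rpow_mul, mul_div_cancel₀ _ hr.ne']

/-- When `μ` has a bounded density, the energy is controlled by the `L_1` norm. -/
lemma energy_withDensity_le {ρ : Rd d → ℝ≥0∞} (hρ : Measurable ρ) {N : ℝ≥0∞} (hN : ∀ x, ρ x ≤ N)
    {H : Rd d → ℂ} (hH : Measurable H) :
    energy (volume.withDensity ρ) H ≤ N * (∫⁻ y, ‖H y‖ₑ) ^ 2 := by
  have hm : Measurable fun w : Rd d × Rd d => ‖H w.2‖ₑ * ‖H (w.2 - w.1)‖ₑ := by fun_prop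
  have hm1 : Measurable fun z : Rd d => ∫⁻ y, ‖H y‖ₑ * ‖H (y - z)‖ₑ := hm.lintegral_prod_right'
  unfold energy
  rw [lintegral_withDensity_eq_lintegral_mul _ hρ hm1]
  calc ∫⁻ z, (ρ * fun z => ∫⁻ y, ‖H y‖ₑ * ‖H (y - z)‖ₑ) z
      ≤ ∫⁻ z, N * ∫⁻ y, ‖H y‖ₑ * ‖H (y - z)‖ₑ :=
        lintegral_mono fun z => mul_le_mul' (hN z) le_rfl
    _ = N * ∫⁻ y, ∫⁻ z, ‖H y‖ₑ * ‖H (y - z)‖ₑ := by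
        rw [lintegral_const_mul _ hm1, lintegral_lintegral_swap hm.aemeasurable]
    _ = N * ∫⁻ y, ‖H y‖ₑ * ∫⁻ z, ‖H z‖ₑ := by
        congr 2; funext y
        rw [lintegral_const_mul' _ _ enorm_ne_top, lintegral_sub_left_eq_self (fun z => ‖H z‖ₑ) y]
    _ = _ := by
        rw [lintegral_mul_const _ hH.enorm, sq]

lemma lintegral_besselKernel_mul_le_of_bounded {γ : ℝ} {ξ u : Rd d → ℂ} {M : ℝ≥0∞} (hM' : M ≠ ⊤)
    (hM : ∀ y, ‖ξ y‖ₑ ≤ M) (x : Rd d) :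
    ∫⁻ y, ‖(((besselKernel (1 - γ) (x - y)).toReal : ℝ) : ℂ) * (ξ y * u y)‖ₑ ≤
      M * kernelAverage γ 1 u x := by
  unfold kernelAverage
  rw [← lintegral_sub_left_eq_self _ x, ← lintegral_const_mul' _ _ hM']
  refine lintegral_mono fun y => ?_
  simp only [enorm_mul, ENNReal.rpow_one]
  rw [show x - (x - y) = y by abel]
  calc _ ≤ besselKernel (1 - γ) y * (M * ‖u (x - y)‖ₑ) := by
        gcongr
        · exact enorm_besselKernel_toReal_le _ _
        · exact hM _
    _ = _ := by ring

lemma lintegral_besselKernel_mul_le_of_holder {γ r s : ℝ} {ξ u : Rd d → ℂ} (hξ : Measurable ξ)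
    (hu : Measurable u) (hsr : s.HolderConjugate r) (x : Rd d) :
    ∫⁻ y, ‖(((besselKernel (1 - γ) (x - y)).toReal : ℝ) : ℂ) * (ξ y * u y)‖ₑ ≤
      (∫⁻ y, ‖ξ y‖ₑ ^ s) ^ (1 / s) * kernelAverage γ r u x ^ (1 / r) := by
  have hR := measurable_besselKernel (d := d) (1 - γ)
  have h := ENNReal.lintegral_mul_le_Lp_mul_Lq (volume : Measure (Rd d)) hsr
    (f := fun y => ‖ξ (x - y)‖ₑ) (g := fun y => besselKernel (1 - γ) y * ‖u (x - y)‖ₑ)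
    (by fun_prop) (by fun_prop)
  rw [lintegral_sub_left_eq_self (fun y => ‖ξ y‖ₑ ^ s) x] at h
  simp only [ENNReal.mul_rpow_of_nonneg _ _ hsr.symm.nonneg] at h
  refine le_trans ?_ h
  rw [← lintegral_sub_left_eq_self _ x]
  refine lintegral_mono fun y => ?_
  simp only [enorm_mul, Pi.mul_apply]
  rw [show x - (x - y) = y by abel]
  calc _ ≤ besselKernel (1 - γ) y * (‖ξ (x - y)‖ₑ * ‖u (x - y)‖ₑ) := by
        gcongr
        exact enorm_besselKernel_toReal_le _ _
    _ = _ := by ring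

/-! ### The Bessel potential norm of the products -/

lemma IsRepresentedBy.congr_ae {T : 𝓢'(Rd d, ℂ)} {g g' : Rd d → ℂ} (h : IsRepresentedBy T g)
    (hg : g =ᵐ[volume] g') : IsRepresentedBy T g' := by
  intro φ
  have hφ : (fun x => φ x * g x) =ᵐ[volume] fun x => φ x * g' x := by
    filter_upwards [hg] with x hx
    rw [hx]
  exact ⟨(h φ).1.congr hφ, (h φ).2.trans (integral_congr_ae hφ)⟩

/-- The norm in question is at most the `L_p` norm of the square root of the energies of the
functions `y ↦ R(x - y) g(y)`. -/
theorem exists_distribution_besselNorm_le (hd : 1 ≤ d) {f : 𝓢'(Rd d, ℂ)} {μ : Measure (Rd d)}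
    {k : ℝ} {ι : Type*} [Countable ι] {e : ι → 𝓢(Rd d, ℂ)} (hfd : IsNonnegDefDist f)
    (hf : ∀ ψ : 𝓢(Rd d, ℂ), f ψ = ∫ x, ψ x ∂μ) (hk : 0 ≤ k) (hμ : temperedMass μ k < ⊤)
    (he : IsNoiseBasis f e) {γ p : ℝ} (hγ : γ < 1) (hp : 0 < p) {g : Rd d → ℂ} (hg : Measurable g)
    {q : ℝ≥0∞} (hq : 1 ≤ q) (hgq : MemLp g q volume) :
    ∃ T : ι → 𝓢'(Rd d, ℂ),
      (∀ i, IsRepresentedBy (T i) (fun x => g x * distConv f (e i) x)) ∧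
      besselNorm (γ - 1) p T ≤ (∫⁻ x, energy μ
        (fun y => (((besselKernel (1 - γ) (x - y)).toReal : ℝ) : ℂ) * g y) ^ (p / 2)) ^ (1 / p) := by
  have hα : 0 < 1 - γ := by linarith
  have htemp : ∀ i, IsTemperedFun (fun x => g x * distConv f (e i) x) := fun i => by
    obtain ⟨C, hC⟩ := exists_norm_distConv_le hf hk hμ (e i)
    exact IsTemperedFun.of_memLp_mul hq hgq
      (stronglyMeasurable_distConv hf hk hμ (e i)).aestronglyMeasurable hk hC
  choose T hT using fun i => (htemp i).exists_distribution
  refine ⟨T, hT, ?_⟩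
  set G : ι → Rd d → ℂ := fun i => besselConv (1 - γ) fun x => g x * distConv f (e i) x with hG
  have hGT : ∀ i, IsRepresentedBy (besselOp (γ - 1) (T i)) (G i) := fun i => by
    have := (hT i).besselOp hd hα (htemp i)
    rwa [neg_sub] at this
  refine (iInf₂_le G hGT).trans ?_
  rw [eLpNorm_eq_lintegral_rpow_enorm_toReal (by simpa using hp) ENNReal.ofReal_ne_top,
    ENNReal.toReal_ofReal hp.le]
  refine ENNReal.rpow_le_rpow (lintegral_mono_ae ?_) (by positivity)
  have hae := ae_all_iff.2 fun i => (htemp i).ae_integrable_besselKernel_mul hd hα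
  filter_upwards [hae] with x hx
  rw [enorm_eq_self, ← ENNReal.rpow_mul, one_div_mul_eq_div]
  refine ENNReal.rpow_le_rpow ?_ (by positivity)
  have hHm : Measurable fun y => (((besselKernel (1 - γ) (x - y)).toReal : ℝ) : ℂ) * g y :=
    (((measurable_besselKernel_sub (1 - γ)).comp measurable_prodMk_left).ennreal_toReal
      |>.complex_ofReal).mul hg
  have h := tsum_enorm_integral_sq_le_energy hfd hf hk hμ he hHm
    (fun i => by simpa only [mul_assoc] using hx i)
  simpa only [hG, besselConv, mul_assoc] using h

/-- From a pointwise bound of the energies to the bound of the `L_p` norm of their square roots. For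
a correlation measure `t = 1 / (2 r)` and `K` is the kernel integral; for a bounded correlation
function `t = 1 / r` and `K` is the integral of `R^r`. -/
lemma lintegral_rpow_rpow_le {E F : Rd d → ℝ≥0∞} {Q K U : ℝ≥0∞} {t p : ℝ} (hp : 0 < p)
    (hQ : Q ≠ ⊤) (hE : ∀ x, E x ≤ Q ^ 2 * F x ^ (2 * t))
    (hF : ∫⁻ x, F x ^ (p * t) ≤ K ^ (p * t) * U) :
    (∫⁻ x, E x ^ (p / 2)) ^ (1 / p) ≤ Q * K ^ t * U ^ (1 / p) := by
  have h1 : ∫⁻ x, E x ^ (p / 2) ≤ Q ^ p * (K ^ (p * t) * U) := by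
    calc ∫⁻ x, E x ^ (p / 2) ≤ ∫⁻ x, Q ^ p * F x ^ (p * t) := by
          refine lintegral_mono fun x => ?_
          refine (ENNReal.rpow_le_rpow (hE x) (by positivity)).trans (le_of_eq ?_)
          rw [ENNReal.mul_rpow_of_nonneg _ _ (by positivity), ← ENNReal.rpow_natCast,
            ← ENNReal.rpow_mul, ← ENNReal.rpow_mul]
          congr 2
          · push_cast; ring
          · ring
      _ = Q ^ p * ∫⁻ x, F x ^ (p * t) :=
          lintegral_const_mul' _ _ (ENNReal.rpow_ne_top_of_nonneg hp.le hQ)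
      _ ≤ _ := by gcongr
  refine (ENNReal.rpow_le_rpow h1 (by positivity)).trans (le_of_eq ?_)
  rw [ENNReal.mul_rpow_of_nonneg _ _ (by positivity), ENNReal.mul_rpow_of_nonneg _ _ (by positivity),
    ← ENNReal.rpow_mul, ← ENNReal.rpow_mul, mul_one_div_cancel hp.ne', ENNReal.rpow_one,
    ← mul_assoc]
  congr 3
  field_simp

/-! ### Exponents -/

section Exponents

variable {s : ℝ≥0∞} {r p : ℝ}

lemma eq_one_of_inv_add_inv_of_eq_top (hsr : (⊤ : ℝ≥0∞)⁻¹ + (ENNReal.ofReal r)⁻¹ = 1) :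
    r = 1 := by
  simpa using hsr

lemma toReal_inv_add_inv (hr : 1 ≤ r) (hsr : s⁻¹ + (ENNReal.ofReal r)⁻¹ = 1) :
    (s⁻¹).toReal + r⁻¹ = 1 := by
  have h1 : s⁻¹ ≠ ⊤ := fun h => by simp [h] at hsr
  have h2 : (ENNReal.ofReal r)⁻¹ ≠ ⊤ := fun h => by simp [h] at hsr
  have h3 := congrArg ENNReal.toReal hsr
  rw [ENNReal.toReal_add h1 h2, ENNReal.toReal_inv (ENNReal.ofReal r),
    ENNReal.toReal_ofReal (by linarith)] at h3
  simpa using h3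

lemma holderConjugate_toReal (hs : s ≠ ⊤) (hr : 1 ≤ r)
    (hsr : s⁻¹ + (ENNReal.ofReal r)⁻¹ = 1) : s.toReal.HolderConjugate r := by
  have h1 := toReal_inv_add_inv hr hsr
  have hs0 : s ≠ 0 := fun h => by simp [h] at hsr
  have hS : 0 < s.toReal := ENNReal.toReal_pos hs0 hs
  rw [ENNReal.toReal_inv] at h1
  refine Real.holderConjugate_iff.2 ⟨?_, h1⟩
  have h2 : 0 < r⁻¹ := by positivity
  have h3 : s.toReal⁻¹ < 1 := by linarith
  exact (inv_lt_one₀ hS).1 h3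

lemma one_sub_inv_lt {a : ℝ} (ha : 0 < a) (hr : 1 ≤ r) (hsr : s⁻¹ + (ENNReal.ofReal r)⁻¹ = 1)
    (has : ENNReal.ofReal a < s) : 1 - r⁻¹ < a⁻¹ := by
  have h1 := toReal_inv_add_inv hr hsr
  have h2 : s⁻¹ < (ENNReal.ofReal a)⁻¹ := ENNReal.inv_lt_inv.2 has
  have h3 := ENNReal.toReal_strict_mono (by simpa using ha) h2
  rw [ENNReal.toReal_inv (ENNReal.ofReal a), ENNReal.toReal_ofReal ha.le] at h3
  linarith

lemma mul_sub_lt_of_ofReal_div_lt (hd : 1 ≤ d) {γ : ℝ} (hγ : γ < 1) (hr : 1 ≤ r)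
    (hsr : s⁻¹ + (ENNReal.ofReal r)⁻¹ = 1) (hs : ENNReal.ofReal (d / (1 - γ)) < s) :
    r * (d - (1 - γ)) < d := by
  have hd' : (1 : ℝ) ≤ d := by exact_mod_cast hd
  have hγ' : 0 < 1 - γ := by linarith
  have h1 := one_sub_inv_lt (by positivity) hr hsr hs
  rw [inv_div, lt_div_iff₀ (by linarith)] at h1
  have hr0 : 0 < r := by linarith
  have h2 : r * ((1 - r⁻¹) * d) < r * (1 - γ) := mul_lt_mul_of_pos_left h1 hr0
  have h3 : r * ((1 - r⁻¹) * d) = r * d - d := by field_simp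
  linarith

lemma conjRatio_eq (hr : 1 ≤ r) (hsr : s⁻¹ + (ENNReal.ofReal r)⁻¹ = 1) : conjRatio s = r := by
  unfold conjRatio
  split_ifs with h
  · subst h
    exact (eq_one_of_inv_add_inv_of_eq_top hsr).symm
  · exact (holderConjugate_toReal h hr hsr).conjugate_eq.symm

/-- The product of functions in `L_{s'}` and `L_p` is in some `L_q` with `q ≥ 1`, hence tempered. -/
lemma one_le_inv_of_inv_add_inv (hr : 1 ≤ r) (hp : 2 * r ≤ p)
    (hsr : s⁻¹ + (ENNReal.ofReal r)⁻¹ = 1) {s' : ℝ≥0∞} (hs' : s ≤ s') :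
    1 ≤ (s'⁻¹ + (ENNReal.ofReal p)⁻¹)⁻¹ := by
  rw [ENNReal.one_le_inv, ← hsr]
  gcongr
  linarith

lemma memLp_mul_inv {s' : ℝ≥0∞} {ξ u : Rd d → ℂ} (hξ : MemLp ξ s' volume)
    (hu : MemLp u (ENNReal.ofReal p) volume) :
    MemLp (fun x => ξ x * u x) (s'⁻¹ + (ENNReal.ofReal p)⁻¹)⁻¹ volume := by
  have : ENNReal.HolderTriple s' (ENNReal.ofReal p) (s'⁻¹ + (ENNReal.ofReal p)⁻¹)⁻¹ :=
    ⟨(inv_inv _).symm⟩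
  exact MemLp.mul' hu hξ

end Exponents

/-- Finiteness of `∫ (R^r * R^r) (1 + |x|²)^(k(r-1)/2) dμ` for admissible parameters. -/
lemma kernelIntegral_lt_top (hd : 1 ≤ d) {μ : Measure (Rd d)} {k γ r : ℝ} {s : ℝ≥0∞} (hk : 0 ≤ k)
    (hμ : temperedMass μ k < ⊤) (hadm : Admissible μ γ s) (hr : 1 ≤ r)
    (hsr : s⁻¹ + (ENNReal.ofReal r)⁻¹ = 1) : kernelIntegral μ k γ r < ⊤ := by
  have hr0 : 0 < r := by linarith
  rcases hadm with ⟨rfl, hγ0, hγ, hs⟩ | ⟨hd2, hγ0, hγ, hs, hball⟩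
  · have h1 := one_sub_inv_lt (by rw [one_div_pos]; linarith) hr hsr hs
    rw [one_div, inv_inv] at h1
    -- In dimension one `R^r` is square integrable, so that no integrability of `μ` near the
    -- origin beyond local finiteness is needed: `σ = 0`.
    obtain ⟨b, hb1, hb2⟩ : ∃ b : ℝ, γ < b ∧ b < r⁻¹ / 2 := exists_between (by linarith)
    have hrb : r * b < 1 / 2 := by
      have := mul_lt_mul_of_pos_left hb2 hr0
      rwa [← mul_div_assoc, mul_inv_cancel₀ hr0.ne'] at this
    refine kernelIntegral_lt_top_of_lintegral_ball hd hμ hr (b := b) (σ := 0) (τ := r * b)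
      (by linarith) (by push_cast; linarith) le_rfl (mul_nonneg hr0.le (by linarith))
      (zero_add _).symm (by push_cast; linarith) ?_
    simp only [neg_zero, ENNReal.rpow_zero, setLIntegral_one]
    exact (measure_mono Metric.ball_subset_closedBall).trans_lt (measure_closedBall_lt_top hk hμ 1)
  · have hd2' : (2 : ℝ) ≤ d := by exact_mod_cast hd2
    have h1 := mul_sub_lt_of_ofReal_div_lt hd hγ hr hsr hs
    -- With `σ` the exact order of the singularity of `R^r`, the loss `τ = r ε` in its upper bound
    -- is harmless as soon as `σ + 2 τ < d`.
    set σ := r * (d - (1 - γ)) with hσ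
    have hσ0 : 0 ≤ σ := mul_nonneg hr0.le (by linarith)
    set ε := (d - σ) / (4 * r) with hε
    have hε0 : 0 < ε := div_pos (by linarith) (by linarith)
    have hrε : r * ε = (d - σ) / 4 := by rw [hε]; field_simp
    refine kernelIntegral_lt_top_of_lintegral_ball hd hμ hr (b := d - (1 - γ) + ε) (σ := σ)
      (τ := r * ε) (by linarith) (by linarith) hσ0 (by positivity) (by rw [hσ]; ring)
      (by rw [hrε]; linarith) ?_
    rw [conjRatio_eq hr hsr] at hball
    have : -σ = r * (1 - γ - d) := by rw [hσ]; ring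
    rwa [this]

/-! ### The estimate for correlation measures -/

/-- A representative of an `L_∞` function that is bounded everywhere by its norm. -/
lemma exists_measurable_bounded {ξ : Rd d → ℂ} (hξ : MemLp ξ ⊤ volume) :
    ∃ ξ' : Rd d → ℂ, Measurable ξ' ∧ ξ =ᵐ[volume] ξ' ∧ ∀ y, ‖ξ' y‖ₑ ≤ eLpNorm ξ ⊤ volume := by
  set g := hξ.1.mk ξ with hg
  have hgm : Measurable g := hξ.1.stronglyMeasurable_mk.measurable
  have hS : MeasurableSet {y | ‖g y‖ₑ ≤ eLpNorm ξ ⊤ volume} :=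
    measurableSet_le hgm.enorm measurable_const
  refine ⟨{y | ‖g y‖ₑ ≤ eLpNorm ξ ⊤ volume}.indicator g, hgm.indicator hS, ?_, fun y => ?_⟩
  · filter_upwards [hξ.1.ae_eq_mk, enorm_ae_le_eLpNormEssSup ξ volume] with y hy1 hy2
    rw [Set.indicator_of_mem, hy1]
    rw [Set.mem_ofPred_eq, hg, ← hy1, eLpNorm_exponent_top]
    exact hy2
  · by_cases hy : y ∈ {y | ‖g y‖ₑ ≤ eLpNorm ξ ⊤ volume}
    · rw [Set.indicator_of_mem hy]; exact hy
    · rw [Set.indicator_of_notMem hy]; simp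

/-- Estimate of the products in terms of the tempered mass and of the kernel integral. -/
theorem exists_distribution_besselNorm_le_kernelIntegral (hd : 1 ≤ d) {f : 𝓢'(Rd d, ℂ)}
    {μ : Measure (Rd d)} {k : ℝ} {ι : Type*} [Countable ι] {e : ι → 𝓢(Rd d, ℂ)}
    (hfd : IsNonnegDefDist f) (hf : ∀ ψ : 𝓢(Rd d, ℂ), f ψ = ∫ x, ψ x ∂μ) (hk : 0 ≤ k)
    (hμ : temperedMass μ k < ⊤) (he : IsNoiseBasis f e) {γ r p : ℝ} {s : ℝ≥0∞} (hγ : γ < 1)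
    (hr : 1 ≤ r) (hp : 2 * r ≤ p) (hsr : s⁻¹ + (ENNReal.ofReal r)⁻¹ = 1) {ξ u : Rd d → ℂ}
    (hξ : MemLp ξ (2 * s) volume) (hu : MemLp u (ENNReal.ofReal p) volume) :
    ∃ T : ι → 𝓢'(Rd d, ℂ),
      (∀ i, IsRepresentedBy (T i) (fun x => ξ x * u x * distConv f (e i) x)) ∧
      besselNorm (γ - 1) p T ≤
        temperedMass μ k ^ (1 / (2 * s)).toReal * kernelIntegral μ k γ r ^ (1 / (2 * r)) *
          eLpNorm ξ (2 * s) volume * eLpNorm u (ENNReal.ofReal p) volume := by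
  have hlf := isLocallyFiniteMeasure_of_temperedMass hk hμ
  have hp0 : 0 < p := by linarith
  have hr0 : 0 < r := by linarith
  set Q : ℝ≥0∞ := temperedMass μ k ^ (1 / (2 * s)).toReal * eLpNorm ξ (2 * s) volume with hQ
  have hQt : Q ≠ ⊤ := ENNReal.mul_ne_top
    (ENNReal.rpow_ne_top_of_nonneg ENNReal.toReal_nonneg hμ.ne) hξ.2.ne
  obtain ⟨u', hu'm, huu'⟩ : ∃ u' : Rd d → ℂ, Measurable u' ∧ u =ᵐ[volume] u' :=
    ⟨hu.1.mk u, hu.1.stronglyMeasurable_mk.measurable, hu.1.ae_eq_mk⟩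
  obtain ⟨ξ', hξ'm, hξξ', henergy⟩ : ∃ ξ' : Rd d → ℂ, Measurable ξ' ∧ ξ =ᵐ[volume] ξ' ∧
      ∀ x, energy μ
        (fun y => (((besselKernel (1 - γ) (x - y)).toReal : ℝ) : ℂ) * (ξ' y * u' y)) ≤
        Q ^ 2 * weightedAverage μ k γ r u' x ^ (2 * (1 / (2 * r))) := by
    have hexp : 2 * (1 / (2 * r)) = 1 / r := by field_simp
    rw [hexp]
    by_cases hs : s = ⊤
    · subst hs
      obtain rfl := eq_one_of_inv_add_inv_of_eq_top hsr
      have h2 : (2 : ℝ≥0∞) * ⊤ = ⊤ := ENNReal.mul_top (by simp)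
      rw [h2] at hξ hQ
      obtain ⟨ξ', hξ'm, hξξ', hle⟩ := exists_measurable_bounded hξ
      refine ⟨ξ', hξ'm, hξξ', fun x => ?_⟩
      have hQ' : Q = eLpNorm ξ ⊤ volume := by simp [hQ]
      rw [hQ', div_one, ENNReal.rpow_one]
      exact energy_le_of_bounded hξ.2.ne hle x
    · have hconj := holderConjugate_toReal hs hr hsr
      have hS := hconj.pos
      obtain ⟨ξ', hξ'm, hξξ'⟩ : ∃ ξ' : Rd d → ℂ, Measurable ξ' ∧ ξ =ᵐ[volume] ξ' :=
        ⟨hξ.1.mk ξ, hξ.1.stronglyMeasurable_mk.measurable, hξ.1.ae_eq_mk⟩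
      refine ⟨ξ', hξ'm, hξξ', fun x => ?_⟩
      refine (energy_le_of_holder (k := k) hξ'm hu'm hconj x).trans (le_of_eq ?_)
      congr 1
      have h2s : (2 * s).toReal = 2 * s.toReal := by simp
      have h2s0 : 2 * s ≠ 0 := by
        intro h
        rw [h] at h2s
        simp at h2s
        linarith
      have h2st : 2 * s ≠ ⊤ := ENNReal.mul_ne_top (by simp) hs
      rw [hQ, eLpNorm_congr_ae hξξ', eLpNorm_eq_lintegral_rpow_enorm_toReal h2s0 h2st,
        one_div (2 * s), ENNReal.toReal_inv, h2s, mul_pow, ← ENNReal.rpow_natCast,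
        ← ENNReal.rpow_natCast, ← ENNReal.rpow_mul, ← ENNReal.rpow_mul,
        ENNReal.mul_rpow_of_nonneg _ _ (by positivity)]
      congr 2
      · push_cast; field_simp
      · push_cast; field_simp
  have hξ'2 : MemLp ξ' (2 * s) volume := hξ.ae_eq hξξ'
  have hu'p : MemLp u' (ENNReal.ofReal p) volume := hu.ae_eq huu'
  have hs2 : s ≤ 2 * s := le_mul_of_one_le_left zero_le (by norm_num)
  obtain ⟨T, hT, hle⟩ := exists_distribution_besselNorm_le hd hfd hf hk hμ he hγ hp0
    (hξ'm.mul hu'm) (one_le_inv_of_inv_add_inv hr hp hsr hs2) (memLp_mul_inv hξ'2 hu'p)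
  refine ⟨T, fun i => (hT i).congr_ae ?_, hle.trans ?_⟩
  · filter_upwards [hξξ', huu'] with x h1 h2
    rw [Pi.mul_apply, h1, h2]
  · have hF := lintegral_weightedAverage_rpow_le (μ := μ) (k := k) (γ := γ) hu'm hr0 hp
    have hpr : p / (2 * r) = p * (1 / (2 * r)) := by ring
    rw [hpr] at hF
    refine (lintegral_rpow_rpow_le hp0 hQt henergy hF).trans (le_of_eq ?_)
    rw [hQ, eLpNorm_congr_ae huu', eLpNorm_eq_lintegral_rpow_enorm_toReal (by simpa using hp0)
      ENNReal.ofReal_ne_top, ENNReal.toReal_ofReal hp0.le]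
    ring

/-! ### Nonnegative, nonnegative definite continuous functions -/

/-- A smooth bump function, as a complex-valued Schwartz function. -/
noncomputable def bumpSchwartz {c : Rd d} (b : ContDiffBump c) : 𝓢(Rd d, ℂ) :=
  (b.hasCompactSupport.comp_left (g := fun t : ℝ => (t : ℂ)) Complex.ofReal_zero).toSchwartzMap
    (Complex.ofRealCLM.contDiff.comp b.contDiff)

@[simp]
lemma bumpSchwartz_apply {c : Rd d} (b : ContDiffBump c) (x : Rd d) :
    bumpSchwartz b x = ((b x : ℝ) : ℂ) := rfl

/-- Testing on bump functions concentrated near `x` detects the sign of `g x`. -/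
lemma nonneg_of_forall_integral_bump_nonneg {g : Rd d → ℝ} (hg : Continuous g) (x : Rd d)
    (h : ∀ b : ContDiffBump x, 0 ≤ ∫ y, b y * g y) : 0 ≤ g x := by
  by_contra! hx
  obtain ⟨δ, hδ, hball⟩ := Metric.isOpen_iff.1 (isOpen_lt hg continuous_const) x hx
  let b : ContDiffBump x := ⟨δ / 2, δ, by positivity, by linarith⟩
  have hpos : 0 < ∫ y, b y * -g y := by
    refine (b.continuous.mul hg.neg).integral_pos_of_hasCompactSupport_nonneg_nonzero (x := x)
      b.hasCompactSupport.mul_right (fun y => ?_) ?_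
    · by_cases hy : y ∈ Metric.ball x δ
      · exact mul_nonneg b.nonneg (neg_nonneg.2 (hball hy).le)
      · have : b y = 0 := b.zero_of_le_dist (by simpa using hy)
        simp [this]
    · have : b x = 1 := b.one_of_mem_closedBall (Metric.mem_closedBall_self b.rIn_pos.le)
      simpa [this] using hx.ne
  have := h b
  simp only [mul_neg, integral_neg] at hpos
  linarith

/-- A continuous function which represents a nonnegative distribution is nonnegative. -/
lemma nonneg_of_isNonnegDist {f : 𝓢'(Rd d, ℂ)} {h : Rd d → ℂ} (hf : IsNonnegDist f)
    (hh : Continuous h) (hrep : IsRepresentedBy f h) (x : Rd d) : 0 ≤ h x := by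
  have key : ∀ b : ContDiffBump x, 0 ≤ ∫ y, b y * (h y).re ∧ 0 = ∫ y, b y * (h y).im := by
    intro b
    have h1 := hf (bumpSchwartz b) fun y => by
      rw [bumpSchwartz_apply]; exact_mod_cast b.nonneg
    rw [(hrep _).2, Complex.nonneg_iff] at h1
    have hint := (hrep (bumpSchwartz b)).1
    have hre := integral_re hint
    have him := integral_im hint
    simp only [bumpSchwartz_apply, RCLike.re_to_complex, RCLike.im_to_complex,
      Complex.re_ofReal_mul, Complex.im_ofReal_mul] at hre him h1
    rw [hre, him]
    exact h1
  have hre := nonneg_of_forall_integral_bump_nonneg (Complex.continuous_re.comp hh) x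
    fun b => (key b).1
  have him := nonneg_of_forall_integral_bump_nonneg (Complex.continuous_im.comp hh) x
    fun b => (key b).2.le
  have him' := nonneg_of_forall_integral_bump_nonneg (Complex.continuous_im.comp hh).neg x
    fun b => by
      have := (key b).2
      simp only [Pi.neg_apply, Function.comp_apply, mul_neg, integral_neg]
      linarith
  simp only [Pi.neg_apply, Function.comp_apply] at hre him him'
  exact Complex.nonneg_iff.2 ⟨hre, by linarith⟩

/-- The two notions of nonnegative definiteness agree, by the substitution `y ↦ x - y` and Fubini's
theorem. -/
lemma IsNonnegDefFun.isNonnegDefDist {f : 𝓢'(Rd d, ℂ)} {h : Rd d → ℂ} (hh : IsNonnegDefFun h)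
    (hrep : IsRepresentedBy f h) : IsNonnegDefDist f := by
  intro ψ
  obtain ⟨hint, hpos⟩ := hh.2 ψ
  have hmp : MeasurePreserving (fun z : Rd d × Rd d => (z.1, z.1 - z.2)) (volume.prod volume)
      (volume.prod volume) := by
    have h1 := (measurePreserving_prod_add (volume : Measure (Rd d)) volume).comp
      ((MeasurePreserving.id (volume : Measure (Rd d))).prod
        (Measure.measurePreserving_neg (volume : Measure (Rd d))))
    convert h1 using 1
    funext z
    simp [sub_eq_add_neg]
  have hint' := hmp.integrable_comp_of_integrable hint
  have heq : f (conv ψ (conjReflect ψ)) =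
      ∫ x, ∫ y, h (x - y) * ψ x * (starRingEnd ℂ) (ψ y) := by
    calc f (conv ψ (conjReflect ψ))
        = ∫ z, (∫ x, h z * ψ x * (starRingEnd ℂ) (ψ (x - z))) := by
          rw [(hrep _).2]
          congr 1; funext z
          rw [conv_apply, ← integral_mul_const]
          congr 1; funext x
          rw [conjReflect_apply, neg_sub]
          ring
      _ = ∫ x, (∫ z, h z * ψ x * (starRingEnd ℂ) (ψ (x - z))) := by
          refine (integral_integral_swap ?_).symm
          refine hint'.congr (Filter.Eventually.of_forall fun z => ?_)
          simp [Function.uncurry]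
      _ = _ := by
          congr 1; funext x
          rw [← integral_sub_left_eq_self (fun y => h (x - y) * ψ x * (starRingEnd ℂ) (ψ y))
            volume x]
          simp
  rw [heq]
  exact hpos

/-- Positivity of the form on `ρ - ρ(· - x)` bounds the mean of `h` around `x` by its mean around
the origin. -/
lemma integral_conv_mul_le {f : 𝓢'(Rd d, ℂ)} {h : Rd d → ℂ} (hfd : IsNonnegDefDist f)
    (hrep : IsRepresentedBy f h) (ρ : 𝓢(Rd d, ℂ)) (x : Rd d) :
    (∫ z, conv ρ (conjReflect ρ) z * h (z + x)).re ≤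
      (∫ z, conv ρ (conjReflect ρ) z * h z).re := by
  set τ := SchwartzMap.compSubConstCLM ℂ x ρ with hτ
  have hττ : conv τ (conjReflect τ) = conv ρ (conjReflect ρ) := by
    ext z
    simp only [conv_apply, conjReflect_apply, hτ, SchwartzMap.compSubConstCLM_apply, neg_sub]
    rw [← integral_sub_right_eq_self
      (fun y => ρ y * (starRingEnd ℂ) (ρ (y - z))) x]
    congr 1; funext y
    congr 3
    abel
  have hτρ : ∀ z, conv τ (conjReflect ρ) z = conv ρ (conjReflect ρ) (z - x) := by
    intro z
    simp only [conv_apply, conjReflect_apply, hτ, SchwartzMap.compSubConstCLM_apply, neg_sub]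
    rw [← integral_sub_right_eq_self
      (fun y => ρ y * (starRingEnd ℂ) (ρ (y - (z - x)))) x]
    congr 1; funext y
    congr 3
    abel
  have hpos := (Complex.nonneg_iff.1 (hfd (τ - ρ))).1
  have hpos' : 0 ≤ (noiseForm f (τ - ρ) (τ - ρ)).re := hpos
  have hsymm := conj_symm_of_nonneg (B := noiseForm f) hfd τ ρ
  have h1 : noiseForm f τ τ = noiseForm f ρ ρ := by
    rw [noiseForm_apply, noiseForm_apply, noiseInner, noiseInner, hττ]
  simp only [map_sub, LinearMap.sub_apply, hsymm, h1, Complex.sub_re, Complex.conj_re] at hpos'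
  have h2 : noiseForm f τ ρ = ∫ z, conv ρ (conjReflect ρ) z * h (z + x) := by
    rw [noiseForm_apply, noiseInner, (hrep _).2,
      ← integral_sub_right_eq_self (fun z => conv ρ (conjReflect ρ) z * h (z + x)) x]
    congr 1; funext z
    rw [hτρ, sub_add_cancel]
  have h3 : noiseForm f ρ ρ = ∫ z, conv ρ (conjReflect ρ) z * h z := by
    rw [noiseForm_apply, noiseInner, (hrep _).2]
  rw [← h2, ← h3]
  linarith

/-- A nonnegative, nonnegative definite continuous function is bounded: its mean around any point is
at most its mean around the origin, for a weight concentrated as closely as needed. -/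
lemma exists_norm_le_of_isNonnegDefDist {f : 𝓢'(Rd d, ℂ)} {h : Rd d → ℂ} (hf : IsNonnegDist f)
    (hfd : IsNonnegDefDist f) (hh : Continuous h) (hrep : IsRepresentedBy f h) :
    ∃ C : ℝ, ∀ x, ‖h x‖ ≤ C := by
  have hnn := nonneg_of_isNonnegDist hf hh hrep
  have hg : Continuous fun x => ‖h x‖ := hh.norm
  have hgh : ∀ x, h x = ((‖h x‖ : ℝ) : ℂ) := fun x => (Complex.eq_coe_norm_of_nonneg (hnn x))
  obtain ⟨C, hC⟩ := (isCompact_closedBall (0 : Rd d) 1).exists_bound_of_continuousOn hh.continuousOn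
  refine ⟨C + 1, fun x => ?_⟩
  by_contra! hx
  obtain ⟨δ, hδ, hball⟩ := Metric.isOpen_iff.1 (isOpen_lt continuous_const hg) x hx
  -- The radius `δ` controls `h` from below near `x`, the radius `1` from above near the origin.
  set η := min δ 1 with hη
  have hη0 : 0 < η := lt_min hδ one_pos
  let b : ContDiffBump (0 : Rd d) := ⟨η / 4, η / 2, by positivity, by linarith⟩
  set κ : Rd d → ℝ := fun z => ∫ y, b y * b (y - z) with hκ
  have hκc : ∀ z, conv (bumpSchwartz b) (conjReflect (bumpSchwartz b)) z = ((κ z : ℝ) : ℂ) := by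
    intro z
    rw [conv_apply, hκ, ← integral_complex_ofReal]
    congr 1; funext y
    rw [conjReflect_apply, neg_sub, bumpSchwartz_apply, bumpSchwartz_apply, Complex.conj_ofReal,
      Complex.ofReal_mul]
  have hκcont : Continuous κ := by
    have h1 : κ = fun z => (conv (bumpSchwartz b) (conjReflect (bumpSchwartz b)) z).re := by
      funext z; rw [hκc, Complex.ofReal_re]
    rw [h1]
    exact Complex.continuous_re.comp (SchwartzMap.continuous _)
  have hκ0 : ∀ z, 0 ≤ κ z := fun z => integral_nonneg fun y => mul_nonneg b.nonneg b.nonneg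
  have hκsupp : ∀ z, η ≤ ‖z‖ → κ z = 0 := by
    intro z hz
    refine integral_eq_zero_of_ae (Filter.Eventually.of_forall fun y => ?_)
    simp only [Pi.zero_apply, mul_eq_zero]
    by_contra! hne
    have h1 : ‖y‖ < η / 2 := by
      by_contra! hy
      exact hne.1 (b.zero_of_le_dist (by simpa using hy))
    have h2 : ‖y - z‖ < η / 2 := by
      by_contra! hy
      exact hne.2 (b.zero_of_le_dist (by simpa using hy))
    have h3 : ‖z‖ ≤ ‖y‖ + ‖y - z‖ := by simpa using norm_sub_le y (y - z)
    linarith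
  have hκcs : HasCompactSupport κ := HasCompactSupport.intro (isCompact_closedBall (0 : Rd d) η)
    fun z hz => hκsupp z (by
      simp only [Metric.mem_closedBall, dist_zero_right, not_le] at hz
      exact hz.le)
  have hb0 : b 0 ≠ 0 := by
    have : b 0 = 1 := b.one_of_mem_closedBall (Metric.mem_closedBall_self b.rIn_pos.le)
    simp [this]
  have hκz : κ 0 ≠ 0 := by
    have : 0 < ∫ y, b y * b y :=
      (b.continuous.mul b.continuous).integral_pos_of_hasCompactSupport_nonneg_nonzero (x := 0)
        b.hasCompactSupport.mul_right (fun y => mul_nonneg b.nonneg b.nonneg)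
        (mul_ne_zero hb0 hb0)
    simpa [hκ] using this.ne'
  have hx' : Continuous fun z : Rd d => ‖h (z + x)‖ := hg.comp (continuous_add_const x)
  have hpos : 0 < ∫ z, κ z * (‖h (z + x)‖ - ‖h z‖) := by
    have hlt : ∀ z, ‖z‖ < η → ‖h z‖ < ‖h (z + x)‖ := by
      intro z hz
      have h1 : C + 1 < ‖h (z + x)‖ := hball (by
        simpa [dist_eq_norm] using hz.trans_le (min_le_left _ _))
      have h2 : ‖h z‖ ≤ C := hC z (by simpa using (hz.trans_le (min_le_right _ _)).le)
      linarith
    refine (hκcont.mul (hx'.sub hg)).integral_pos_of_hasCompactSupport_nonneg_nonzero (x := 0)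
      hκcs.mul_right (fun z => ?_) (mul_ne_zero hκz ?_)
    · rcases lt_or_ge ‖z‖ η with hz | hz
      · exact mul_nonneg (hκ0 z) (sub_nonneg.2 (hlt z hz).le)
      · simp [hκsupp z hz]
    · exact (sub_pos.2 (hlt 0 (by simpa using hη0))).ne'
  have hle := integral_conv_mul_le hfd hrep (bumpSchwartz b) x
  have e1 : ∫ z, conv (bumpSchwartz b) (conjReflect (bumpSchwartz b)) z * h (z + x) =
      ((∫ z, κ z * ‖h (z + x)‖ : ℝ) : ℂ) := by
    rw [← integral_complex_ofReal]
    congr 1; funext z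
    rw [hκc, Complex.ofReal_mul, ← hgh]
  have e2 : ∫ z, conv (bumpSchwartz b) (conjReflect (bumpSchwartz b)) z * h z =
      ((∫ z, κ z * ‖h z‖ : ℝ) : ℂ) := by
    rw [← integral_complex_ofReal]
    congr 1; funext z
    rw [hκc, Complex.ofReal_mul, ← hgh]
  rw [e1, e2, Complex.ofReal_re, Complex.ofReal_re] at hle
  have e3 : ∫ z, κ z * (‖h (z + x)‖ - ‖h z‖) =
      (∫ z, κ z * ‖h (z + x)‖) - ∫ z, κ z * ‖h z‖ := by
    simp only [mul_sub]
    exact integral_sub ((hκcont.mul hx').integrable_of_hasCompactSupport hκcs.mul_right)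
      ((hκcont.mul hg).integrable_of_hasCompactSupport hκcs.mul_right)
  linarith

lemma iSup_enorm_lt_top {f : 𝓢'(Rd d, ℂ)} {h : Rd d → ℂ} (hf : IsNonnegDist f)
    (hh : IsNonnegDefFun h) (hrep : IsRepresentedBy f h) : ⨆ x, ‖h x‖ₑ < ⊤ := by
  obtain ⟨C, hC⟩ := exists_norm_le_of_isNonnegDefDist hf (hh.isNonnegDefDist hrep) hh.1 hrep
  refine lt_of_le_of_lt (iSup_le fun x => ?_) (ENNReal.ofReal_lt_top (r := C))
  rw [← ofReal_norm]
  exact ENNReal.ofReal_le_ofReal (hC x)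

/-- The corresponding measure of `f` has density `h = |h|`. -/
lemma eq_integral_withDensity {f : 𝓢'(Rd d, ℂ)} {h : Rd d → ℂ} (hf : IsNonnegDist f)
    (hh : Continuous h) (hrep : IsRepresentedBy f h) (ψ : 𝓢(Rd d, ℂ)) :
    f ψ = ∫ x, ψ x ∂(volume.withDensity fun x => ‖h x‖ₑ) := by
  rw [integral_withDensity_eq_integral_toReal_smul hh.enorm.measurable (by simp), (hrep ψ).2]
  congr 1; funext x
  have hx := Complex.eq_coe_norm_of_nonneg (nonneg_of_isNonnegDist hf hh hrep x)
  rw [toReal_enorm, Complex.real_smul, ← hx, mul_comm]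

lemma temperedMass_withDensity_lt_top {ρ : Rd d → ℝ≥0∞} (hρ : Measurable ρ) {N : ℝ≥0∞}
    (hN : N ≠ ⊤) (hle : ∀ x, ρ x ≤ N) :
    temperedMass (volume.withDensity ρ) (d + 1) < ⊤ := by
  have h1 : Integrable (fun x : Rd d => (1 + ‖x‖ ^ 2) ^ (-((d : ℝ) + 1) / 2)) volume :=
    integrable_rpow_neg_one_add_norm_sq (by simp)
  have h2 := h1.lintegral_lt_top
  unfold temperedMass
  have hm : Measurable fun x : Rd d => ENNReal.ofReal (1 / (1 + ‖x‖ ^ 2) ^ (((d : ℝ) + 1) / 2)) := by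
    fun_prop
  rw [lintegral_withDensity_eq_lintegral_mul _ hρ hm]
  calc _ ≤ ∫⁻ x : Rd d, N * ENNReal.ofReal ((1 + ‖x‖ ^ 2) ^ (-((d : ℝ) + 1) / 2)) := by
        refine lintegral_mono fun x => ?_
        rw [Pi.mul_apply, neg_div, Real.rpow_neg (by positivity), one_div]
        exact mul_le_mul' (hle x) le_rfl
    _ < ⊤ := by
        rw [lintegral_const_mul' _ _ hN]
        exact ENNReal.mul_lt_top hN.lt_top h2

/-! ### The estimate for bounded correlation functions -/

lemma eLpNorm_besselKernel {α r : ℝ} (hr : 0 < r) :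
    eLpNorm (besselKernel (d := d) α) (ENNReal.ofReal r) volume =
      (∫⁻ x : Rd d, besselKernel α x ^ r) ^ (1 / r) := by
  rw [eLpNorm_eq_lintegral_rpow_enorm_toReal (by simpa using hr) ENNReal.ofReal_ne_top,
    ENNReal.toReal_ofReal hr.le]
  simp only [enorm_eq_self]

lemma eLpNorm_besselKernel_lt_top (hd : 1 ≤ d) {γ r : ℝ} {s : ℝ≥0∞} (hγ : γ < 1) (hr : 1 ≤ r)
    (hsr : s⁻¹ + (ENNReal.ofReal r)⁻¹ = 1) (hs : ENNReal.ofReal (d / (1 - γ)) < s) :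
    eLpNorm (besselKernel (d := d) (1 - γ)) (ENNReal.ofReal r) volume < ⊤ := by
  rw [eLpNorm_besselKernel (by linarith)]
  refine ENNReal.rpow_lt_top_of_nonneg (by positivity) (lintegral_besselKernel_rpow_lt_top hd hr
    (mul_sub_lt_of_ofReal_div_lt hd hγ hr hsr hs)).ne

/-- Estimate of the products for a continuous correlation function. -/
theorem exists_distribution_besselNorm_le_iSup (hd : 1 ≤ d) {f : 𝓢'(Rd d, ℂ)} {h : Rd d → ℂ}
    {ι : Type*} [Countable ι] {e : ι → 𝓢(Rd d, ℂ)} (hf : IsNonnegDist f) (hh : IsNonnegDefFun h)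
    (hrep : IsRepresentedBy f h) (he : IsNoiseBasis f e) {γ r p : ℝ} {s : ℝ≥0∞} (hγ : γ < 1)
    (hr : 1 ≤ r) (hp : 2 * r ≤ p) (hsr : s⁻¹ + (ENNReal.ofReal r)⁻¹ = 1) {ξ u : Rd d → ℂ}
    (hξ : MemLp ξ s volume) (hu : MemLp u (ENNReal.ofReal p) volume) :
    ∃ T : ι → 𝓢'(Rd d, ℂ),
      (∀ i, IsRepresentedBy (T i) (fun x => ξ x * u x * distConv f (e i) x)) ∧
      besselNorm (γ - 1) p T ≤
        (⨆ x, ‖h x‖ₑ) ^ (1 / 2 : ℝ) * eLpNorm ξ s volume *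
          eLpNorm (besselKernel (d := d) (1 - γ)) (ENNReal.ofReal r) volume *
          eLpNorm u (ENNReal.ofReal p) volume := by
  have hp0 : 0 < p := by linarith
  have hr0 : 0 < r := by linarith
  set N : ℝ≥0∞ := ⨆ x, ‖h x‖ₑ with hN
  have hNt : N ≠ ⊤ := (iSup_enorm_lt_top hf hh hrep).ne
  have hle : ∀ x, ‖h x‖ₑ ≤ N := fun x => le_iSup (fun x => ‖h x‖ₑ) x
  have hhm : Measurable fun x => ‖h x‖ₑ := hh.1.enorm.measurable
  set Q : ℝ≥0∞ := N ^ (1 / 2 : ℝ) * eLpNorm ξ s volume with hQ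
  have hQt : Q ≠ ⊤ := ENNReal.mul_ne_top (ENNReal.rpow_ne_top_of_nonneg (by positivity) hNt) hξ.2.ne
  have hQ2 : Q ^ 2 = N * eLpNorm ξ s volume ^ 2 := by
    rw [hQ, mul_pow, ← ENNReal.rpow_natCast (N ^ (1 / 2 : ℝ)), ← ENNReal.rpow_mul]
    norm_num
  obtain ⟨u', hu'm, huu'⟩ : ∃ u' : Rd d → ℂ, Measurable u' ∧ u =ᵐ[volume] u' :=
    ⟨hu.1.mk u, hu.1.stronglyMeasurable_mk.measurable, hu.1.ae_eq_mk⟩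
  obtain ⟨ξ', hξ'm, hξξ', hint⟩ : ∃ ξ' : Rd d → ℂ, Measurable ξ' ∧ ξ =ᵐ[volume] ξ' ∧
      ∀ x, ∫⁻ y, ‖(((besselKernel (1 - γ) (x - y)).toReal : ℝ) : ℂ) * (ξ' y * u' y)‖ₑ ≤
        eLpNorm ξ s volume * kernelAverage γ r u' x ^ (1 / r) := by
    by_cases hs : s = ⊤
    · subst hs
      obtain rfl := eq_one_of_inv_add_inv_of_eq_top hsr
      obtain ⟨ξ', hξ'm, hξξ', hle⟩ := exists_measurable_bounded hξ
      refine ⟨ξ', hξ'm, hξξ', fun x => ?_⟩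
      rw [div_one, ENNReal.rpow_one]
      exact lintegral_besselKernel_mul_le_of_bounded hξ.2.ne hle x
    · have hconj := holderConjugate_toReal hs hr hsr
      obtain ⟨ξ', hξ'm, hξξ'⟩ : ∃ ξ' : Rd d → ℂ, Measurable ξ' ∧ ξ =ᵐ[volume] ξ' :=
        ⟨hξ.1.mk ξ, hξ.1.stronglyMeasurable_mk.measurable, hξ.1.ae_eq_mk⟩
      refine ⟨ξ', hξ'm, hξξ', fun x => ?_⟩
      have hs0 : s ≠ 0 := fun h0 => by simp [h0] at hsr
      rw [eLpNorm_congr_ae hξξ', eLpNorm_eq_lintegral_rpow_enorm_toReal hs0 hs]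
      exact lintegral_besselKernel_mul_le_of_holder hξ'm hu'm hconj x
  have henergy : ∀ x, energy (volume.withDensity fun x => ‖h x‖ₑ)
      (fun y => (((besselKernel (1 - γ) (x - y)).toReal : ℝ) : ℂ) * (ξ' y * u' y)) ≤
        Q ^ 2 * kernelAverage γ r u' x ^ (2 * (1 / r)) := by
    intro x
    have hHm : Measurable fun y =>
        (((besselKernel (1 - γ) (x - y)).toReal : ℝ) : ℂ) * (ξ' y * u' y) :=
      (((measurable_besselKernel_sub (1 - γ)).comp measurable_prodMk_left).ennreal_toReal
        |>.complex_ofReal).mul (hξ'm.mul hu'm)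
    refine (energy_withDensity_le hhm hle hHm).trans ?_
    calc _ ≤ N * (eLpNorm ξ s volume * kernelAverage γ r u' x ^ (1 / r)) ^ 2 :=
          mul_le_mul' le_rfl (pow_le_pow_left' (hint x) 2)
      _ = _ := by
          rw [hQ2, mul_pow, mul_assoc, mul_comm 2 (1 / r), ENNReal.rpow_mul]
          norm_num
  have hξ's : MemLp ξ' s volume := hξ.ae_eq hξξ'
  have hu'p : MemLp u' (ENNReal.ofReal p) volume := hu.ae_eq huu'
  obtain ⟨T, hT, hle⟩ := exists_distribution_besselNorm_le hd (hh.isNonnegDefDist hrep)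
    (eq_integral_withDensity hf hh.1 hrep) (by positivity)
    (temperedMass_withDensity_lt_top hhm hNt hle) he hγ hp0
    (hξ'm.mul hu'm) (one_le_inv_of_inv_add_inv hr hp hsr le_rfl) (memLp_mul_inv hξ's hu'p)
  refine ⟨T, fun i => (hT i).congr_ae ?_, hle.trans ?_⟩
  · filter_upwards [hξξ', huu'] with x h1 h2
    rw [Pi.mul_apply, h1, h2]
  · have hF := lintegral_kernelAverage_rpow_le (γ := γ) hu'm hr0 (p := p) (by linarith)
    have hpr : p / r = p * (1 / r) := by ring
    rw [hpr] at hF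
    refine (lintegral_rpow_rpow_le hp0 hQt henergy hF).trans (le_of_eq ?_)
    rw [hQ, eLpNorm_besselKernel hr0, eLpNorm_congr_ae huu',
      eLpNorm_eq_lintegral_rpow_enorm_toReal (by simpa using hp0) ENNReal.ofReal_ne_top,
      ENNReal.toReal_ofReal hp0.le]

end ColoredNoise

theorem lemma4p4 {d : ℕ} (hd : 1 ≤ d) {ι : Type*} [Countable ι]
    (f : 𝓢'(Rd d, ℂ)) (e : ι → 𝓢(Rd d, ℂ)) (he : IsNoiseBasis f e) :
    -- part (a)
    (IsNonnegDist f → IsNonnegDefDist f →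
      ∀ μ : Measure (Rd d), IsCorrespondingMeasure f μ →
      ∀ k : ℝ, 0 ≤ k → temperedMass μ k < ⊤ →
      ∀ (γ : ℝ) (s : ℝ≥0∞), Admissible μ γ s →
      ∀ r p : ℝ, s⁻¹ + (ENNReal.ofReal r)⁻¹ = 1 → 2 ≤ 2 * r → 2 * r ≤ p →
        kernelIntegral μ k γ r < ⊤ ∧
        ∀ ξ u : Rd d → ℂ, MemLp ξ (2 * s) volume → MemLp u (ENNReal.ofReal p) volume →
          ∃ T : ι → 𝓢'(Rd d, ℂ),
            (∀ i, IsRepresentedBy (T i) (fun x => ξ x * u x * distConv f (e i) x)) ∧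
            besselNorm (γ - 1) p T ≤
              temperedMass μ k ^ (1 / (2 * s)).toReal * kernelIntegral μ k γ r ^ (1 / (2 * r)) *
                eLpNorm ξ (2 * s) volume * eLpNorm u (ENNReal.ofReal p) volume) ∧
    -- part (b)
    (IsNonnegDist f → ∀ h : Rd d → ℂ, IsNonnegDefFun h → IsRepresentedBy f h →
      ∀ (γ : ℝ) (s : ℝ≥0∞), 0 ≤ γ → γ < 1 → 1 < s → ENNReal.ofReal (d / (1 - γ)) < s →
      ∀ r p : ℝ, s⁻¹ + (ENNReal.ofReal r)⁻¹ = 1 → 2 ≤ 2 * r → 2 * r ≤ p →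
        (⨆ x, ‖h x‖ₑ) < ⊤ ∧
        eLpNorm (besselKernel (d := d) (1 - γ)) (ENNReal.ofReal r) volume < ⊤ ∧
        ∀ ξ u : Rd d → ℂ, MemLp ξ s volume → MemLp u (ENNReal.ofReal p) volume →
          ∃ T : ι → 𝓢'(Rd d, ℂ),
            (∀ i, IsRepresentedBy (T i) (fun x => ξ x * u x * distConv f (e i) x)) ∧
            besselNorm (γ - 1) p T ≤
              (⨆ x, ‖h x‖ₑ) ^ (1 / 2 : ℝ) * eLpNorm ξ s volume *
                eLpNorm (besselKernel (d := d) (1 - γ)) (ENNReal.ofReal r) volume *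
                eLpNorm u (ENNReal.ofReal p) volume) := by
  refine ⟨fun _ hfd μ hμf k hk hμ γ s hadm r p hsr hr hp => ?_,
    fun hf h hh hrep γ s _ hγ _ hs r p hsr hr hp => ?_⟩
  · have hr1 : 1 ≤ r := by linarith
    have hγ : γ < 1 := by
      rcases hadm with ⟨_, _, h, _⟩ | ⟨_, _, h, _⟩ <;> linarith
    exact ⟨kernelIntegral_lt_top hd hk hμ hadm hr1 hsr, fun ξ u hξ hu =>
      exists_distribution_besselNorm_le_kernelIntegral hd hfd hμf.2 hk hμ he hγ hr1 hp hsr hξ hu⟩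
  · have hr1 : 1 ≤ r := by linarith
    exact ⟨iSup_enorm_lt_top hf hh hrep, eLpNorm_besselKernel_lt_top hd hγ hr1 hsr hs,
      fun ξ u hξ hu =>
        exists_distribution_besselNorm_le_iSup hd hf hh hrep he hγ hr1 hp hsr hξ hu⟩
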